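/- **Setting.** Minkowski space has signature $(+,-,-,-)$. Let $f_{abc}$ be real, completely antisymmetric structure constants satisfying the Jacobi identity, $[\xi_a,\xi_b]=if_{abc}\xi_c$, $\langle\xi_a|\xi_b\rangle=\delta_{ab}$, and $\pi$ a finite-dimensional matrix representation. Lie-algebra valued fields are $X=X_a\xi_a$, with $i[X,Z]=-f_{abc}X_aZ_b\,\xi_c$ and $\langle X|Z\rangle=X_aZ_a$; all products are Wick-ordered. The linear free fields are: massless gluon field strengths $F_{\mu\nu}$ (free Maxwell equations), the string-localized potential $$A_\mu(x)=A_\mu(x,c)=\int d\sigma(e)\,c(e)\int_0^\infty ds\,F_{\mu\nu}(x+se)e^\nu ,$$ and $w(x)=\int d\sigma(e)\,b^\kappa(e)\int_0^\infty s\,ds\,F_{\kappa\nu}(x+se)e^\nu$, where $d\sigma$ is the Lorentz invariant measure on $H_1=\{e^2=-1\}$, $c$ is a smooth compactly supported function of total weight $1$, and the variation $\delta c$ of $c$ is the divergence given by the smooth compactly supported tangent vector field $b$, with the sign $\int d\sigma\,\delta c\,h=\int d\sigma\,b^\kappa\partial_\kappa h$ (so that $\delta_cA_\mu=\partial_\mu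 w$); and the massless quark fields $\psi,\bar\psi$, with $j_a^\mu=\bar\psi\gamma^\mu\pi(\xi_a)\psi$, $j^\mu=j^\mu_a\xi_a$. Write $I^\nu k(x)=\int d\sigma(e)\,c(e)e^\nu\int_0^\infty ds\,k(x+se)$, $I'^\nu$ for the same operation on $x'$, a prime for fields at $x'$, $\delta_{xx'}=\delta(x-x')$, $\mathfrak S_{xx'}$ for the average over the exchange of $x,x'$, and $[\cdot\,\cdot]$ on indices for antisymmetrization without factor. For Wick polynomials $Y^\mu,X$ the tree-level obstruction is $$O_Y(X')=\sum_{\varphi,\chi}\frac{\partial Y^\mu}{\partial\varphi}(x)\,O_\mu(\varphi(x),\chi(x'))\,\frac{\partial X}{\partial\chi}(x'),\qquad O_\mu(\varphi,\chi')=\langle T\,\partial_\mu\varphi\,\chi'\rangle-\partial_\mu\langle T\varphi\chi'\rangle ,$$ the sum running over the linear fields. Here $\langle TF_{\mu\nu}F'_{\kappa\lambda}\rangle=\delta_{ab}\big(-\partial_{[\mu}\eta_{\nu][\kappa}\partial_{\lambda]}T_0(x-x')-c_F\,\eta_{\mu[\kappa}\eta_{\lambda]\nu}\,i\delta_{xx'}\big)$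 with the massless time-ordered two-point function $T_0$ (so that $\square T_0=-i\delta$) and a constant $c_F$; the propagators involving $A$ and $w$ are the string integrals of the unrenormalized ($c_F=0$) $\langle TFF'\rangle$; $\langle T\psi\bar\psi'\rangle=i\gamma^\mu\partial_\mu T_0$; and the propagators $\langle T\,\partial_\mu\varphi\,\chi'\rangle$ are any that respect the free equations of motion $\partial^\mu F_{\mu\nu}=0$, $\partial_\mu A_\nu-\partial_\nu A_\mu=F_{\mu\nu}$, $\partial^\mu A_\mu=0$, $\gamma^\mu\partial_\mu\psi=0$, $\partial_\mu\bar\psi\gamma^\mu=0$ under the time-ordering and satisfy $\langle T\,\partial_\mu w\,\chi'\rangle=\partial_\mu\langle Tw\chi'\rangle$. Let $$L_{1,\rm YM}=\tfrac12\langle F^{\mu\nu}|i[A_\mu,A_\nu]\rangle,\quad Q^\mu_{1,\rm YM}=\langle F^{\mu\nu}|i[w,A_\nu]\rangle,\quad L_{1,\rm min}=\langle A_\mu|j^\mu\rangle,\quad Q^\mu_{1,\rm min}=\langle w|j^\mu\rangle,$$ $$w_2(x,x')=i[w',A'_\nu]\cdot I^\nu\delta_{xx'},\qquad L_{2,\rm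 YM}=-\tfrac12(1+c_F)\langle i[A^\mu,A^\nu]|i[A_\mu,A_\nu]\rangle,$$ $$Q^\mu_{2,\rm YM}(x;x')=-2(1+c_F)\langle i[A^\mu,A^\nu]|i[w,A_\nu]\rangle\,\delta_{xx'}-2\langle i[F^{\mu\nu},A_\nu](x)|w_2(x,x')\rangle .$$ **Proposition.** For string-localized QCD with massless quarks, $L_1=L_{1,\rm YM}+L_{1,\rm min}$, $Q_1=Q_{1,\rm YM}+Q_{1,\rm min}$, the second-order obstruction is resolved, $$2\,\mathfrak S_{xx'}\,O_{Q_1}(L_1')=\delta_cL_2(x)\cdot i\delta_{xx'}-i\,\mathfrak S_{xx'}\,\partial^x_\mu Q_2^\mu(x;x'),$$ with $L_2=L_{2,\rm YM}+L_{2,\rm min}$, $Q_2=Q_{2,\rm YM}+Q_{2,\rm min}$, where $$L_{2,\rm min}=0,\qquad Q^\mu_{2,\rm min}(x;x')=2\langle j^\mu(x)|w_2(x,x')\rangle .$$ Moreover, the quark-only obstruction is cancelled by the local part of the quark–gluon cross-term ("lock-key"): $$O_{Q_{1,\rm min}}(L'_{1,\rm min})=\langle i[w,A_\nu]|j^\nu\rangle\,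 i\delta_{xx'},\qquad O_{Q_{1,\rm YM}}(L'_{1,\rm min})=-\langle i[w,A_\nu]|j'^\kappa\rangle\,(\delta^\nu_\kappa-I'^\nu\partial_\kappa)\,i\delta_{xx'},$$ and the other cross-term vanishes, $O_{Q_{1,\rm min}}(L'_{1,\rm YM})=0$. -/

import Mathlib

open MeasureTheory Filter Topology
open scoped TensorProduct ContDiff

/-!  Conventions.  Minkowski space is `ℝ⁴` with signature `(+,-,-,-)`.  The components of `F`, `A`
and of derivatives are covariant (lower indices), those of `e`, `b`, `j` and of the `Q` fields are
contravariant; an index is moved by the sign `sgn μ`. -/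

noncomputable section

namespace StringQCD

/-! ### Minkowski space -/

/-- Space-time. -/
abbrev Spt := Fin 4 → ℝ

/-- The diagonal entries of the metric. -/
def sgn (μ : Fin 4) : ℂ := if μ = 0 then 1 else -1

/-- The metric tensor. -/
def eta (μ ν : Fin 4) : ℂ := if μ = ν then sgn μ else 0

/-- The Minkowski square `x² = (x⁰)² - |x|²`. -/
def minkSq (x : Spt) : ℝ := x 0 ^ 2 - (x 1 ^ 2 + x 2 ^ 2 + x 3 ^ 2)

/-- The partial derivative `∂_μ` of a function on space-time. -/
def pd (μ : Fin 4) (f : Spt → ℂ) (x : Spt) : ℂ := fderiv ℝ f x (Pi.single μ 1)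

/-- The Lorentz invariant measure `dσ` on the hyperboloid `H₁ = {e | e² = -1}`, in its cone
form: `d⁴x = r³ dr dσ(e)` for `x = r e` spacelike, so that `dσ` is four times the image of
Lebesgue measure on `{-1 < x² < 0}` under `x ↦ x / √(-x²)`. -/
def sigma : Measure Spt :=
  (4 : ENNReal) • (volume.restrict {x : Spt | -1 < minkSq x ∧ minkSq x < 0}).map
    (fun x => (Real.sqrt (-minkSq x))⁻¹ • x)

/-- A string smearing function `c` of unit weight on `H₁`, together with a variation `δc`.
Smooth functions with compact support on `H₁` are given as restrictions of such functions on `ℝ⁴`.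
The variation is a divergence on `H₁` (`b` is the vector field; it is automatically tangent),
expressed weakly:  `∫ δc f dσ = ∫ b^κ ∂_κ f dσ` for all `f` that are smooth near `H₁`. -/
structure Smearing where
  c : Spt → ℝ
  dc : Spt → ℝ
  b : Fin 4 → Spt → ℝ
  c_smooth : ContDiff ℝ ∞ c
  c_supp : HasCompactSupport c
  dc_smooth : ContDiff ℝ ∞ dc
  dc_supp : HasCompactSupport dc
  b_smooth : ∀ κ, ContDiff ℝ ∞ (b κ)
  b_supp : ∀ κ, HasCompactSupport (b κ)
  c_weight : ∫ e, c e ∂sigma = 1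
  dc_div : ∀ f : Spt → ℂ, ContDiffOn ℝ ∞ f {e | minkSq e < 0} →
    ∫ e, (dc e : ℂ) * f e ∂sigma = ∫ e, ∑ κ, (b κ e : ℂ) * pd κ f e ∂sigma

/-! ### Lie algebra and Dirac matrices -/

/-- Completely antisymmetric structure constants, `[ξ_a, ξ_b] = i f_{abc} ξ_c` with
`⟨ξ_a | ξ_b⟩ = δ_{ab}`, and a matrix representation `π`. -/
structure ColorData (ι κ : Type*) [Fintype ι] [Fintype κ] where
  f : ι → ι → ι → ℝ
  f_antisymm : ∀ a b c, f b a c = -f a b c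
  f_cyclic : ∀ a b c, f b c a = f a b c
  jacobi : ∀ a b c e, ∑ d, (f a b d * f d c e + f b c d * f d a e + f c a d * f d b e) = 0
  rep : ι → Matrix κ κ ℂ
  rep_comm : ∀ a b, rep a * rep b - rep b * rep a = ∑ c, (Complex.I * (f a b c : ℂ)) • rep c

/-- Dirac matrices `γ^μ` (in any representation): `γ^μ γ^ν + γ^ν γ^μ = 2 η^{μν}`. -/
structure DiracMatrices where
  γ : Fin 4 → Matrix (Fin 4) (Fin 4) ℂ
  clifford : ∀ μ ν, γ μ * γ ν + γ ν * γ μ = (2 * eta μ ν) • (1 : Matrix (Fin 4) (Fin 4) ℂ)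

/-! ### Wick polynomials -/

/-- The linear gluon fields: the field strength `F_{μν}^a`, the string-localized potential
`A_μ^a(c)` and `w^a`.  Both `F_{μν}` and `F_{νμ}` are listed; they are negatives of each other in
all values and in all propagators, so that sums over the linear fields are sums over all
`(μ, ν)`. -/
inductive Boson (ι : Type*) where
  | F (μ ν : Fin 4) (a : ι)
  | A (μ : Fin 4) (a : ι)
  | w (a : ι)
  deriving DecidableEq, Fintype

/-- The components of the quark field `ψ` and of its conjugate `ψ̄` (spinor and color index). -/
inductive Quark (κ : Type*) where
  | psi (α : Fin 4) (m : κ)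
  | bar (α : Fin 4) (m : κ)
  deriving DecidableEq, Fintype

/-- The linear fields. -/
abbrev LinField (ι κ : Type*) := Boson ι ⊕ Quark κ

/-- The algebra of Wick polynomials in the linear fields: the free graded-commutative algebra,
commutative in the gluon fields and anticommutative in the quark fields. -/
abbrev Wick (ι κ : Type*) := MvPolynomial (Boson ι) ℂ ⊗[ℂ] ExteriorAlgebra ℂ (Quark κ → ℂ)

section WickAlgebra

variable {ι κ : Type*} [Fintype ι] [DecidableEq ι] [Fintype κ] [DecidableEq κ]

/-- A gluon field as a Wick polynomial. -/
def bos (i : Boson ι) : Wick ι κ := MvPolynomial.X i ⊗ₜ[ℂ] 1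

/-- A quark field as a Wick polynomial. -/
def quark (i : Quark κ) : Wick ι κ := 1 ⊗ₜ[ℂ] ExteriorAlgebra.ι ℂ (Pi.single i 1)

/-- The derivative `∂/∂φ`, acting from the left. -/
def dLeft : LinField ι κ → Wick ι κ →ₗ[ℂ] Wick ι κ
  | Sum.inl i => TensorProduct.map (MvPolynomial.pderiv i).toLinearMap LinearMap.id
  | Sum.inr i => TensorProduct.map LinearMap.id
      (CliffordAlgebra.contractLeft (Q := (0 : QuadraticForm ℂ (Quark κ → ℂ))) (LinearMap.proj i))

/-- The derivative `∂/∂φ`, acting from the right. -/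
def dRight : LinField ι κ → Wick ι κ →ₗ[ℂ] Wick ι κ
  | Sum.inl i => TensorProduct.map (MvPolynomial.pderiv i).toLinearMap LinearMap.id
  | Sum.inr i => TensorProduct.map LinearMap.id
      ((CliffordAlgebra.contractRight (Q := (0 : QuadraticForm ℂ (Quark κ → ℂ)))).flip
        (LinearMap.proj i))

/-- The bracket `i[X,Z]` of Lie-algebra valued fields `X = X_a ξ_a`, `Z = Z_a ξ_a`:
`i[X,Z]_c = -f_{abc} X_a Z_b`. -/
def br (D : ColorData ι κ) (X Z : ι → Wick ι κ) (c : ι) : Wick ι κ :=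
  ∑ a, ∑ b, (-(D.f a b c : ℂ)) • (X a * Z b)

/-- The inner product `⟨X | Z⟩ = X_a Z_a` of Lie-algebra valued fields. -/
def ip (X Z : ι → Wick ι κ) : Wick ι κ := ∑ a, X a * Z a

/-- The Lie-algebra valued `F_{μν}`. -/
def FF (μ ν : Fin 4) : ι → Wick ι κ := fun a => bos (.F μ ν a)

/-- The Lie-algebra valued `A_μ(c)`. -/
def AA (μ : Fin 4) : ι → Wick ι κ := fun a => bos (.A μ a)

/-- The Lie-algebra valued `w`. -/
def ww : ι → Wick ι κ := fun a => bos (.w a)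

/-- The quark current `j^μ_a = ψ̄ γ^μ π(ξ_a) ψ`. -/
def cur (D : ColorData ι κ) (G : DiracMatrices) (μ : Fin 4) : ι → Wick ι κ := fun a =>
  ∑ α, ∑ β, ∑ m, ∑ n, (G.γ μ α β * D.rep a m n) • (quark (.bar α m) * quark (.psi β n))

/-- `L_{1,YM} = ½ ⟨F^{μν} | i[A_μ, A_ν]⟩`. -/
def L1YM (D : ColorData ι κ) : Wick ι κ :=
  (1 / 2 : ℂ) • ∑ μ, ∑ ν, (sgn μ * sgn ν) • ip (FF μ ν) (br D (AA μ) (AA ν))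

/-- `Q^μ_{1,YM} = ⟨F^{μν} | i[w, A_ν]⟩`. -/
def Q1YM (D : ColorData ι κ) (μ : Fin 4) : Wick ι κ :=
  ∑ ν, (sgn μ * sgn ν) • ip (FF μ ν) (br D ww (AA ν))

/-- `L_{1,QCD,min} = ⟨A_μ | j^μ⟩`. -/
def L1min (D : ColorData ι κ) (G : DiracMatrices) : Wick ι κ := ∑ μ, ip (AA μ) (cur D G μ)

/-- `Q^μ_{1,QCD,min} = ⟨w | j^μ⟩`. -/
def Q1min (D : ColorData ι κ) (G : DiracMatrices) (μ : Fin 4) : Wick ι κ := ip ww (cur D G μ)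

/-- `L_{2,YM} = -½ (1+c_F) ⟨i[A^μ,A^ν] | i[A_μ,A_ν]⟩`. -/
def L2YM (D : ColorData ι κ) (cF : ℂ) : Wick ι κ :=
  (-(1 / 2 : ℂ) * (1 + cF)) •
    ∑ μ, ∑ ν, (sgn μ * sgn ν) • ip (br D (AA μ) (AA ν)) (br D (AA μ) (AA ν))

/-- `L_{2,QCD,min} = 0`. -/
def L2min : Wick ι κ := 0

/-- The coefficient of `δ_{xx'}` in `Q^μ_{2,YM}`:  `-2 (1+c_F) ⟨i[A^μ,A^ν] | i[w,A_ν]⟩`. -/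
def Q2YMdelta (D : ColorData ι κ) (cF : ℂ) (μ : Fin 4) : Wick ι κ :=
  (-2 * (1 + cF)) • ∑ ν, (sgn μ * sgn ν) • ip (br D (AA μ) (AA ν)) (br D ww (AA ν))

/-- The Lie-algebra valued `i[F^{μν}, A_ν]`. -/
def FAcur (D : ColorData ι κ) (μ : Fin 4) : ι → Wick ι κ := fun a =>
  ∑ ν, (sgn μ * sgn ν) • br D (FF μ ν) (AA ν) a

/-- Evaluation of Wick polynomials on given values of the linear fields: complex numbers for the
gluon fields, generators of a Grassmann algebra for the quark fields. -/
def evalWick {n : ℕ} (β : Boson ι → ℂ) (χ : Quark κ → Fin n → ℂ) :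
    Wick ι κ →ₐ[ℂ] ExteriorAlgebra ℂ (Fin n → ℂ) :=
  Algebra.TensorProduct.lift
    ((Algebra.ofId ℂ (ExteriorAlgebra ℂ (Fin n → ℂ))).comp (MvPolynomial.aeval β))
    (ExteriorAlgebra.map (Fintype.linearCombination ℂ χ))
    (fun p q => Algebra.commutes (MvPolynomial.aeval β p)
      (ExteriorAlgebra.map (Fintype.linearCombination ℂ χ) q))

end WickAlgebra

/-! ### Free fields

A Wick-ordered expression is identified with its normal symbol, i.e. with the function of the
classical solutions of the free field equations that it defines (Grassmann-valued for the quarks):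
two Wick-ordered expressions in free fields agree iff these functions do. -/

/-- A solution of the free Maxwell equations for the gluon field strengths (with values in `ℂ`),
with spacelike compact support, so that all string integrals converge. -/
structure GluonSolution (ι : Type*) where
  F : ι → Fin 4 → Fin 4 → Spt → ℂ
  smooth : ∀ a μ ν, ContDiff ℝ ∞ (F a μ ν)
  antisymm : ∀ a μ ν x, F a ν μ x = -F a μ ν x
  bianchi : ∀ a ρ μ ν x, pd ρ (F a μ ν) x + pd μ (F a ν ρ) x + pd ν (F a ρ μ) x = 0
  maxwell : ∀ a ν x, ∑ μ, sgn μ * pd μ (F a μ ν) x = 0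
  support : ∃ R : ℝ, ∀ a μ ν x,
    |x 0| + R < Real.sqrt (x 1 ^ 2 + x 2 ^ 2 + x 3 ^ 2) → F a μ ν x = 0

/-- The string-localized potential `A_μ(x,c) = ∫ dσ(e) c(e) ∫₀^∞ ds F_{μν}(x+se) e^ν`. -/
def potential {ι : Type*} (S : GluonSolution ι) (c : Spt → ℝ) (a : ι) (μ : Fin 4) (x : Spt) : ℂ :=
  ∫ e, (c e : ℂ) * (∫ s in Set.Ioi (0 : ℝ), ∑ ν, S.F a μ ν (x + s • e) * (e ν : ℂ)) ∂sigma

/-- `w(x,δc) = ∫ dσ(e) b^κ(e) ∫₀^∞ s ds F_{κν}(x+se) e^ν`. -/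
def wField {ι : Type*} (S : GluonSolution ι) (b : Fin 4 → Spt → ℝ) (a : ι) (x : Spt) : ℂ :=
  ∫ e, ∑ κ, (b κ e : ℂ) *
    (∫ s in Set.Ioi (0 : ℝ), ∑ ν, (s : ℂ) * S.F a κ ν (x + s • e) * (e ν : ℂ)) ∂sigma

/-- A Grassmann-valued solution of the massless Dirac equation and its conjugate:
`ψ = ∑_k θ_k u_k` and `ψ̄ = ∑_k θ_k v_k` with Grassmann generators `θ_k`. -/
structure QuarkSolution (κ : Type*) (G : DiracMatrices) (n : ℕ) where
  u : Fin 4 → κ → Fin n → Spt → ℂ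
  v : Fin 4 → κ → Fin n → Spt → ℂ
  u_smooth : ∀ α m k, ContDiff ℝ ∞ (u α m k)
  v_smooth : ∀ α m k, ContDiff ℝ ∞ (v α m k)
  dirac : ∀ α m k x, ∑ μ, ∑ β, G.γ μ α β * pd μ (u β m k) x = 0
  dirac_bar : ∀ β m k x, ∑ μ, ∑ α, pd μ (v α m k) x * G.γ μ α β = 0

section Values

variable {ι κ : Type*} [Fintype ι] [DecidableEq ι] [Fintype κ] [DecidableEq κ]

/-- The values of the gluon fields at `x`. -/
def gluonValue (S : GluonSolution ι) (c : Spt → ℝ) (b : Fin 4 → Spt → ℝ) (x : Spt) :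
    Boson ι → ℂ
  | .F μ ν a => S.F a μ ν x
  | .A μ a => potential S c a μ x
  | .w a => wField S b a x

/-- The values of the quark fields at `x`. -/
def quarkValue {G : DiracMatrices} {n : ℕ} (P : QuarkSolution κ G n) (x : Spt) :
    Quark κ → Fin n → ℂ
  | .psi α m => fun k => P.u α m k x
  | .bar α m => fun k => P.v α m k x

/-- The value of a Wick polynomial at `x`. -/
def value {G : DiracMatrices} {n : ℕ} (S : GluonSolution ι) (P : QuarkSolution κ G n)
    (c : Spt → ℝ) (b : Fin 4 → Spt → ℝ) (x : Spt) :
    Wick ι κ →ₐ[ℂ] ExteriorAlgebra ℂ (Fin n → ℂ) :=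
  evalWick (gluonValue S c b x) (quarkValue P x)

end Values

/-! ### Distributions in two points -/

/-- Functionals on test functions `g(x,x')`. -/
abbrev Kern := (Spt × Spt → ℂ) → ℂ

/-- Test functions. -/
def IsTest (g : Spt × Spt → ℂ) : Prop := ContDiff ℝ ∞ g ∧ HasCompactSupport g

/-- Linearity on test functions. -/
def Kern.IsLinear (K : Kern) : Prop :=
  (∀ g h, IsTest g → IsTest h → K (g + h) = K g + K h) ∧
    ∀ (z : ℂ) g, IsTest g → K (z • g) = z * K g

/-- `∂g/∂x^μ` for a test function `g(x,x')`. -/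
def pdx (μ : Fin 4) (g : Spt × Spt → ℂ) : Spt × Spt → ℂ :=
  fun z => fderiv ℝ g z (Pi.single μ 1, 0)

/-- The distributional derivative `∂_μ` with respect to `x`. -/
def Kern.dx (μ : Fin 4) (K : Kern) : Kern := fun g => -K (pdx μ g)

/-- The exchange of `x` and `x'`. -/
def Kern.swap (K : Kern) : Kern := fun g => K (fun z => g (z.2, z.1))

/-- The symmetrization (average) `𝔖_{xx'}`. -/
def Kern.symm (K : Kern) : Kern := fun g => (1 / 2 : ℂ) * (K g + K.swap g)

/-- A finite string in `x`: the distribution `∫ dσ(e) c(e) e^ν ∫₀^R ds K(x+se, x')`, tested with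
`g`, is `K` tested with this function. -/
def strX (c : Spt → ℝ) (ν : Fin 4) (R : ℝ) (g : Spt × Spt → ℂ) : Spt × Spt → ℂ := fun z =>
  ∫ e, (c e : ℂ) * (e ν : ℂ) * (∫ s in (0 : ℝ)..R, g (z.1 - s • e, z.2)) ∂sigma

/-- A finite string in `x'`: the distribution `∫ dσ(e) c(e) e^ν ∫₀^R ds K(x, x'+se)`, tested with
`g`, is `K` tested with this function. -/
def strX' (c : Spt → ℝ) (ν : Fin 4) (R : ℝ) (g : Spt × Spt → ℂ) : Spt × Spt → ℂ := fun z =>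
  ∫ e, (c e : ℂ) * (e ν : ℂ) * (∫ s in (0 : ℝ)..R, g (z.1, z.2 - s • e)) ∂sigma

/-- As `strX`, for `∫ dσ(e) b(e) e^ν ∫₀^R s ds K(x+se, x')`. -/
def strXw (b : Spt → ℝ) (ν : Fin 4) (R : ℝ) (g : Spt × Spt → ℂ) : Spt × Spt → ℂ := fun z =>
  ∫ e, (b e : ℂ) * (e ν : ℂ) * (∫ s in (0 : ℝ)..R, (s : ℂ) * g (z.1 - s • e, z.2)) ∂sigma

/-- `δ_{xx'} = δ(x-x')`. -/
def delta : Kern := fun g => ∫ x, g (x, x)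

/-- `I_c^ν δ_{xx'} = ∫ dσ(e) c(e) e^ν ∫₀^∞ ds δ(x+se-x')`. -/
def strDelta (c : Spt → ℝ) (ν : Fin 4) : Kern := fun g =>
  ∫ e, (c e : ℂ) * (e ν : ℂ) * (∫ s in Set.Ioi (0 : ℝ), ∫ x, g (x, x + s • e)) ∂sigma

/-- `I'_c^ν δ_{xx'} = ∫ dσ(e) c(e) e^ν ∫₀^∞ ds δ(x-x'-se)`. -/
def strDelta' (c : Spt → ℝ) (ν : Fin 4) : Kern := fun g =>
  ∫ e, (c e : ℂ) * (e ν : ℂ) * (∫ s in Set.Ioi (0 : ℝ), ∫ x, g (x, x - s • e)) ∂sigma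

/-! ### Propagators -/

/-- The time-ordered two-point function of the massless scalar field as a distribution on
`ℝ⁴`: `T₀(t,x) = ∫ d³p / ((2π)³ 2|p|) e^{-i|p||t|} e^{ip·x}`. -/
def T0 (h : Spt → ℂ) : ℂ :=
  ∫ t : ℝ, ∫ p : EuclideanSpace ℝ (Fin 3),
    (1 / ((2 * (Real.pi : ℂ)) ^ 3 * (2 * (‖p‖ : ℂ)))) *
      Complex.exp (-Complex.I * ((‖p‖ * |t| : ℝ) : ℂ)) *
      ∫ x : EuclideanSpace ℝ (Fin 3),
        Complex.exp (Complex.I * ((inner ℝ p x : ℝ) : ℂ)) * h ![t, x 0, x 1, x 2]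

/-- `T₀(x-x')`. -/
def T0K : Kern := fun g => T0 (fun y => ∫ x', g (x' + y, x'))

/-- The kinematic propagator
`⟨T F_{μν}(x) F_{κλ}(x')⟩ = -∂_{[μ} η_{ν][κ} ∂_{λ]} T₀(x-x')`  (without Lie-algebra factor). -/
def TFFkin (μ ν κ l : Fin 4) : Kern := fun g =>
  -(eta ν κ * (T0K.dx l).dx μ g - eta μ κ * (T0K.dx l).dx ν g
    - eta ν l * (T0K.dx κ).dx μ g + eta μ l * (T0K.dx κ).dx ν g)

/-- The renormalized propagator `⟨T F F'⟩`, with the term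
`-c_F η_{μ[κ} η_{λ]ν} · iδ_{xx'}` added. -/
def TFFren (cF : ℂ) (μ ν κ l : Fin 4) : Kern := fun g =>
  TFFkin μ ν κ l g - cF * (eta μ κ * eta l ν - eta μ l * eta κ ν) * (Complex.I * delta g)

/-- `K` is the string integral given by the finite strings `N R`, `R → ∞`. -/
def IsStringIntegral (K : Kern) (N : ℝ → Kern) : Prop :=
  ∀ g, IsTest g → Tendsto (fun R : ℝ => N R g) atTop (𝓝 (K g))

/-- The time-ordered two-point functions `⟨T φ(x) χ(x')⟩` and `⟨T ∂_μφ(x) χ(x')⟩` of the linear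
fields.  The former are kinematic: those of `F` and of the quarks are explicit (with the
renormalization of `⟨T F F'⟩`), and those of `A(c)` and `w` arise by string integration from the
unrenormalized `⟨T F F'⟩`, with `A_κ(c) = ∫ c ∫ ds F_{κλ} e^λ`, `w = ∫ b^κ ∫ s ds F_{κλ} e^λ`.
The latter respect the free equations of motion
`∂^μ F_{μν} = 0`, `∂_μ A_ν - ∂_ν A_μ = F_{μν}`, `∂^μ A_μ = 0`, `γ^μ ∂_μ ψ = 0`,
`∂_μ ψ̄ γ^μ = 0` under the time-ordering, and are kinematic for `w`.  They are otherwise arbitrary,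
and so are the propagators with `w` at the second point, which never contribute below. -/
structure TimeOrdering {ι κ : Type*} [DecidableEq ι] [DecidableEq κ]
    (G : DiracMatrices) (Sm : Smearing) (cF : ℂ) where
  T : LinField ι κ → LinField ι κ → Kern
  dT : Fin 4 → LinField ι κ → LinField ι κ → Kern
  T_linear : ∀ φ χ, (T φ χ).IsLinear
  dT_linear : ∀ μ φ χ, (dT μ φ χ).IsLinear
  -- gluon propagators
  T_F_F : ∀ μ ν a k l b g, IsTest g → T (.inl (.F μ ν a)) (.inl (.F k l b)) g =
    if a = b then TFFren cF μ ν k l g else 0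
  T_F_A : ∀ μ ν a k b, IsStringIntegral (T (.inl (.F μ ν a)) (.inl (.A k b)))
    (fun R g => if a = b then ∑ l, TFFkin μ ν k l (strX' Sm.c l R g) else 0)
  T_A_F : ∀ μ a k l b, IsStringIntegral (T (.inl (.A μ a)) (.inl (.F k l b)))
    (fun R g => if a = b then ∑ ν, TFFkin μ ν k l (strX Sm.c ν R g) else 0)
  T_A_A : ∀ μ a k b, IsStringIntegral (T (.inl (.A μ a)) (.inl (.A k b)))
    (fun R g => ∑ l, T (.inl (.A μ a)) (.inl (.F k l b)) (strX' Sm.c l R g))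
  T_w_F : ∀ a k l b, IsStringIntegral (T (.inl (.w a)) (.inl (.F k l b)))
    (fun R g => if a = b then ∑ ρ, ∑ ν, TFFkin ρ ν k l (strXw (Sm.b ρ) ν R g) else 0)
  T_w_A : ∀ a k b, IsStringIntegral (T (.inl (.w a)) (.inl (.A k b)))
    (fun R g => ∑ l, T (.inl (.w a)) (.inl (.F k l b)) (strX' Sm.c l R g))
  -- quark propagators: `⟨T ψ ψ̄'⟩ = i γ^μ ∂_μ T₀` and `⟨T ψ̄ ψ'⟩ = -⟨T ψ' ψ̄⟩`, transposed
  T_psi_bar : ∀ α m β n g, IsTest g → T (.inr (.psi α m)) (.inr (.bar β n)) g =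
    if m = n then ∑ μ, Complex.I * G.γ μ α β * T0K.dx μ g else 0
  T_bar_psi : ∀ α m β n g, IsTest g → T (.inr (.bar α m)) (.inr (.psi β n)) g =
    if m = n then ∑ μ, Complex.I * G.γ μ β α * T0K.dx μ g else 0
  T_psi_psi : ∀ α m β n g, IsTest g → T (.inr (.psi α m)) (.inr (.psi β n)) g = 0
  T_bar_bar : ∀ α m β n g, IsTest g → T (.inr (.bar α m)) (.inr (.bar β n)) g = 0
  T_gluon_quark : ∀ φ χ g, IsTest g → T (.inl φ) (.inr χ) g = 0
  T_quark_gluon : ∀ φ χ g, IsTest g → T (.inr φ) (.inl χ) g = 0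
  -- equations of motion under the time-ordering
  dT_F_antisymm : ∀ ρ μ ν a χ g, IsTest g →
    dT ρ (.inl (.F ν μ a)) χ g = -dT ρ (.inl (.F μ ν a)) χ g
  eom_F : ∀ ν a χ g, IsTest g → ∑ μ, sgn μ * dT μ (.inl (.F μ ν a)) χ g = 0
  eom_A : ∀ μ ν a χ g, IsTest g →
    dT μ (.inl (.A ν a)) χ g - dT ν (.inl (.A μ a)) χ g = T (.inl (.F μ ν a)) χ g
  eom_divA : ∀ a χ g, IsTest g → ∑ μ, sgn μ * dT μ (.inl (.A μ a)) χ g = 0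
  kin_w : ∀ μ a χ g, IsTest g → dT μ (.inl (.w a)) χ g = (T (.inl (.w a)) χ).dx μ g
  eom_psi : ∀ α m χ g, IsTest g → ∑ μ, ∑ β, G.γ μ α β * dT μ (.inr (.psi β m)) χ g = 0
  eom_bar : ∀ β m χ g, IsTest g → ∑ μ, ∑ α, dT μ (.inr (.bar α m)) χ g * G.γ μ α β = 0

/-! ### Obstructions -/

section Obstructions

variable {ι κ : Type*} [Fintype ι] [DecidableEq ι] [Fintype κ] [DecidableEq κ]
  {G : DiracMatrices} {Sm : Smearing} {cF : ℂ} {n : ℕ}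

/-- The two-point obstruction
`O_μ(φ(x),χ(x')) = ⟨T ∂_μφ(x) χ(x')⟩ - ∂_μ ⟨T φ(x) χ(x')⟩`. -/
def twoPoint (τ : TimeOrdering (ι := ι) (κ := κ) G Sm cF) (μ : Fin 4) (φ χ : LinField ι κ) :
    Kern :=
  fun g => τ.dT μ φ χ g - (τ.T φ χ).dx μ g

/-- The two-point field `:Y(x) X(x'): K(x,x')` for Wick polynomials `Y`, `X` and a numerical
distribution `K`, evaluated on classical solutions; `ℓ` selects a component of the Grassmann
algebra. -/
def bilocal (S : GluonSolution ι) (P : QuarkSolution κ G n) (Sm : Smearing)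
    (ℓ : Module.Dual ℂ (ExteriorAlgebra ℂ (Fin n → ℂ))) (Y X : Wick ι κ) (K : Kern) : Kern :=
  fun g => K (fun z => ℓ (value S P Sm.c Sm.b z.1 Y * value S P Sm.c Sm.b z.2 X) * g z)

/-- The (tree level) obstruction map
`O_Y(X') = ∑_{φ,χ} ∂Y^μ/∂φ (x) O_μ(φ(x),χ(x')) ∂X/∂χ (x')`. -/
def obs (τ : TimeOrdering (ι := ι) (κ := κ) G Sm cF) (S : GluonSolution ι)
    (P : QuarkSolution κ G n) (ℓ : Module.Dual ℂ (ExteriorAlgebra ℂ (Fin n → ℂ)))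
    (Y : Fin 4 → Wick ι κ) (X : Wick ι κ) : Kern :=
  fun g => ∑ μ, ∑ φ, ∑ χ,
    bilocal S P Sm ℓ (dRight φ (Y μ)) (dLeft χ X) (twoPoint τ μ φ χ) g

/-- The second-order obstruction `O^{(2)} = 2 𝔖_{xx'} O_{Q₁}(L₁')`. -/
def obs2 (τ : TimeOrdering (ι := ι) (κ := κ) G Sm cF) (S : GluonSolution ι)
    (P : QuarkSolution κ G n) (ℓ : Module.Dual ℂ (ExteriorAlgebra ℂ (Fin n → ℂ)))
    (Q1 : Fin 4 → Wick ι κ) (L1 : Wick ι κ) : Kern :=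
  fun g => 2 * (obs τ S P ℓ Q1 L1).symm g

/-- The string variation `δ_c L(x,c)`: the derivative of `L` in the direction `c + t δc`. -/
def varC (S : GluonSolution ι) (P : QuarkSolution κ G n) (Sm : Smearing)
    (ℓ : Module.Dual ℂ (ExteriorAlgebra ℂ (Fin n → ℂ))) (L : Wick ι κ) (x : Spt) : ℂ :=
  deriv (fun t : ℝ => ℓ (value S P (fun e => Sm.c e + t * Sm.dc e) Sm.b x L)) 0

/-- The pairing of a Lie-algebra valued field `Y(x)` with
`w₂(x,x') = i[w(x'), A_ν(x')] · I^ν δ_{xx'}`:  the two-point field `⟨Y(x) | w₂(x,x')⟩`. -/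
def pairW2 (D : ColorData ι κ) (S : GluonSolution ι) (P : QuarkSolution κ G n) (Sm : Smearing)
    (ℓ : Module.Dual ℂ (ExteriorAlgebra ℂ (Fin n → ℂ))) (Y : ι → Wick ι κ) : Kern :=
  fun g => ∑ a, ∑ ν, bilocal S P Sm ℓ (Y a) (br D ww (AA ν) a) (strDelta Sm.c ν) g

/-- `Q^μ_{2,YM}(x;x')`. -/
def Q2YM (D : ColorData ι κ) (cF : ℂ) (S : GluonSolution ι) (P : QuarkSolution κ G n)
    (Sm : Smearing) (ℓ : Module.Dual ℂ (ExteriorAlgebra ℂ (Fin n → ℂ))) (μ : Fin 4) : Kern :=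
  fun g => bilocal S P Sm ℓ (Q2YMdelta D cF μ) 1 delta g
    - 2 * pairW2 D S P Sm ℓ (FAcur D μ) g

/-- `Q^μ_{2,QCD,min}(x;x') = 2 ⟨j^μ(x) | w₂(x,x')⟩`. -/
def Q2min (D : ColorData ι κ) (S : GluonSolution ι) (P : QuarkSolution κ G n)
    (Sm : Smearing) (ℓ : Module.Dual ℂ (ExteriorAlgebra ℂ (Fin n → ℂ))) (μ : Fin 4) : Kern :=
  fun g => 2 * pairW2 D S P Sm ℓ (cur D G μ) g

/-- The right-hand side `δ_c L₂ · iδ_{xx'} - i 𝔖_{xx'} ∂_μ Q₂^μ(x;x')` of the resolution. -/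
def resolution (S : GluonSolution ι) (P : QuarkSolution κ G n) (Sm : Smearing)
    (ℓ : Module.Dual ℂ (ExteriorAlgebra ℂ (Fin n → ℂ))) (L2 : Wick ι κ) (Q2 : Fin 4 → Kern) :
    Kern :=
  fun g => Complex.I * delta (fun z => varC S P Sm ℓ L2 z.1 * g z)
    - Complex.I * Kern.symm (fun h => ∑ μ, (Q2 μ).dx μ h) g

end Obstructions

end StringQCD

end

namespace StringQCD

set_option linter.unusedSectionVars false

/-! ### Smooth parametric integrals over a compact set -/

section Parametric

variable {E V W : Type} [NormedAddCommGroup E] [NormedSpace ℝ E] [FiniteDimensional ℝ E]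
  [NormedAddCommGroup V] [NormedSpace ℝ V] [MeasurableSpace V] [BorelSpace V]
  [FiniteDimensional ℝ V]
  [NormedAddCommGroup W] [NormedSpace ℝ W] [FiniteDimensional ℝ W]

/-! The propagators ⟨T ∂φ χ'⟩ are largely arbitrary, but the obstruction of `Q₁` contains them only
in combinations that the free equations of motion fix. `Q_{1,YM}` depends on `F` through `F^{μν}`,
so the index of `∂_μ` is contracted with `F`. It depends on `A_ν` with the antisymmetric coefficient
`F^{μν}`, so only the curl of `A` enters. `Q_{1,min}` contains ψ and ψ̄ only inside the current, so
`∂_μ` comes with `γ^μ`. The field `w` is kinematic and contributes nothing. Each such combination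
reduces to a derivative of an explicit propagator, and its value is a delta function or a string
integral of one.

Two analytic facts about `T₀` produce these values. The first is the Green's function property □T₀ =
-iδ (`T0_box`), proved in momentum space: at fixed momentum, the time integral is that of a harmonic
oscillator with frequency |p|. It gives the contact terms in `TFFkin_maxwell` and `sum_gamma_T0K`.
The second is decay in spacelike directions (`tendsto_T0_avg`): the far end points of long strings
do not contribute, so the string integral over the kinematic ⟨T F F'⟩ has the expected curl
(`T_A_F_curl`). Decay follows from a Riemann-Lebesgue lemma, because the phase p·e - |e⁰||p| is
non-degenerate for spacelike `e`.

For classical fields, the Bianchi identity and the fundamental theorem of calculus along the string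
give the curl of `A` (`potential_curl`) and δ_c A = ∂w (`potential_variation`).

The rest is algebra. In the quark-only obstruction the ψ and ψ̄ contractions combine into the
commutator [π(ξ_a), π(ξ_b)], hence into ⟨i[w,A_ν]|j^ν⟩ iδ (`obs_Q1min_L1min`). The local part of the
cross-term `obs_Q1YM_L1min_eq` is the negative of this: the key fits the lock. In the pure
Yang-Mills part, the Jacobi identity makes all terms ⟨i[w,A]|i[F,A]⟩ cancel for every c_F. What is
left is (1+c_F) times a divergence and the variation of ⟨i[A,A]|i[A,A]⟩, together with a
string-localized term (`obs_Q1YM_L1YM`).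

The string-localized terms pair i[w,A_ν] at one point with a current at the other, namely j or
i[F,A]. Both currents are conserved (`isConserved_cur`, `isConserved_FAcur`), so these terms are
divergences of ⟨current | w₂⟩ up to the exchange of x and x' (`sum_strDelta'_smear`). The
symmetrization removes the exchange, and the result is `Q₂`. -/

theorem integrable_of_continuous_of_compact {m : Measure V} [IsFiniteMeasure m] {K : Set V}
    (hK : IsCompact K) (hm : ∀ᵐ v ∂m, v ∈ K) {f : V → W} (hf : Continuous f) : Integrable f m := by
  obtain ⟨C, hC⟩ := hK.exists_bound_of_continuousOn hf.continuousOn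
  exact Integrable.of_bound hf.aestronglyMeasurable C (hm.mono fun v hv => hC v hv)

theorem hasFDerivAt_integral_of_compact {m : Measure V} [IsFiniteMeasure m] {K : Set V}
    (hK : IsCompact K) (hm : ∀ᵐ v ∂m, v ∈ K) {H : E → V → W}
    (hH : ContDiff ℝ 1 (Function.uncurry H)) (x : E) :
    HasFDerivAt (fun x => ∫ v, H x v ∂m)
      (∫ v, (fderiv ℝ (Function.uncurry H) (x, v)).comp (ContinuousLinearMap.inl ℝ E V) ∂m) x := by
  have hc : Continuous fun z : E × V =>
      (fderiv ℝ (Function.uncurry H) z).comp (ContinuousLinearMap.inl ℝ E V) :=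
    (hH.continuous_fderiv one_ne_zero).clm_comp continuous_const
  -- The derivative is bounded on the compact product of a ball around `x` with `K`. This constant
  -- is the dominating function.
  obtain ⟨C, hC⟩ := ((isCompact_closedBall x 1).prod hK).exists_bound_of_continuousOn
    hc.continuousOn
  refine hasFDerivAt_integral_of_dominated_of_fderiv_le (s := Metric.closedBall x 1)
    (F' := fun x v => (fderiv ℝ (Function.uncurry H) (x, v)).comp (ContinuousLinearMap.inl ℝ E V))
    (bound := fun _ => C)
    (Metric.closedBall_mem_nhds x one_pos) ?_ ?_ ?_ ?_ (integrable_const C) ?_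
  · exact .of_forall fun y =>
      (hH.continuous.comp (continuous_const.prodMk continuous_id)).aestronglyMeasurable
  · exact integrable_of_continuous_of_compact hK hm
      (hH.continuous.comp (continuous_const.prodMk continuous_id))
  · exact (hc.comp (continuous_const.prodMk continuous_id)).aestronglyMeasurable
  · exact hm.mono fun v hv y hy => hC (y, v) ⟨hy, hv⟩
  · refine .of_forall fun v y _ => ?_
    exact ((hH.differentiable one_ne_zero) (y, v)).hasFDerivAt.comp (f := fun e => (e, v)) y
      (hasFDerivAt_prodMk_left y v)

/-- The derivative in the parameter is an integral of the same kind with values in `E →L[ℝ] W`, so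
the induction has to range over all target spaces `W`. -/
theorem contDiff_nat_integral_of_compact (n : ℕ) : ∀ {W : Type} [NormedAddCommGroup W]
    [NormedSpace ℝ W] [FiniteDimensional ℝ W] {m : Measure V} [IsFiniteMeasure m] {K : Set V}
    (_ : IsCompact K) (_ : ∀ᵐ v ∂m, v ∈ K) {H : E → V → W}
    (_ : ContDiff ℝ ∞ (Function.uncurry H)), ContDiff ℝ n (fun x => ∫ v, H x v ∂m) := by
  induction n with
  | zero =>
    intro W _ _ _ m _ K hK hm H hH
    refine contDiff_zero.2 (continuous_iff_continuousAt.2 fun x => ?_)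
    exact (hasFDerivAt_integral_of_compact hK hm
      (hH.of_le (by exact_mod_cast le_top)) x).continuousAt
  | succ n ih =>
    intro W _ _ _ m _ K hK hm H hH
    have hd := fun x => hasFDerivAt_integral_of_compact hK hm
      (hH.of_le (by exact_mod_cast le_top)) x
    push_cast
    refine contDiff_succ_iff_fderiv.2 ⟨fun x => (hd x).differentiableAt, by simp, ?_⟩
    rw [show fderiv ℝ (fun x => ∫ v, H x v ∂m) = _ from funext fun x => (hd x).fderiv]
    exact ih hK hm (H := fun x v => (fderiv ℝ (Function.uncurry H) (x, v)).comp
      (ContinuousLinearMap.inl ℝ E V)) ((hH.fderiv_right (m := ∞) (by simp)).clm_comp contDiff_const)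

/-- Integrals of smooth functions over a compact set of parameters are smooth. -/
theorem contDiff_integral_of_compact {m : Measure V} [IsFiniteMeasure m] {K : Set V}
    (hK : IsCompact K) (hm : ∀ᵐ v ∂m, v ∈ K) {H : E → V → W}
    (hH : ContDiff ℝ ∞ (Function.uncurry H)) : ContDiff ℝ ∞ (fun x => ∫ v, H x v ∂m) :=
  contDiff_infty.2 fun n => contDiff_nat_integral_of_compact n hK hm hH

theorem fderiv_integral_of_compact {m : Measure V} [IsFiniteMeasure m] {K : Set V}
    (hK : IsCompact K) (hm : ∀ᵐ v ∂m, v ∈ K) {H : E → V → W}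
    (hH : ContDiff ℝ ∞ (Function.uncurry H)) (x y : E) :
    fderiv ℝ (fun x => ∫ v, H x v ∂m) x y = ∫ v, fderiv ℝ (fun x => H x v) x y ∂m := by
  have h1 : ContDiff ℝ 1 (Function.uncurry H) := hH.of_le (by exact_mod_cast le_top)
  rw [(hasFDerivAt_integral_of_compact hK hm h1 x).fderiv, ContinuousLinearMap.integral_apply]
  · refine integral_congr_ae (.of_forall fun v => ?_)
    have := ((h1.differentiable one_ne_zero) (x, v)).hasFDerivAt.comp
      (f := fun e => (e, v)) x (hasFDerivAt_prodMk_left x v)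
    exact congrArg (fun L : E →L[ℝ] W => L y) this.fderiv.symm
  · exact integrable_of_continuous_of_compact hK hm
      (((h1.continuous_fderiv one_ne_zero).clm_comp continuous_const).comp
        (continuous_const.prodMk continuous_id))

end Parametric

/-! ### The measure on the hyperboloid -/

theorem continuous_minkSq : Continuous minkSq := by unfold minkSq; fun_prop

theorem measurable_normalize : Measurable fun x : Spt => (Real.sqrt (-minkSq x))⁻¹ • x := by
  have := continuous_minkSq.measurable
  fun_prop

theorem sigma_ae : ∀ᵐ e ∂sigma, minkSq e = -1 := by
  unfold sigma
  refine Measure.ae_smul_measure ?_ _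
  refine (ae_map_iff measurable_normalize.aemeasurable
    (measurableSet_eq_fun continuous_minkSq.measurable measurable_const)).2 ?_
  have hms : MeasurableSet {x : Spt | -1 < minkSq x ∧ minkSq x < 0} :=
    ((isOpen_lt continuous_const continuous_minkSq).inter
      (isOpen_lt continuous_minkSq continuous_const)).measurableSet
  filter_upwards [ae_restrict_mem hms] with x hx
  have h : minkSq ((Real.sqrt (-minkSq x))⁻¹ • x) = ((Real.sqrt (-minkSq x))⁻¹) ^ 2 * minkSq x := by
    simp only [minkSq, Pi.smul_apply, smul_eq_mul]; ring
  rw [h, inv_pow, Real.sq_sqrt (by linarith [hx.2])]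
  field_simp [hx.2.ne]

/-- On the region -1 < x² < 0 the factor √(-x²) is at most 1. A point whose normalization has norm
at most `M` therefore has norm at most `M` itself, and a ball has finite volume. -/
instance : IsFiniteMeasureOnCompacts sigma where
  lt_top_of_isCompact K hK := by
    obtain ⟨M, hM⟩ := hK.isBounded.exists_norm_le
    unfold sigma
    rw [Measure.smul_apply, Measure.map_apply measurable_normalize hK.measurableSet]
    refine ENNReal.mul_lt_top (by simp) ?_
    have hms : MeasurableSet {x : Spt | -1 < minkSq x ∧ minkSq x < 0} :=
      ((isOpen_lt continuous_const continuous_minkSq).inter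
        (isOpen_lt continuous_minkSq continuous_const)).measurableSet
    rw [Measure.restrict_apply' hms]
    refine (measure_mono ?_).trans_lt (measure_closedBall_lt_top (x := (0 : Spt)) (r := M))
    rintro x ⟨hx, h1, h2⟩
    have hs : 0 < Real.sqrt (-minkSq x) := Real.sqrt_pos.2 (by linarith)
    have hs1 : Real.sqrt (-minkSq x) ≤ 1 := Real.sqrt_le_one.2 (by linarith)
    have := hM _ hx
    rw [norm_smul, norm_inv, Real.norm_of_nonneg hs.le, inv_mul_le_iff₀ hs] at this
    rw [mem_closedBall_zero_iff]
    nlinarith [norm_nonneg x, (norm_nonneg _).trans (hM _ hx)]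

instance : SFinite sigma := by unfold sigma; infer_instance

/-! ### The spatial Fourier transform -/

/-- Momentum space. -/
abbrev E3 := EuclideanSpace ℝ (Fin 3)

/-- Space-time as the product of time and space. -/
noncomputable def embL : (ℝ × E3) →L[ℝ] Spt :=
  ContinuousLinearMap.pi (Fin.cons (ContinuousLinearMap.fst ℝ ℝ E3)
    (fun j : Fin 3 => (EuclideanSpace.proj j).comp (ContinuousLinearMap.snd ℝ ℝ E3)))

theorem embL_apply (t : ℝ) (x : E3) : embL (t, x) = ![t, x 0, x 1, x 2] := by
  ext i; fin_cases i <;> rfl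

theorem embL_time : embL (1, 0) = Pi.single 0 1 := by
  ext i; fin_cases i <;> simp [embL_apply]

theorem embL_space (j : Fin 3) : embL (0, EuclideanSpace.single j 1) = Pi.single j.succ 1 := by
  ext i; fin_cases i <;> fin_cases j <;> simp [embL_apply]

/-- Test functions on space-time. -/
def IsTest1 (h : Spt → ℂ) : Prop := ContDiff ℝ ∞ h ∧ HasCompactSupport h

theorem IsTest1.pd {h : Spt → ℂ} (hh : IsTest1 h) (μ : Fin 4) : IsTest1 (pd μ h) :=
  ⟨(hh.1.fderiv_right (m := ∞) (by simp)).clm_apply contDiff_const,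
    hh.2.fderiv_apply ℝ (Pi.single μ 1)⟩

theorem IsTest1.add {h k : Spt → ℂ} (hh : IsTest1 h) (hk : IsTest1 k) : IsTest1 (h + k) :=
  ⟨hh.1.add hk.1, hh.2.add hk.2⟩

theorem IsTest1.smul {h : Spt → ℂ} (hh : IsTest1 h) (z : ℂ) : IsTest1 (z • h) :=
  ⟨contDiff_const.smul hh.1, hh.2.smul_left (f := fun _ => z)⟩

theorem IsTest1.exists_bound {h : Spt → ℂ} (hh : IsTest1 h) :
    ∃ M : ℝ, 0 ≤ M ∧ ∀ t (x : E3), h (embL (t, x)) ≠ 0 → |t| ≤ M ∧ ‖x‖ ≤ M := by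
  obtain ⟨M, hM⟩ := hh.2.isCompact.isBounded.exists_norm_le
  -- The norm on `Spt` is the supremum norm; the Euclidean norm of the spatial part exceeds it by a
  -- factor of at most √3 ≤ 2.
  have h3 : ∀ t (x : E3), h (embL (t, x)) ≠ 0 → |t| ≤ M ∧ ‖x‖ ≤ 2 * M := by
    intro t x hx
    have h1 := hM _ (subset_tsupport _ hx)
    have h2 := fun i => (norm_le_pi_norm (embL (t, x)) i).trans h1
    have M0 : 0 ≤ M := (norm_nonneg _).trans h1
    rw [embL_apply] at h2
    refine ⟨by simpa using h2 0, ?_⟩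
    have a := h2 1; have b := h2 2; have c := h2 3
    simp at a b c
    rw [EuclideanSpace.norm_eq, Fin.sum_univ_three]
    refine Real.sqrt_le_iff.2 ⟨by positivity, ?_⟩
    simp only [Real.norm_eq_abs]
    nlinarith [abs_nonneg (x 0), abs_nonneg (x 1), abs_nonneg (x 2)]
  refine ⟨2 * |M|, by positivity, fun t x hx => ?_⟩
  have := h3 t x hx
  have h4 := le_abs_self M
  constructor <;> linarith [abs_nonneg M, this.1, this.2]

/-- The Fourier transform in space at time `t`. -/
noncomputable def spFT (h : Spt → ℂ) (t : ℝ) (p : E3) : ℂ :=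
  ∫ x : E3, Complex.exp (Complex.I * ((inner ℝ p x : ℝ) : ℂ)) * h (embL (t, x))

theorem contDiff_spFT_integrand {h : Spt → ℂ} (hh : IsTest1 h) :
    ContDiff ℝ ∞ (Function.uncurry fun (z : ℝ × E3) (x : E3) =>
      Complex.exp (Complex.I * ((inner ℝ z.2 x : ℝ) : ℂ)) * h (embL (z.1, x))) := by
  have h1 : ContDiff ℝ ∞ fun q : (ℝ × E3) × E3 => h (embL (q.1.1, q.2)) :=
    hh.1.comp (embL.contDiff.comp (by fun_prop))
  have h2 : ContDiff ℝ ∞ fun q : (ℝ × E3) × E3 => ((inner ℝ q.1.2 q.2 : ℝ) : ℂ) :=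
    Complex.ofRealCLM.contDiff.comp
      (ContDiff.inner ℝ (contDiff_snd.comp contDiff_fst) contDiff_snd)
  exact ((contDiff_const.mul h2).cexp).mul h1

theorem contDiff_spFT_integrand_fixed {h : Spt → ℂ} (hh : IsTest1 h) (p : E3) :
    ContDiff ℝ ∞ (Function.uncurry fun (t : ℝ) (x : E3) =>
      Complex.exp (Complex.I * ((inner ℝ p x : ℝ) : ℂ)) * h (embL (t, x))) := by
  have h1 : ContDiff ℝ ∞ fun q : ℝ × E3 => h (embL (q.1, q.2)) :=
    hh.1.comp (embL.contDiff.comp (by fun_prop))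
  have h2 : ContDiff ℝ ∞ fun q : ℝ × E3 => ((inner ℝ p q.2 : ℝ) : ℂ) :=
    Complex.ofRealCLM.contDiff.comp (ContDiff.inner ℝ contDiff_const contDiff_snd)
  exact ((contDiff_const.mul h2).cexp).mul h1

/-- A ball that does not depend on `t` and `p` makes the results on integrals over compact sets
applicable. -/
theorem spFT_eq {h : Spt → ℂ} {M : ℝ} (hM : ∀ t (x : E3), h (embL (t, x)) ≠ 0 → |t| ≤ M ∧ ‖x‖ ≤ M)
    (t : ℝ) (p : E3) : spFT h t p = ∫ x in Metric.closedBall (0 : E3) M,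
      Complex.exp (Complex.I * ((inner ℝ p x : ℝ) : ℂ)) * h (embL (t, x)) := by
  refine (setIntegral_eq_integral_of_forall_compl_eq_zero fun x hx => ?_).symm
  rw [mem_closedBall_zero_iff] at hx
  rw [mul_eq_zero]; right
  by_contra h0
  exact hx (hM t x h0).2

theorem ae_mem_ball (M : ℝ) : ∀ᵐ x ∂(volume.restrict (Metric.closedBall (0 : E3) M)),
    x ∈ Metric.closedBall (0 : E3) M := ae_restrict_mem measurableSet_closedBall

instance (M : ℝ) : IsFiniteMeasure (volume.restrict (Metric.closedBall (0 : E3) M)) :=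
  ⟨by
    rw [Measure.restrict_apply_univ]
    exact measure_closedBall_lt_top (μ := (volume : Measure E3)) (x := 0)⟩

theorem integrable_spFT {h : Spt → ℂ} (hh : IsTest1 h) (t : ℝ) (p : E3) :
    Integrable fun x : E3 =>
      Complex.exp (Complex.I * ((inner ℝ p x : ℝ) : ℂ)) * h (embL (t, x)) := by
  obtain ⟨M, -, hM⟩ := hh.exists_bound
  refine Continuous.integrable_of_hasCompactSupport ?_ ?_
  · have h1 := hh.1.continuous
    have h2 : Continuous fun x : E3 => ((inner ℝ p x : ℝ) : ℂ) :=
      Complex.continuous_ofReal.comp (continuous_const.inner continuous_id)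
    have h3 : Continuous fun x : E3 => h (embL (t, x)) :=
      h1.comp (embL.continuous.comp (by fun_prop))
    exact ((continuous_const.mul h2).cexp).mul h3
  · refine HasCompactSupport.intro (isCompact_closedBall (0 : E3) M) fun x hx => ?_
    rw [mem_closedBall_zero_iff] at hx
    rw [mul_eq_zero]; right
    by_contra h0
    exact hx (hM t x h0).2

theorem contDiff_spFT {h : Spt → ℂ} (hh : IsTest1 h) :
    ContDiff ℝ ∞ fun z : ℝ × E3 => spFT h z.1 z.2 := by
  obtain ⟨M, -, hM⟩ := hh.exists_bound
  simp_rw [spFT_eq hM]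
  exact contDiff_integral_of_compact (isCompact_closedBall (0 : E3) M) (ae_mem_ball M)
    (contDiff_spFT_integrand hh)

theorem hasDerivAt_spFT {h : Spt → ℂ} (hh : IsTest1 h) (t : ℝ) (p : E3) :
    HasDerivAt (fun t => spFT h t p) (spFT (pd 0 h) t p) t := by
  obtain ⟨M, -, hM⟩ := hh.exists_bound
  have hs := contDiff_spFT_integrand_fixed hh p
  have hd : Differentiable ℝ h := hh.1.differentiable (by simp)
  have h1 : ∀ t x, HasDerivAt (fun t => h (embL (t, x))) (pd 0 h (embL (t, x))) t := by
    intro t x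
    have := (hd (embL (t, x))).hasFDerivAt.comp_hasDerivAt t
      (embL.hasFDerivAt.comp_hasDerivAt t ((hasDerivAt_id t).prodMk (hasDerivAt_const t x)))
    rwa [embL_time] at this
  have h2 := contDiff_integral_of_compact (isCompact_closedBall (0 : E3) M) (ae_mem_ball M) hs
  have h3 := ((h2.differentiable (by simp)) t).hasDerivAt
  have hfun : (fun t => spFT h t p) = fun t => ∫ x in Metric.closedBall (0 : E3) M,
      Complex.exp (Complex.I * ((inner ℝ p x : ℝ) : ℂ)) * h (embL (t, x)) :=
    funext fun t => spFT_eq hM t p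
  rw [hfun]
  refine h3.congr_deriv ?_
  rw [← fderiv_apply_one_eq_deriv,
    fderiv_integral_of_compact (isCompact_closedBall (0 : E3) M) (ae_mem_ball M) hs, spFT]
  have h4 : ∀ x : E3, fderiv ℝ (fun t : ℝ => Complex.exp (Complex.I * ((inner ℝ p x : ℝ) : ℂ)) *
      h (embL (t, x))) t 1 =
      Complex.exp (Complex.I * ((inner ℝ p x : ℝ) : ℂ)) * pd 0 h (embL (t, x)) := fun x => by
    rw [fderiv_apply_one_eq_deriv, ((h1 t x).const_mul _).deriv]
  simp_rw [h4]
  refine setIntegral_eq_integral_of_forall_compl_eq_zero fun x hx => ?_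
  rw [mem_closedBall_zero_iff] at hx
  rw [← h4 x]
  have : (fun t : ℝ => Complex.exp (Complex.I * ((inner ℝ p x : ℝ) : ℂ)) * h (embL (t, x))) =
      fun _ => 0 := by
    ext s
    rw [mul_eq_zero]; right
    by_contra h0
    exact hx (hM s x h0).2
  rw [this]; simp

/-- Integration by parts; the boundary terms vanish by compact support, and the kernel exp(ip·x)
gives the sign in -i p_j. -/
theorem spFT_pd_space {h : Spt → ℂ} (hh : IsTest1 h) (j : Fin 3) (t : ℝ) (p : E3) :
    spFT (pd j.succ h) t p = -Complex.I * p j * spFT h t p := by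
  have hd : Differentiable ℝ h := hh.1.differentiable (by simp)
  have hg : ∀ x : E3, HasFDerivAt (fun x : E3 => h (embL (t, x)))
      ((fderiv ℝ h (embL (t, x))).comp (embL.comp (ContinuousLinearMap.inr ℝ ℝ E3))) x := fun x =>
    (hd (embL (t, x))).hasFDerivAt.comp x (embL.hasFDerivAt.comp (f := fun x => (t, x)) x
      (hasFDerivAt_prodMk_right t x))
  have hgv : ∀ x : E3, fderiv ℝ (fun x : E3 => h (embL (t, x))) x (EuclideanSpace.single j 1) =
      pd j.succ h (embL (t, x)) := fun x => by
    rw [(hg x).fderiv]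
    simp [← embL_space, pd]
  have hf : ∀ x : E3, HasFDerivAt (fun x : E3 => Complex.exp (Complex.I * ((inner ℝ p x : ℝ) : ℂ)))
      (Complex.exp (Complex.I * ((inner ℝ p x : ℝ) : ℂ)) •
        (Complex.I • (Complex.ofRealCLM.comp (innerSL ℝ p)))) x := fun x =>
    (((Complex.ofRealCLM.comp (innerSL ℝ p)).hasFDerivAt (x := x)).const_mul Complex.I).cexp
  have hfv : ∀ x : E3, fderiv ℝ (fun x : E3 => Complex.exp (Complex.I * ((inner ℝ p x : ℝ) : ℂ))) x
      (EuclideanSpace.single j 1) =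
      Complex.I * p j * Complex.exp (Complex.I * ((inner ℝ p x : ℝ) : ℂ)) := fun x => by
    rw [(hf x).fderiv]
    simp [EuclideanSpace.inner_single_right]; ring
  have key := integral_mul_fderiv_eq_neg_fderiv_mul_of_integrable (μ := (volume : Measure E3))
    (f := fun x : E3 => Complex.exp (Complex.I * ((inner ℝ p x : ℝ) : ℂ)))
    (g := fun x : E3 => h (embL (t, x))) (v := EuclideanSpace.single j 1) ?_ ?_
    (integrable_spFT hh t p) (fun x _ => (hf x).differentiableAt)
    (fun x _ => (hg x).differentiableAt)
  · simp_rw [hgv, hfv] at key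
    rw [spFT, key, spFT, ← integral_const_mul, ← integral_neg]
    congr 1; ext x; ring
  · simp_rw [hfv, mul_assoc]
    exact ((integrable_spFT hh t p).const_mul _).const_mul _
  · simp_rw [hgv]
    exact integrable_spFT (hh.pd _) t p

theorem spFT_add {h k : Spt → ℂ} (hh : IsTest1 h) (hk : IsTest1 k) (t : ℝ) (p : E3) :
    spFT (h + k) t p = spFT h t p + spFT k t p := by
  rw [spFT, spFT, spFT, ← integral_add (integrable_spFT hh t p) (integrable_spFT hk t p)]
  congr 1; ext x; simp [mul_add]

theorem spFT_smul (z : ℂ) (h : Spt → ℂ) (t : ℝ) (p : E3) :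
    spFT (z • h) t p = z * spFT h t p := by
  rw [spFT, spFT, ← integral_const_mul]
  congr 1; ext x; simp; ring

theorem exists_spFT_bound {h : Spt → ℂ} (hh : IsTest1 h) :
    ∃ C, ∀ t p, ‖spFT h t p‖ ≤ C := by
  obtain ⟨M, -, hM⟩ := hh.exists_bound
  obtain ⟨B, hB⟩ := hh.2.exists_bound_of_continuous hh.1.continuous
  refine ⟨B * (volume.restrict (Metric.closedBall (0 : E3) M)).real Set.univ, fun t p => ?_⟩
  rw [spFT_eq hM]
  refine norm_integral_le_of_norm_le_const (.of_forall fun x => ?_)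
  rw [norm_mul, mul_comm Complex.I, Complex.norm_exp_ofReal_mul_I, one_mul]
  exact hB _

theorem spFT_eq_zero {h : Spt → ℂ} {M : ℝ}
    (hM : ∀ t (x : E3), h (embL (t, x)) ≠ 0 → |t| ≤ M ∧ ‖x‖ ≤ M)
    {t : ℝ} (ht : M < |t|) (p : E3) : spFT h t p = 0 := by
  rw [spFT, ← integral_zero E3 ℂ]
  congr 1; ext x
  rw [mul_eq_zero]; right
  by_contra h0
  exact absurd (hM t x h0).1 (not_le.2 ht)

/-- `1 - Δ`. -/
noncomputable def oneSubLap (h : Spt → ℂ) : Spt → ℂ :=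
  h + (-1 : ℂ) • (pd 1 (pd 1 h) + (pd 2 (pd 2 h) + pd 3 (pd 3 h)))

theorem IsTest1.oneSubLap {h : Spt → ℂ} (hh : IsTest1 h) : IsTest1 (oneSubLap h) :=
  hh.add (((hh.pd 1).pd 1).add (((hh.pd 2).pd 2).add ((hh.pd 3).pd 3)) |>.smul _)

theorem spFT_pd_pd_space {h : Spt → ℂ} (hh : IsTest1 h) (j : Fin 3) (t : ℝ) (p : E3) :
    spFT (pd j.succ (pd j.succ h)) t p = -(p j : ℂ) ^ 2 * spFT h t p := by
  rw [spFT_pd_space (hh.pd _), spFT_pd_space hh]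
  linear_combination (p j : ℂ) ^ 2 * spFT h t p * Complex.I_sq

theorem norm_sq_E3 (p : E3) : ((‖p‖ : ℝ) : ℂ) ^ 2 = (p 0 : ℂ) ^ 2 + (p 1 : ℂ) ^ 2 + (p 2 : ℂ) ^ 2 := by
  have : ‖p‖ ^ 2 = p 0 ^ 2 + p 1 ^ 2 + p 2 ^ 2 := by
    rw [EuclideanSpace.norm_sq_eq, Fin.sum_univ_three]; simp
  exact_mod_cast congrArg (fun r : ℝ => (r : ℂ)) this

theorem spFT_oneSubLap {h : Spt → ℂ} (hh : IsTest1 h) (t : ℝ) (p : E3) :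
    spFT (oneSubLap h) t p = ((1 + ‖p‖ ^ 2 : ℝ) : ℂ) * spFT h t p := by
  have h0 := spFT_pd_pd_space hh 0 t p
  have h1 := spFT_pd_pd_space hh 1 t p
  have h2 := spFT_pd_pd_space hh 2 t p
  rw [oneSubLap, spFT_add hh
    ((((hh.pd 1).pd 1).add (((hh.pd 2).pd 2).add ((hh.pd 3).pd 3))).smul _), spFT_smul,
    spFT_add ((hh.pd 1).pd 1) (((hh.pd 2).pd 2).add ((hh.pd 3).pd 3)),
    spFT_add ((hh.pd 2).pd 2) ((hh.pd 3).pd 3)]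
  simp only [Fin.isValue, Fin.succ_zero_eq_one, Fin.succ_one_eq_two] at h0 h1
  have e : Fin.succ (2 : Fin 3) = 3 := rfl
  rw [e] at h2
  rw [h0, h1, h2]
  push_cast
  rw [norm_sq_E3]; ring

/-- Decay of the Fourier transform, and compact support in time. -/
theorem exists_spFT_decay {h : Spt → ℂ} (hh : IsTest1 h) :
    ∃ M C : ℝ, 0 ≤ M ∧ 0 ≤ C ∧ (∀ t p, ‖spFT h t p‖ ≤ C * ((1 + ‖p‖ ^ 2) ^ 2)⁻¹) ∧
      ∀ t p, M < |t| → spFT h t p = 0 := by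
  obtain ⟨M, hM0, hM⟩ := hh.exists_bound
  -- Two factors 1-Δ give the decay |p|⁻⁴, enough both for integrability in three dimensions and
  -- against the density on the mass shell.
  obtain ⟨C, hC⟩ := exists_spFT_bound hh.oneSubLap.oneSubLap
  refine ⟨M, C, hM0, (norm_nonneg _).trans (hC 0 0), fun t p => ?_, fun t p ht =>
    spFT_eq_zero hM ht p⟩
  have := hC t p
  rw [spFT_oneSubLap hh.oneSubLap, spFT_oneSubLap hh, norm_mul, norm_mul, Complex.norm_real,
    Real.norm_of_nonneg (by positivity)] at this
  rw [← div_eq_mul_inv, le_div_iff₀ (by positivity)]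
  linarith

/-! ### A Riemann-Lebesgue lemma for non-degenerate phases -/

section Phase

variable {X : Type*} [MeasurableSpace X] {m : Measure X}

/-- The integral is the Fourier transform of the image measure of `θ`. That measure has an
integrable density, so the classical Riemann-Lebesgue lemma applies. -/
theorem tendsto_integral_exp_of_finite [IsFiniteMeasure m] {θ : X → ℝ} (hθ : Measurable θ)
    (hac : m.map θ ≪ volume) :
    Tendsto (fun R : ℝ => ∫ p, Complex.exp (Complex.I * ((R * θ p : ℝ) : ℂ)) ∂m) atTop (𝓝 0) := by
  have h1 : ∀ R : ℝ, ∫ p, Complex.exp (Complex.I * ((R * θ p : ℝ) : ℂ)) ∂m =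
      ∫ y : ℝ, Real.fourierChar (-(y * (-R / (2 * Real.pi)))) •
        (((m.map θ).rnDeriv volume y).toReal : ℂ) := by
    intro R
    have e1 : ∫ p, Complex.exp (Complex.I * ((R * θ p : ℝ) : ℂ)) ∂m =
        ∫ y, Complex.exp (Complex.I * ((R * y : ℝ) : ℂ)) ∂(m.map θ) :=
      (integral_map (f := fun y : ℝ => Complex.exp (Complex.I * ((R * y : ℝ) : ℂ)))
        hθ.aemeasurable (Continuous.aestronglyMeasurable (by fun_prop))).symm
    rw [e1, ← integral_rnDeriv_smul hac]
    congr 1; ext y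
    rw [Circle.smul_def, Real.fourierChar_apply, Complex.real_smul, smul_eq_mul, mul_comm]
    congr 2
    push_cast
    have : (Real.pi : ℂ) ≠ 0 := by exact_mod_cast Real.pi_ne_zero
    field_simp
  simp_rw [h1]
  refine (Real.tendsto_integral_exp_smul_cocompact
    (fun y => (((m.map θ).rnDeriv volume y).toReal : ℂ))).comp ?_
  have : Tendsto (fun R : ℝ => -R / (2 * Real.pi)) atTop atBot :=
    (tendsto_neg_atTop_atBot).atBot_div_const (by positivity)
  exact this.mono_right atBot_le_cocompact

/-- A non-negative amplitude is absorbed into the measure, which becomes finite and keeps an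
absolutely continuous image under `θ`. A complex amplitude is later split into four of this kind. -/
theorem tendsto_integral_mul_exp_of_nonneg {θ : X → ℝ} (hθ : Measurable θ)
    (hac : m.map θ ≪ volume) {ψ : X → ℝ} (hψ : Integrable ψ m) (h0 : 0 ≤ ψ) :
    Tendsto (fun R : ℝ => ∫ p, (ψ p : ℂ) * Complex.exp (Complex.I * ((R * θ p : ℝ) : ℂ)) ∂m)
      atTop (𝓝 0) := by
  have hfin : IsFiniteMeasure (m.withDensity fun p => ENNReal.ofReal (ψ p)) :=
    isFiniteMeasure_withDensity_ofReal hψ.2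
  have hac' : (m.withDensity fun p => ENNReal.ofReal (ψ p)).map θ ≪ volume :=
    ((withDensity_absolutelyContinuous m _).map hθ).trans hac
  refine (tendsto_integral_exp_of_finite hθ hac').congr fun R => ?_
  rw [integral_withDensity_eq_integral_toReal_smul₀ hψ.aestronglyMeasurable.aemeasurable.ennreal_ofReal
    (.of_forall fun _ => ENNReal.ofReal_lt_top)]
  congr 1; ext p
  rw [ENNReal.toReal_ofReal (h0 p), Complex.real_smul]

theorem integrable_mul_exp {θ : X → ℝ} (hθ : Measurable θ) {Ψ : X → ℂ} (hΨ : Integrable Ψ m)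
    (R : ℝ) : Integrable (fun p => Ψ p * Complex.exp (Complex.I * ((R * θ p : ℝ) : ℂ))) m := by
  refine hΨ.mul_bdd (c := 1) ?_ ?_
  · exact (by fun_prop : Measurable fun p => Complex.exp (Complex.I * ((R * θ p : ℝ) : ℂ))).aestronglyMeasurable
  · exact .of_forall fun p => by rw [mul_comm Complex.I, Complex.norm_exp_ofReal_mul_I]

theorem tendsto_integral_mul_exp {θ : X → ℝ} (hθ : Measurable θ)
    (hac : m.map θ ≪ volume) {Ψ : X → ℂ} (hΨ : Integrable Ψ m) :
    Tendsto (fun R : ℝ => ∫ p, Ψ p * Complex.exp (Complex.I * ((R * θ p : ℝ) : ℂ)) ∂m)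
      atTop (𝓝 0) := by
  have hr : Integrable (fun p => (Ψ p).re) m := hΨ.re
  have hi : Integrable (fun p => (Ψ p).im) m := hΨ.im
  have i1 : Integrable (fun p => ((max (Ψ p).re 0 : ℝ) : ℂ)) m := hr.pos_part.ofReal
  have i2 : Integrable (fun p => ((max (-(Ψ p).re) 0 : ℝ) : ℂ)) m := hr.neg_part.ofReal
  have i3 : Integrable (fun p => ((max (Ψ p).im 0 : ℝ) : ℂ)) m := hi.pos_part.ofReal
  have i4 : Integrable (fun p => ((max (-(Ψ p).im) 0 : ℝ) : ℂ)) m := hi.neg_part.ofReal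
  have t1 := tendsto_integral_mul_exp_of_nonneg hθ hac hr.pos_part fun _ => le_max_right _ _
  have t2 := tendsto_integral_mul_exp_of_nonneg hθ hac hr.neg_part fun _ => le_max_right _ _
  have t3 := tendsto_integral_mul_exp_of_nonneg hθ hac hi.pos_part fun _ => le_max_right _ _
  have t4 := tendsto_integral_mul_exp_of_nonneg hθ hac hi.neg_part fun _ => le_max_right _ _
  have key := (t1.sub t2).add ((t3.sub t4).const_mul Complex.I)
  simp only [sub_zero, mul_zero, add_zero] at key
  refine key.congr fun R => ?_
  rw [← integral_sub (integrable_mul_exp hθ i1 R)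
      (integrable_mul_exp hθ i2 R),
    ← integral_sub (integrable_mul_exp hθ i3 R)
      (integrable_mul_exp hθ i4 R), ← integral_const_mul, ← integral_add]
  · congr 1; ext p
    rw [← sub_mul, ← sub_mul, ← mul_assoc, ← add_mul]
    congr 1
    have e : ∀ a : ℝ, ((max a 0 : ℝ) : ℂ) - ((max (-a) 0 : ℝ) : ℂ) = a := fun a => by
      rw [← Complex.ofReal_sub]; congr 1
      rcases le_total a 0 with h | h
      · rw [max_eq_right h, max_eq_left (by linarith)]; ring
      · rw [max_eq_left h, max_eq_right (by linarith)]; ring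
    rw [e, e, mul_comm Complex.I]
    exact Complex.re_add_im _
  · exact (integrable_mul_exp hθ i1 R).sub
      (integrable_mul_exp hθ i2 R)
  · exact ((integrable_mul_exp hθ i3 R).sub
      (integrable_mul_exp hθ i4 R)).const_mul _

end Phase

/-- The phase `p·v - a|p|` is non-degenerate for `0 ≤ a < |v|`. -/
theorem map_phase_absolutelyContinuous {v : E3} {a : ℝ} (ha : 0 ≤ a) (hav : a < ‖v‖) :
    (volume : Measure E3).map (fun p => inner ℝ p v - a * ‖p‖) ≪ volume := by
  have hm : Measurable fun p : E3 => inner ℝ p v - a * ‖p‖ :=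
    (by fun_prop : Continuous fun p : E3 => inner ℝ p v - a * ‖p‖).measurable
  refine Measure.AbsolutelyContinuous.mk fun N hN hN0 => ?_
  rw [Measure.map_apply hm hN]
  have hv : 0 < ‖v‖ := ha.trans_lt hav
  have hd : 0 < ‖v‖ * (‖v‖ - a) := mul_pos hv (by linarith)
  -- Fubini along the lines parallel to `v`: it suffices that the preimage of the null set is null
  -- on each of them.
  have key := ae_mem_of_ae_add_linearMap_mem (LinearMap.toSpanSingleton ℝ E3 v) volume volume
    (s := ((fun p : E3 => inner ℝ p v - a * ‖p‖) ⁻¹' N)ᶜ) (hm hN).compl ?_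
  · rwa [ae_iff, show {p | ¬ p ∈ ((fun p : E3 => inner ℝ p v - a * ‖p‖) ⁻¹' N)ᶜ} = _ from
      by ext; simp; rfl] at key
  intro y
  set f : ℝ → ℝ := fun s => inner ℝ (y + s • v) v - a * ‖y + s • v‖ with hf
  -- Along such a line p·v has slope |v|², while a|p| has Lipschitz constant at most a|v|. Hence the
  -- phase stretches distances by at least |v|(|v| - a), and null sets have null preimages.
  have hanti : AntilipschitzWith (Real.toNNReal (‖v‖ * (‖v‖ - a))⁻¹) f := by
    refine AntilipschitzWith.of_le_mul_dist fun s s' => ?_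
    rw [Real.coe_toNNReal _ (by positivity), inv_mul_eq_div, le_div_iff₀ hd, Real.dist_eq,
      Real.dist_eq]
    have e1 : f s - f s' = (s - s') * ‖v‖ ^ 2 - a * (‖y + s • v‖ - ‖y + s' • v‖) := by
      simp only [hf, inner_add_left, inner_smul_left, real_inner_self_eq_norm_sq]
      simp; ring
    have e2 : |‖y + s • v‖ - ‖y + s' • v‖| ≤ |s - s'| * ‖v‖ := by
      refine (abs_norm_sub_norm_le _ _).trans (le_of_eq ?_)
      rw [add_sub_add_left_eq_sub, ← sub_smul, norm_smul, Real.norm_eq_abs]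
    rw [e1]
    have e3 := abs_sub_abs_le_abs_sub ((s - s') * ‖v‖ ^ 2) (a * (‖y + s • v‖ - ‖y + s' • v‖))
    rw [abs_mul, abs_mul, abs_of_nonneg ha, abs_of_nonneg (by positivity : 0 ≤ ‖v‖ ^ 2)] at e3
    nlinarith [mul_le_mul_of_nonneg_left e2 ha]
  have h0 := hanti.hausdorffMeasure_preimage_le zero_le_one N
  rw [hausdorffMeasure_real, hN0, mul_zero] at h0
  rw [ae_iff]
  refine measure_mono_null ?_ (le_antisymm h0 zero_le)
  intro s hs
  simpa [hf, LinearMap.toSpanSingleton_apply] using hs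

/-! ### The massless time-ordered two-point function -/

/-- The invariant measure on the mass shell. -/
noncomputable def shellDensity (p : E3) : ℂ := 1 / ((2 * (Real.pi : ℂ)) ^ 3 * (2 * (‖p‖ : ℂ)))

theorem measurable_shellDensity : Measurable shellDensity := by
  unfold shellDensity; fun_prop

/-- In polar coordinates the volume factor r² absorbs the singularity 1/r of the density; the rest
is bounded by a multiple of (1+r²)⁻¹ because r ≤ 1 + r². -/
theorem integrable_shellDensity_mul :
    Integrable fun p : E3 => ‖shellDensity p‖ * ((1 + ‖p‖ ^ 2) ^ 2)⁻¹ := by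
  have h1 : ∀ p : E3, ‖shellDensity p‖ * ((1 + ‖p‖ ^ 2) ^ 2)⁻¹ =
      (fun y : ℝ => ((2 * Real.pi) ^ 3 * 2)⁻¹ * (y⁻¹ * ((1 + y ^ 2) ^ 2)⁻¹)) ‖p‖ := by
    intro p
    simp only [shellDensity, norm_div, norm_mul, norm_pow, Complex.norm_real, Real.norm_eq_abs,
      norm_one, Complex.norm_ofNat, abs_norm, abs_of_pos Real.pi_pos]
    rw [one_div, ← mul_assoc, mul_inv, mul_assoc]
  simp_rw [h1]
  rw [integrable_fun_norm_addHaar (volume : Measure E3)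
    (f := fun y : ℝ => ((2 * Real.pi) ^ 3 * 2)⁻¹ * (y⁻¹ * ((1 + y ^ 2) ^ 2)⁻¹))]
  have h2 : IntegrableOn (fun y : ℝ => ((2 * Real.pi) ^ 3 * 2)⁻¹ * (1 + y ^ 2)⁻¹) (Set.Ioi 0) :=
    (integrable_inv_one_add_sq.const_mul _).integrableOn
  refine Integrable.mono' h2 (Measurable.aestronglyMeasurable (by fun_prop)) ?_
  filter_upwards [ae_restrict_mem measurableSet_Ioi] with y hy
  have hy : 0 < y := hy
  rw [Real.norm_of_nonneg (by have := Real.pi_pos; positivity), finrank_euclideanSpace_fin, smul_eq_mul]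
  have : y ^ (3 - 1) * (((2 * Real.pi) ^ 3 * 2)⁻¹ * (y⁻¹ * ((1 + y ^ 2) ^ 2)⁻¹)) =
      ((2 * Real.pi) ^ 3 * 2)⁻¹ * (y * ((1 + y ^ 2) ^ 2)⁻¹) := by
    field_simp
  rw [this]
  refine mul_le_mul_of_nonneg_left ?_ (by have := Real.pi_pos; positivity)
  rw [← div_eq_mul_inv, div_le_iff₀ (by positivity)]
  field_simp
  nlinarith [sq_nonneg (y - 1)]

/-- The integrand of the two-point function, with a general phase. -/
theorem integrable_shell {h : Spt → ℂ} (hh : IsTest1 h) {φ : ℝ × E3 → ℂ} (hφ : Measurable φ)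
    (hφ1 : ∀ z, ‖φ z‖ ≤ 1) :
    Integrable (fun z : ℝ × E3 => shellDensity z.2 * φ z * spFT h z.1 z.2)
      ((volume : Measure ℝ).prod (volume : Measure E3)) := by
  obtain ⟨M, C, hM0, hC0, hC, hM⟩ := exists_spFT_decay hh
  have hb : Integrable (fun z : ℝ × E3 => (Set.Icc (-M) M).indicator (fun _ => C) z.1 *
      (‖shellDensity z.2‖ * ((1 + ‖z.2‖ ^ 2) ^ 2)⁻¹))
      ((volume : Measure ℝ).prod (volume : Measure E3)) :=
    Integrable.mul_prod (f := (Set.Icc (-M) M).indicator fun _ => C)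
      ((integrable_indicator_iff measurableSet_Icc).2 (integrableOn_const (by simp)))
      integrable_shellDensity_mul
  refine hb.mono' ?_ (.of_forall fun z => ?_)
  · exact (((measurable_shellDensity.comp measurable_snd).mul hφ).mul
      (contDiff_spFT hh).continuous.measurable).aestronglyMeasurable
  · rw [norm_mul, norm_mul]
    by_cases hz : |z.1| ≤ M
    · rw [Set.indicator_of_mem (show z.1 ∈ Set.Icc (-M) M from abs_le.1 hz)]
      calc ‖shellDensity z.2‖ * ‖φ z‖ * ‖spFT h z.1 z.2‖
          ≤ ‖shellDensity z.2‖ * 1 * (C * ((1 + ‖z.2‖ ^ 2) ^ 2)⁻¹) := by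
            gcongr; exacts [hφ1 z, hC _ _]
        _ = _ := by ring
    · rw [hM _ _ (not_le.1 hz), norm_zero, mul_zero]
      exact mul_nonneg (Set.indicator_nonneg (fun _ _ => hC0) _) (by positivity)

theorem norm_exp_neg_I (r : ℝ) : ‖Complex.exp (-Complex.I * (r : ℂ))‖ = 1 := by
  rw [neg_mul, ← mul_neg, ← Complex.ofReal_neg, mul_comm, Complex.norm_exp_ofReal_mul_I]

theorem integrable_T0 {h : Spt → ℂ} (hh : IsTest1 h) :
    Integrable (fun z : ℝ × E3 => shellDensity z.2 *
      Complex.exp (-Complex.I * ((‖z.2‖ * |z.1| : ℝ) : ℂ)) * spFT h z.1 z.2)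
      ((volume : Measure ℝ).prod (volume : Measure E3)) :=
  integrable_shell hh (by fun_prop) fun z => (norm_exp_neg_I _).le

theorem T0_eq (h : Spt → ℂ) : T0 h = ∫ t : ℝ, ∫ p : E3, shellDensity p *
    Complex.exp (-Complex.I * ((‖p‖ * |t| : ℝ) : ℂ)) * spFT h t p := by
  simp only [T0, shellDensity, spFT, embL_apply]

theorem T0_eq_prod {h : Spt → ℂ} (hh : IsTest1 h) :
    T0 h = ∫ z : ℝ × E3, shellDensity z.2 *
      Complex.exp (-Complex.I * ((‖z.2‖ * |z.1| : ℝ) : ℂ)) * spFT h z.1 z.2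
      ∂((volume : Measure ℝ).prod (volume : Measure E3)) := by
  rw [T0_eq, integral_prod _ (integrable_T0 hh)]

theorem T0_add {h k : Spt → ℂ} (hh : IsTest1 h) (hk : IsTest1 k) : T0 (h + k) = T0 h + T0 k := by
  rw [T0_eq_prod (hh.add hk), T0_eq_prod hh, T0_eq_prod hk,
    ← integral_add (integrable_T0 hh) (integrable_T0 hk)]
  congr 1; ext z
  rw [spFT_add hh hk]; ring

theorem T0_smul {h : Spt → ℂ} (hh : IsTest1 h) (z : ℂ) : T0 (z • h) = z * T0 h := by
  rw [T0_eq_prod (hh.smul z), T0_eq_prod hh, ← integral_const_mul]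
  congr 1; ext w
  rw [spFT_smul]; ring

theorem continuous_spFT {h : Spt → ℂ} (hh : IsTest1 h) :
    Continuous fun z : ℝ × E3 => spFT h z.1 z.2 := (contDiff_spFT hh).continuous

theorem continuous_spFT_time {h : Spt → ℂ} (hh : IsTest1 h) (p : E3) :
    Continuous fun t => spFT h t p := by
  have := continuous_spFT hh
  have h2 : Continuous fun t : ℝ => (t, p) := by fun_prop
  fun_prop

theorem continuous_spFT_momentum {h : Spt → ℂ} (hh : IsTest1 h) (t : ℝ) :
    Continuous fun p => spFT h t p := by
  have := continuous_spFT hh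
  have h2 : Continuous fun p : E3 => (t, p) := by fun_prop
  fun_prop

/-- Inversion of the Fourier transform at the origin. -/
theorem integral_spFT_zero {h : Spt → ℂ} (hh : IsTest1 h) :
    ((2 * (Real.pi : ℂ)) ^ 3)⁻¹ * ∫ p : E3, spFT h 0 p = h 0 := by
  set f : E3 → ℂ := fun x => h (embL (0, x)) with hf
  have hc : Continuous f := hh.1.continuous.comp (embL.continuous.comp (by fun_prop))
  have hi : Integrable f :=
    (integrable_spFT hh 0 0).congr (.of_forall fun x => by
      change Complex.exp (Complex.I * ((inner ℝ (0 : E3) x : ℝ) : ℂ)) * h (embL (0, x)) = _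
      rw [inner_zero_left, Complex.ofReal_zero, mul_zero, Complex.exp_zero, one_mul])
  -- The kernels exp(-2πi w·x) and exp(ip·x) are related by p = -2πw; the Jacobian of this
  -- substitution is the source of the factor (2π)⁻³.
  have hF : ∀ w : E3, FourierTransform.fourier f w = spFT h 0 ((-(2 * Real.pi)) • w) := by
    intro w
    rw [Real.fourier_eq', spFT]
    congr 1; ext x
    rw [smul_eq_mul]
    congr 2
    rw [real_inner_smul_left, real_inner_comm]
    push_cast; ring
  have hcF := continuous_spFT_momentum hh 0
  have hiF0 : Integrable fun p : E3 => spFT h 0 p := by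
    obtain ⟨M, C, hM0, hC0, hC, hM⟩ := exists_spFT_decay hh
    have := integrable_rpow_neg_one_add_norm_sq (E := E3) (μ := volume) (r := 4)
      (by rw [finrank_euclideanSpace_fin]; norm_num)
    refine (this.const_mul C).mono' hcF.aestronglyMeasurable (.of_forall fun p => ?_)
    refine (hC 0 p).trans (le_of_eq ?_)
    rw [show (-4 / 2 : ℝ) = -((2 : ℕ) : ℝ) by norm_num, Real.rpow_neg (by positivity),
      Real.rpow_natCast]
  have hne : (-(2 * Real.pi)) ≠ 0 := by have := Real.pi_pos; linarith
  have hiF : Integrable (FourierTransform.fourier f) := by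
    rw [show FourierTransform.fourier f = _ from funext hF]
    exact hiF0.comp_smul hne
  have key := congrFun (hc.fourierInv_fourier_eq hi hiF) 0
  rw [Real.fourierInv_eq'] at key
  simp only [inner_zero_right, mul_zero, Complex.ofReal_zero, zero_mul, Complex.exp_zero, one_smul,
    hF] at key
  rw [Measure.integral_comp_smul volume (fun p => spFT h 0 p), finrank_euclideanSpace_fin] at key
  have h0 : f 0 = h 0 := by
    have : embL ((0 : ℝ), (0 : E3)) = 0 := map_zero embL
    simp [hf, this]
  rw [← h0, ← key, Complex.real_smul]
  congr 1
  rw [abs_inv, abs_pow, abs_neg, abs_of_pos (by have := Real.pi_pos; positivity)]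
  push_cast; rfl

/-- The fundamental solution of the harmonic oscillator. -/
theorem integral_oscillator {u u' u'' : ℝ → ℂ} (h1 : ∀ t, HasDerivAt u (u' t) t)
    (h2 : ∀ t, HasDerivAt u' (u'' t) t) (hc : Continuous u'') {M : ℝ}
    (hu : ∀ t, M < |t| → u t = 0) (hu' : ∀ t, M < |t| → u' t = 0)
    (hu'' : ∀ t, M < |t| → u'' t = 0) (k : ℝ) :
    ∫ t : ℝ, Complex.exp (-Complex.I * ((k * |t| : ℝ) : ℂ)) * (u'' t + k ^ 2 * u t) =
      -2 * Complex.I * k * u 0 := by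
  have cu : Continuous u := continuous_iff_continuousAt.2 fun t => (h1 t).continuousAt
  have cu' : Continuous u' := continuous_iff_continuousAt.2 fun t => (h2 t).continuousAt
  have hint : Integrable fun t : ℝ =>
      Complex.exp (-Complex.I * ((k * |t| : ℝ) : ℂ)) * (u'' t + k ^ 2 * u t) := by
    refine Continuous.integrable_of_hasCompactSupport (by fun_prop) ?_
    refine HasCompactSupport.intro (isCompact_Icc (a := -M) (b := M)) fun t ht => ?_
    have : M < |t| := by
      by_contra h0; exact ht (abs_le.1 (not_lt.1 h0))
    simp [hu t this, hu'' t this]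
  -- A primitive of the integrand on the half-line where |t| = st, with s = ±1. The terms u'(0) of
  -- the two half-lines cancel at the origin, and the terms iku(0) add up to -2iku(0).
  have hG : ∀ (s : ℝ) t, s ^ 2 = 1 → HasDerivAt (fun t : ℝ => Complex.exp (-Complex.I * ((k * (s * t) : ℝ) : ℂ)) *
      (u' t + Complex.I * k * s * u t))
      (Complex.exp (-Complex.I * ((k * (s * t) : ℝ) : ℂ)) * (u'' t + k ^ 2 * u t)) t := by
    intro s t hs
    have e0 : HasDerivAt (fun t : ℝ => ((k * (s * t) : ℝ) : ℂ)) ((k * (s * 1) : ℝ) : ℂ) t :=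
      (((hasDerivAt_id t).const_mul s).const_mul k).ofReal_comp
    have := ((e0.const_mul (-Complex.I)).cexp).mul ((h2 t).add ((h1 t).const_mul (Complex.I * k * s)))
    refine this.congr_deriv ?_
    have hs' : (s : ℂ) ^ 2 = 1 := by exact_mod_cast hs
    simp only [Pi.add_apply]
    push_cast
    linear_combination (-Complex.exp (-Complex.I * (k * (s * t))) * k ^ 2 * u t * Complex.I ^ 2) * hs' -
      Complex.exp (-Complex.I * (k * (s * t))) * k ^ 2 * u t * Complex.I_sq
  rw [← intervalIntegral.integral_Iic_add_Ioi hint.integrableOn hint.integrableOn (b := 0)]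
  have hp := integral_Ioi_of_hasDerivAt_of_tendsto (a := 0) (m := 0)
    (hG 1 0 (by norm_num)).continuousAt.continuousWithinAt (fun t _ => hG 1 t (by norm_num)) ?_ ?_
  have hm := integral_Iic_of_hasDerivAt_of_tendsto (a := 0) (m := 0)
    (hG (-1) 0 (by norm_num)).continuousAt.continuousWithinAt
    (fun t _ => hG (-1) t (by norm_num)) ?_ ?_
  · rw [setIntegral_congr_fun (g := fun t : ℝ => Complex.exp (-Complex.I * ((k * (1 * t) : ℝ) : ℂ)) *
        (u'' t + k ^ 2 * u t)) measurableSet_Ioi, hp,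
      setIntegral_congr_fun (g := fun t : ℝ => Complex.exp (-Complex.I * ((k * (-1 * t) : ℝ) : ℂ)) *
        (u'' t + k ^ 2 * u t)) measurableSet_Iic, hm]
    · simp; ring
    · intro t (ht : t ≤ 0); simp [abs_of_nonpos ht]
    · intro t (ht : 0 < t); simp [abs_of_pos ht]
  · exact (hint.integrableOn (s := Set.Iic 0)).congr_fun
      (fun t (ht : t ≤ 0) => by simp [abs_of_nonpos ht]) measurableSet_Iic
  · refine tendsto_const_nhds.congr' ?_
    filter_upwards [eventually_lt_atBot (-|M|)] with t ht
    have : M < |t| := by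
      have := neg_abs_le t; have := le_abs_self M; linarith [neg_le_abs t]
    simp [hu t this, hu' t this]
  · exact (hint.integrableOn (s := Set.Ioi 0)).congr_fun
      (fun t (ht : 0 < t) => by simp [abs_of_pos ht]) measurableSet_Ioi
  · refine tendsto_const_nhds.congr' ?_
    filter_upwards [eventually_gt_atTop |M|] with t ht
    have : M < |t| := by
      have := le_abs_self t; have := le_abs_self M; linarith
    simp [hu t this, hu' t this]

/-- The two-point function is a Green's function: `□ T₀ = -iδ`. -/
theorem T0_box {h : Spt → ℂ} (hh : IsTest1 h) :
    ∑ μ, sgn μ * T0 (pd μ (pd μ h)) = -Complex.I * h 0 := by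
  have e1 : Fin.succ (0 : Fin 3) = 1 := rfl
  have e2 : Fin.succ (1 : Fin 3) = 2 := rfl
  have e3 : Fin.succ (2 : Fin 3) = 3 := rfl
  have q := fun μ : Fin 4 => integrable_T0 ((hh.pd μ).pd μ)
  have hpt : ∀ z : ℝ × E3, ∑ μ, sgn μ * (shellDensity z.2 *
      Complex.exp (-Complex.I * ((‖z.2‖ * |z.1| : ℝ) : ℂ)) * spFT (pd μ (pd μ h)) z.1 z.2) =
      shellDensity z.2 * (Complex.exp (-Complex.I * ((‖z.2‖ * |z.1| : ℝ) : ℂ)) *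
        (spFT (pd 0 (pd 0 h)) z.1 z.2 + ‖z.2‖ ^ 2 * spFT h z.1 z.2)) := by
    intro z
    have h0 := spFT_pd_pd_space hh 0 z.1 z.2
    have h1 := spFT_pd_pd_space hh 1 z.1 z.2
    have h2 := spFT_pd_pd_space hh 2 z.1 z.2
    rw [e1] at h0; rw [e2] at h1; rw [e3] at h2
    rw [Fin.sum_univ_four, h0, h1, h2, norm_sq_E3]
    simp [sgn]; ring
  have hsum : ∑ μ, sgn μ * T0 (pd μ (pd μ h)) = ∫ z : ℝ × E3, shellDensity z.2 *
      (Complex.exp (-Complex.I * ((‖z.2‖ * |z.1| : ℝ) : ℂ)) *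
        (spFT (pd 0 (pd 0 h)) z.1 z.2 + ‖z.2‖ ^ 2 * spFT h z.1 z.2))
      ∂((volume : Measure ℝ).prod (volume : Measure E3)) := by
    simp_rw [← hpt]
    rw [integral_finsetSum _ fun μ _ => (q μ).const_mul (sgn μ)]
    exact Finset.sum_congr rfl fun μ _ => by
      rw [integral_const_mul, T0_eq_prod ((hh.pd μ).pd μ)]
  have hint : Integrable (fun z : ℝ × E3 => shellDensity z.2 *
      (Complex.exp (-Complex.I * ((‖z.2‖ * |z.1| : ℝ) : ℂ)) *
        (spFT (pd 0 (pd 0 h)) z.1 z.2 + ‖z.2‖ ^ 2 * spFT h z.1 z.2)))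
      ((volume : Measure ℝ).prod (volume : Measure E3)) := by
    simp_rw [← hpt]
    exact integrable_finsetSum _ fun μ _ => (q μ).const_mul (sgn μ)
  rw [hsum, integral_prod_symm _ hint]
  obtain ⟨M0, -, hM0⟩ := hh.exists_bound
  obtain ⟨M1, -, hM1⟩ := (hh.pd 0).exists_bound
  obtain ⟨M2, -, hM2⟩ := ((hh.pd 0).pd 0).exists_bound
  -- At fixed momentum the wave operator is an oscillator of frequency |p|. The resulting factor
  -- 2|p| cancels the one in the shell density, leaving the Fourier inversion formula at the origin.
  have key : ∀ p : E3, ∫ t : ℝ, shellDensity p *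
      (Complex.exp (-Complex.I * ((‖p‖ * |t| : ℝ) : ℂ)) *
        (spFT (pd 0 (pd 0 h)) t p + ‖p‖ ^ 2 * spFT h t p)) =
      shellDensity p * (-2 * Complex.I * ‖p‖ * spFT h 0 p) := by
    intro p
    rw [integral_const_mul, integral_oscillator (M := max M0 (max M1 M2))
      (fun t => hasDerivAt_spFT hh t p) (fun t => hasDerivAt_spFT (hh.pd 0) t p)
      (continuous_spFT_time ((hh.pd 0).pd 0) p)
      (fun t ht => spFT_eq_zero hM0 ((le_max_left _ _).trans_lt ht) p)
      (fun t ht => spFT_eq_zero hM1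
        (((le_max_left _ _).trans (le_max_right _ _)).trans_lt ht) p)
      (fun t ht => spFT_eq_zero hM2
        (((le_max_right _ _).trans (le_max_right _ _)).trans_lt ht) p)]
  simp_rw [key]
  rw [← integral_spFT_zero hh, ← mul_assoc, ← integral_const_mul]
  refine integral_congr_ae ?_
  -- The factor |p| is cancelled only for p ≠ 0, that is, almost everywhere.
  filter_upwards [Measure.ae_ne (volume : Measure E3) 0] with p hp
  have hp' : (‖p‖ : ℂ) ≠ 0 := by exact_mod_cast norm_ne_zero_iff.2 hp
  have hpi : (Real.pi : ℂ) ≠ 0 := by exact_mod_cast Real.pi_ne_zero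
  rw [shellDensity]
  field_simp

/-! ### Decay of the two-point function in spacelike directions -/

theorem integral_sigma_restrict {c : Spt → ℝ} (f : Spt → ℂ) :
    ∫ e, (c e : ℂ) * f e ∂sigma = ∫ e in tsupport c, (c e : ℂ) * f e ∂sigma := by
  refine (setIntegral_eq_integral_of_forall_compl_eq_zero fun e he => ?_).symm
  rw [image_eq_zero_of_notMem_tsupport he]; simp

theorem isFiniteMeasure_sigma_restrict {K : Set Spt} (hK : IsCompact K) :
    IsFiniteMeasure (sigma.restrict K) :=
  ⟨by rw [Measure.restrict_apply_univ]; exact hK.measure_lt_top⟩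

/-- The average of the translates by `R e`. -/
noncomputable def avg (c : Spt → ℝ) (R : ℝ) (h : Spt → ℂ) : Spt → ℂ := fun y =>
  ∫ e, (c e : ℂ) * h (y - R • e) ∂sigma

theorem isTest1_avg {c : Spt → ℝ} (hc : ContDiff ℝ ∞ c) (hcs : HasCompactSupport c) {h : Spt → ℂ}
    (hh : IsTest1 h) (R : ℝ) : IsTest1 (avg c R h) := by
  constructor
  · have : avg c R h = fun y => ∫ e in tsupport c, (c e : ℂ) * h (y - R • e) ∂sigma :=
      funext fun y => integral_sigma_restrict _
    rw [this]
    have := isFiniteMeasure_sigma_restrict hcs.isCompact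
    refine contDiff_integral_of_compact hcs.isCompact
      (ae_restrict_mem hcs.isCompact.measurableSet) ?_
    have h1 : ContDiff ℝ ∞ fun z : Spt × Spt => (c z.2 : ℂ) :=
      Complex.ofRealCLM.contDiff.comp (hc.comp contDiff_snd)
    have h2 : ContDiff ℝ ∞ fun z : Spt × Spt => h (z.1 - R • z.2) := hh.1.comp (by fun_prop)
    exact h1.mul h2
  · have hK : IsCompact ((fun z : Spt × Spt => z.1 + R • z.2) '' (tsupport h ×ˢ tsupport c)) :=
      (hh.2.isCompact.prod hcs.isCompact).image (by fun_prop)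
    refine HasCompactSupport.intro hK fun y hy => ?_
    rw [avg, ← integral_zero Spt ℂ]
    congr 1; ext e
    by_contra h0
    obtain ⟨h1, h2⟩ := mul_ne_zero_iff.1 h0
    refine hy ⟨(y - R • e, e), ⟨subset_tsupport _ h2, subset_tsupport _ ?_⟩, by simp⟩
    simpa using h1

/-- The spatial part of a vector. -/
noncomputable def spv (e : Spt) : E3 := WithLp.toLp 2 ![e 1, e 2, e 3]

theorem continuous_spv : Continuous spv := by
  refine (PiLp.continuous_toLp 2 _).comp (continuous_pi fun i => ?_)
  fin_cases i <;> exact continuous_apply _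

theorem embL_sub_smul (t : ℝ) (x : E3) (R : ℝ) (e : Spt) :
    embL (t, x) - R • e = embL (t - R * e 0, x - R • spv e) := by
  ext i; fin_cases i <;> simp [embL_apply, spv]

theorem norm_spv_sq (e : Spt) : ‖spv e‖ ^ 2 = e 1 ^ 2 + e 2 ^ 2 + e 3 ^ 2 := by
  rw [EuclideanSpace.norm_sq_eq, Fin.sum_univ_three]; simp [spv]

theorem abs_time_lt_norm_spv {e : Spt} (he : minkSq e < 0) : |e 0| < ‖spv e‖ := by
  refine abs_lt_of_sq_lt_sq ?_ (norm_nonneg _)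
  rw [norm_spv_sq]; unfold minkSq at he; linarith

/-- A translation by Re acts on the spatial Fourier transform as the phase exp(iR p·e) and the time
shift by R e⁰. -/
theorem spFT_avg {c : Spt → ℝ} (hc : ContDiff ℝ ∞ c) (hcs : HasCompactSupport c) {h : Spt → ℂ}
    (hh : IsTest1 h) (R t : ℝ) (p : E3) : spFT (avg c R h) t p =
      ∫ e, (c e : ℂ) * (Complex.exp (Complex.I * ((R * inner ℝ p (spv e) : ℝ) : ℂ)) *
        spFT h (t - R * e 0) p) ∂sigma := by
  have h1 : ∀ e, Complex.exp (Complex.I * ((R * inner ℝ p (spv e) : ℝ) : ℂ)) *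
      spFT h (t - R * e 0) p = ∫ x : E3, Complex.exp (Complex.I * ((inner ℝ p x : ℝ) : ℂ)) *
        h (embL (t, x) - R • e) := by
    intro e
    simp_rw [embL_sub_smul]
    rw [spFT, ← integral_const_mul, ← integral_sub_right_eq_self _ (R • spv e)]
    congr 1; ext x
    rw [← mul_assoc, ← Complex.exp_add, inner_sub_right, real_inner_smul_right]
    congr 2
    push_cast; ring
  simp_rw [h1]
  simp only [spFT, avg, ← integral_const_mul]
  rw [integral_integral_swap]
  · congr 1; ext e; congr 1; ext x; ring
  · have hcont : Continuous (Function.uncurry fun (x : E3) (e : Spt) =>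
        Complex.exp (Complex.I * ((inner ℝ p x : ℝ) : ℂ)) * ((c e : ℂ) * h (embL (t, x) - R • e))) := by
      have h2 : Continuous fun z : E3 × Spt => ((inner ℝ p z.1 : ℝ) : ℂ) :=
        Complex.continuous_ofReal.comp (continuous_const.inner continuous_fst)
      have h3 : Continuous fun z : E3 × Spt => (c z.2 : ℂ) :=
        Complex.continuous_ofReal.comp (hc.continuous.comp continuous_snd)
      have h4 : Continuous fun z : E3 × Spt => h (embL (t, z.1) - R • z.2) :=
        hh.1.continuous.comp ((embL.continuous.comp (by fun_prop)).sub (by fun_prop))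
      exact ((continuous_const.mul h2).cexp).mul (h3.mul h4)
    refine hcont.integrable_of_hasCompactSupport ?_
    obtain ⟨M, -, hM⟩ := hh.exists_bound
    have hK : IsCompact ((fun z : E3 × Spt => (z.1 + R • spv z.2, z.2)) ''
        (Metric.closedBall 0 M ×ˢ tsupport c)) := by
      refine ((isCompact_closedBall _ _).prod hcs.isCompact).image ?_
      have := continuous_spv
      fun_prop
    refine HasCompactSupport.intro hK fun z hz => ?_
    by_contra h0
    obtain ⟨-, h0⟩ := mul_ne_zero_iff.1 h0
    obtain ⟨h1, h2⟩ := mul_ne_zero_iff.1 h0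
    rw [embL_sub_smul] at h2
    exact hz ⟨(z.1 - R • spv z.2, z.2), ⟨mem_closedBall_zero_iff.2 (hM _ _ h2).2,
      subset_tsupport _ (by simpa using h1)⟩, by simp⟩

/-- The two-point function of a translate, in momentum space. -/
noncomputable def shiftT0 (h : Spt → ℂ) (R : ℝ) (e : Spt) : ℂ :=
  ∫ z : ℝ × E3, shellDensity z.2 * (Complex.exp (-Complex.I * ((‖z.2‖ * |z.1| : ℝ) : ℂ)) *
    Complex.exp (Complex.I * ((R * inner ℝ z.2 (spv e) : ℝ) : ℂ))) * spFT h (z.1 - R * e 0) z.2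
    ∂((volume : Measure ℝ).prod (volume : Measure E3))

theorem norm_phase (a b : ℝ) :
    ‖Complex.exp (-Complex.I * (a : ℂ)) * Complex.exp (Complex.I * (b : ℂ))‖ = 1 := by
  rw [norm_mul, norm_exp_neg_I, one_mul, mul_comm, Complex.norm_exp_ofReal_mul_I]

theorem integrable_T0_avg {c : Spt → ℝ} (hc : ContDiff ℝ ∞ c) (hcs : HasCompactSupport c)
    {h : Spt → ℂ} (hh : IsTest1 h) (R : ℝ) :
    Integrable (fun q : (ℝ × E3) × Spt => (c q.2 : ℂ) * (shellDensity q.1.2 *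
      (Complex.exp (-Complex.I * ((‖q.1.2‖ * |q.1.1| : ℝ) : ℂ)) *
        Complex.exp (Complex.I * ((R * inner ℝ q.1.2 (spv q.2) : ℝ) : ℂ))) *
      spFT h (q.1.1 - R * q.2 0) q.1.2))
      (((volume : Measure ℝ).prod (volume : Measure E3)).prod sigma) := by
  obtain ⟨M, C, hM0, hC0, hC, hM⟩ := exists_spFT_decay hh
  obtain ⟨B, hB⟩ := hcs.isCompact.isBounded.exists_norm_le
  have hci : Integrable (fun e => ‖c e‖) sigma :=
    (hc.continuous.integrable_of_hasCompactSupport hcs).norm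
  -- The transform shifted in time by R e⁰ vanishes for |t| > M + |R||e⁰|, and |e⁰| ≤ B on the
  -- support of `c`.
  set L := M + |R| * B with hL
  have hb1 : Integrable (fun z : ℝ × E3 => (Set.Icc (-L) L).indicator (fun _ => C) z.1 *
      (‖shellDensity z.2‖ * ((1 + ‖z.2‖ ^ 2) ^ 2)⁻¹))
      ((volume : Measure ℝ).prod (volume : Measure E3)) :=
    Integrable.mul_prod (f := (Set.Icc (-L) L).indicator fun _ => C)
      ((integrable_indicator_iff measurableSet_Icc).2 (integrableOn_const (by simp)))
      integrable_shellDensity_mul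
  refine (hb1.mul_prod hci).mono' ?_ (.of_forall fun q => ?_)
  · have m1 := measurable_shellDensity
    have m2 : Measurable c := hc.continuous.measurable
    have m3 : Measurable fun q : (ℝ × E3) × Spt => spFT h (q.1.1 - R * q.2 0) q.1.2 := by
      have := continuous_spFT hh
      have h2 : Continuous fun q : (ℝ × E3) × Spt => (q.1.1 - R * q.2 0, q.1.2) := by fun_prop
      exact Continuous.measurable (by fun_prop)
    have m4 : Measurable fun q : (ℝ × E3) × Spt => (inner ℝ q.1.2 (spv q.2) : ℝ) :=
      Continuous.measurable (Continuous.inner (by fun_prop)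
        (continuous_spv.comp continuous_snd))
    have m5 : Measurable fun q : (ℝ × E3) × Spt => (‖q.1.2‖ * |q.1.1| : ℝ) :=
      Continuous.measurable (by fun_prop)
    exact Measurable.aestronglyMeasurable (by fun_prop)
  · rw [norm_mul, norm_mul, norm_mul, norm_phase, mul_one, Complex.norm_real]
    by_cases hq : q.2 ∈ tsupport c
    · by_cases hz : |q.1.1 - R * q.2 0| ≤ M
      · have hz' : q.1.1 ∈ Set.Icc (-L) L := by
          refine abs_le.1 ?_
          have h1 : |q.2 0| ≤ B := (norm_le_pi_norm q.2 0).trans (hB _ hq)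
          have h2 := abs_sub_abs_le_abs_sub q.1.1 (R * q.2 0)
          rw [abs_mul] at h2
          have := mul_le_mul_of_nonneg_left h1 (abs_nonneg R)
          linarith
        rw [Set.indicator_of_mem hz', mul_comm]
        refine mul_le_mul_of_nonneg_right ?_ (norm_nonneg _)
        calc _ ≤ ‖shellDensity q.1.2‖ * (C * ((1 + ‖q.1.2‖ ^ 2) ^ 2)⁻¹) := by
              gcongr; exact hC _ _
          _ = _ := by ring
      · rw [hM _ _ (not_le.1 hz), norm_zero, mul_zero, mul_zero]
        exact mul_nonneg (mul_nonneg (Set.indicator_nonneg (fun _ _ => hC0) _) (by positivity))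
          (norm_nonneg _)
    · rw [image_eq_zero_of_notMem_tsupport hq]; simp

theorem T0_avg {c : Spt → ℝ} (hc : ContDiff ℝ ∞ c) (hcs : HasCompactSupport c) {h : Spt → ℂ}
    (hh : IsTest1 h) (R : ℝ) : T0 (avg c R h) = ∫ e, (c e : ℂ) * shiftT0 h R e ∂sigma := by
  rw [T0_eq_prod (isTest1_avg hc hcs hh R)]
  simp_rw [spFT_avg hc hcs hh, shiftT0, ← integral_const_mul]
  refine Eq.trans ?_ (integral_integral_swap (f := fun (z : ℝ × E3) (e : Spt) =>
    (c e : ℂ) * (shellDensity z.2 * (Complex.exp (-Complex.I * ((‖z.2‖ * |z.1| : ℝ) : ℂ)) *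
      Complex.exp (Complex.I * ((R * inner ℝ z.2 (spv e) : ℝ) : ℂ))) *
      spFT h (z.1 - R * e 0) z.2)) (integrable_T0_avg hc hcs hh R))
  congr 1; ext z; congr 1; ext e; ring

/-- The substitution t ↦ t + R e⁰ moves all dependence on `R` and `e` into the phases. The amplitude
becomes a fixed integrable function, which also serves as a bound uniform in `R` and `e`. -/
theorem shiftT0_eq (h : Spt → ℂ) (R : ℝ) (e : Spt) : shiftT0 h R e =
    ∫ z : ℝ × E3, shellDensity z.2 * (Complex.exp (-Complex.I * ((‖z.2‖ * |z.1 + R * e 0| : ℝ) : ℂ)) *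
    Complex.exp (Complex.I * ((R * inner ℝ z.2 (spv e) : ℝ) : ℂ))) * spFT h z.1 z.2
    ∂((volume : Measure ℝ).prod (volume : Measure E3)) := by
  rw [shiftT0]
  refine (integral_add_right_eq_self _ ((R * e 0, 0) : ℝ × E3)).symm.trans ?_
  congr 1; ext z
  simp

theorem norm_shiftT0_le {h : Spt → ℂ} (hh : IsTest1 h) (R : ℝ) (e : Spt) : ‖shiftT0 h R e‖ ≤
    ∫ z : ℝ × E3, ‖shellDensity z.2 * 1 * spFT h z.1 z.2‖
      ∂((volume : Measure ℝ).prod (volume : Measure E3)) := by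
  rw [shiftT0_eq]
  refine norm_integral_le_of_norm_le
    (integrable_shell hh (φ := fun _ => 1) measurable_const (by simp)).norm (.of_forall fun z => ?_)
  rw [norm_mul, norm_mul, norm_phase, norm_mul, norm_mul, norm_one]

/-- On the bounded time support, t + R e⁰ has a fixed sign for large R when e⁰ ≠ 0, so |t + R e⁰| =
R|e⁰| + s(t) with s independent of R. The total phase is then R(p·e - |e⁰||p|) plus a term without
R. It is non-degenerate because |e⁰| is smaller than the spatial length of a spacelike `e`. -/
theorem tendsto_shiftT0 {h : Spt → ℂ} (hh : IsTest1 h) {e : Spt} (he : minkSq e < 0) :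
    Tendsto (fun R => shiftT0 h R e) atTop (𝓝 0) := by
  obtain ⟨M, C, hM0, hC0, hC, hM⟩ := exists_spFT_decay hh
  obtain ⟨s, hs, hst⟩ : ∃ s : ℝ → ℝ, Continuous s ∧ ∀ᶠ R : ℝ in atTop, ∀ t, |t| ≤ M →
      |t + R * e 0| = R * |e 0| + s t := by
    rcases lt_trichotomy (e 0) 0 with h0 | h0 | h0
    · refine ⟨fun t => -t, by fun_prop, ?_⟩
      filter_upwards [eventually_ge_atTop (M / |e 0|)] with R hR t ht
      rw [div_le_iff₀ (abs_pos.2 h0.ne), abs_of_neg h0] at hR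
      rw [abs_of_neg h0, abs_of_nonpos (by linarith [le_abs_self t])]; ring
    · exact ⟨fun t => |t|, by fun_prop, .of_forall fun R t _ => by simp [h0]⟩
    · refine ⟨fun t => t, by fun_prop, ?_⟩
      filter_upwards [eventually_ge_atTop (M / |e 0|)] with R hR t ht
      rw [div_le_iff₀ (abs_pos.2 h0.ne'), abs_of_pos h0] at hR
      rw [abs_of_pos h0, abs_of_nonneg (by linarith [neg_abs_le t])]; ring
  have hi : Integrable (fun z : ℝ × E3 => shellDensity z.2 *
      Complex.exp (-Complex.I * ((‖z.2‖ * s z.1 : ℝ) : ℂ)) * spFT h z.1 z.2)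
      ((volume : Measure ℝ).prod (volume : Measure E3)) :=
    integrable_shell hh (by fun_prop) fun z => (norm_exp_neg_I _).le
  have hθ : Measurable fun p : E3 => inner ℝ p (spv e) - |e 0| * ‖p‖ :=
    (by fun_prop : Continuous fun p : E3 => inner ℝ p (spv e) - |e 0| * ‖p‖).measurable
  refine (tendsto_integral_mul_exp hθ (map_phase_absolutelyContinuous (abs_nonneg _)
    (abs_time_lt_norm_spv he)) hi.integral_prod_right).congr' ?_
  filter_upwards [hst] with R hR
  have hpt : ∀ z : ℝ × E3, shellDensity z.2 *
      (Complex.exp (-Complex.I * ((‖z.2‖ * |z.1 + R * e 0| : ℝ) : ℂ)) *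
        Complex.exp (Complex.I * ((R * inner ℝ z.2 (spv e) : ℝ) : ℂ))) * spFT h z.1 z.2 =
      (shellDensity z.2 * Complex.exp (-Complex.I * ((‖z.2‖ * s z.1 : ℝ) : ℂ)) * spFT h z.1 z.2) *
        Complex.exp (Complex.I * ((R * (inner ℝ z.2 (spv e) - |e 0| * ‖z.2‖) : ℝ) : ℂ)) := by
    intro z
    by_cases hz : |z.1| ≤ M
    · rw [hR _ hz, mul_right_comm (shellDensity z.2 * _), mul_assoc (shellDensity z.2) (Complex.exp _),
        ← Complex.exp_add, ← Complex.exp_add]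
      congr 3
      push_cast; ring
    · rw [hM _ _ (not_le.1 hz)]; simp
  rw [shiftT0_eq]
  simp_rw [hpt]
  refine Eq.trans ?_ (integral_prod_symm _ (integrable_mul_exp (hθ.comp measurable_snd) hi R)).symm
  simp only [Function.comp_apply, integral_mul_const]

/-- The two-point function decays in spacelike directions. -/
theorem tendsto_T0_avg {c : Spt → ℝ} (hc : ContDiff ℝ ∞ c) (hcs : HasCompactSupport c)
    {h : Spt → ℂ} (hh : IsTest1 h) : Tendsto (fun R => T0 (avg c R h)) atTop (𝓝 0) := by
  simp_rw [T0_avg hc hcs hh]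
  rw [← integral_zero Spt ℂ (μ := sigma)]
  refine tendsto_integral_filter_of_dominated_convergence (fun e => ‖c e‖ *
    ∫ z : ℝ × E3, ‖shellDensity z.2 * 1 * spFT h z.1 z.2‖
      ∂((volume : Measure ℝ).prod (volume : Measure E3))) ?_ ?_ ?_ ?_
  · refine .of_forall fun R => ?_
    have := (integrable_T0_avg hc hcs hh R).integral_prod_right.aestronglyMeasurable
    refine this.congr (.of_forall fun e => ?_)
    simp only [integral_const_mul, shiftT0]
  · refine .of_forall fun R => .of_forall fun e => ?_
    rw [norm_mul, Complex.norm_real]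
    exact mul_le_mul_of_nonneg_left (norm_shiftT0_le hh R e) (norm_nonneg _)
  · exact (hc.continuous.integrable_of_hasCompactSupport hcs).norm.mul_const _
  · filter_upwards [sigma_ae] with e he
    simpa using (tendsto_shiftT0 hh (by rw [he]; norm_num)).const_mul (c e : ℂ)

/-! ### Test functions of two points -/

/-- `∂g/∂x'^μ` for a test function `g(x,x')`. -/
noncomputable def pdx' (μ : Fin 4) (g : Spt × Spt → ℂ) : Spt × Spt → ℂ :=
  fun z => fderiv ℝ g z (0, Pi.single μ 1)

section TestFunctions

variable {E : Type} [NormedAddCommGroup E] [NormedSpace ℝ E]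

theorem contDiff_fderiv_const {g : E → ℂ} (hg : ContDiff ℝ ∞ g) (v : E) :
    ContDiff ℝ ∞ fun z => fderiv ℝ g z v :=
  (hg.fderiv_right (m := ∞) (by simp)).clm_apply contDiff_const

theorem fderiv_fderiv_const {g : E → ℂ} (hg : ContDiff ℝ ∞ g) (v w : E) (z : E) :
    fderiv ℝ (fun z => fderiv ℝ g z v) z w = fderiv ℝ (fderiv ℝ g) z w v := by
  have h1 : DifferentiableAt ℝ (fderiv ℝ g) z :=
    (hg.fderiv_right (m := ∞) (by simp)).differentiable (by simp) z
  rw [fderiv_clm_apply h1 (differentiableAt_const v)]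
  simp

theorem fderiv_fderiv_comm {g : E → ℂ} (hg : ContDiff ℝ ∞ g) (v w : E) (z : E) :
    fderiv ℝ (fun z => fderiv ℝ g z v) z w = fderiv ℝ (fun z => fderiv ℝ g z w) z v := by
  rw [fderiv_fderiv_const hg, fderiv_fderiv_const hg]
  exact (hg.contDiffAt.isSymmSndFDerivAt (by simpa using ENat.LEInfty.out)).eq w v

end TestFunctions

theorem IsTest.add {g h : Spt × Spt → ℂ} (hg : IsTest g) (hh : IsTest h) : IsTest (g + h) :=
  ⟨hg.1.add hh.1, hg.2.add hh.2⟩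

theorem IsTest.smul {g : Spt × Spt → ℂ} (hg : IsTest g) (z : ℂ) : IsTest (z • g) :=
  ⟨contDiff_const.smul hg.1, hg.2.smul_left (f := fun _ => z)⟩

theorem isTest_zero : IsTest 0 := ⟨contDiff_const, HasCompactSupport.zero⟩

theorem IsTest.sum {α : Type*} {s : Finset α} {g : α → Spt × Spt → ℂ}
    (hg : ∀ i ∈ s, IsTest (g i)) : IsTest (∑ i ∈ s, g i) := by
  classical
  induction s using Finset.induction_on with
  | empty => simpa using isTest_zero
  | insert i s hi ih =>
    rw [Finset.sum_insert hi]
    exact (hg i (by simp)).add (ih fun j hj => hg j (by simp [hj]))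

theorem IsTest.pdx {g : Spt × Spt → ℂ} (hg : IsTest g) (μ : Fin 4) : IsTest (pdx μ g) :=
  ⟨contDiff_fderiv_const hg.1 _, hg.2.fderiv_apply ℝ _⟩

theorem IsTest.pdx' {g : Spt × Spt → ℂ} (hg : IsTest g) (μ : Fin 4) : IsTest (pdx' μ g) :=
  ⟨contDiff_fderiv_const hg.1 _, hg.2.fderiv_apply ℝ _⟩

theorem IsTest.swap {g : Spt × Spt → ℂ} (hg : IsTest g) : IsTest fun z => g (z.2, z.1) :=
  ⟨hg.1.comp (contDiff_snd.prodMk contDiff_fst),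
    hg.2.comp_homeomorph (Homeomorph.prodComm Spt Spt)⟩

theorem pdx_comm {g : Spt × Spt → ℂ} (hg : IsTest g) (μ ν : Fin 4) :
    pdx μ (pdx ν g) = pdx ν (pdx μ g) :=
  funext fun z => fderiv_fderiv_comm hg.1 _ _ z

theorem pdx_add {g h : Spt × Spt → ℂ} (hg : IsTest g) (hh : IsTest h) (μ : Fin 4) :
    pdx μ (g + h) = pdx μ g + pdx μ h := by
  ext z
  simp only [pdx, Pi.add_apply]
  rw [fderiv_add ((hg.1.differentiable (by simp)) z) ((hh.1.differentiable (by simp)) z)]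
  rfl

theorem pdx_smul (g : Spt × Spt → ℂ) (μ : Fin 4) (z : ℂ) : pdx μ (z • g) = z • pdx μ g := by
  ext w
  simp only [pdx, Pi.smul_apply]
  rw [fderiv_const_smul_field]
  rfl

theorem swap_pdx (g : Spt × Spt → ℂ) (μ : Fin 4) :
    (fun z : Spt × Spt => pdx μ g (z.2, z.1)) = pdx' μ (fun z => g (z.2, z.1)) := by
  ext z
  have := (ContinuousLinearEquiv.prodComm ℝ Spt Spt).comp_right_fderiv (f := g) (x := z)
  simp only [pdx, pdx']
  change _ = fderiv ℝ (g ∘ (ContinuousLinearEquiv.prodComm ℝ Spt Spt)) z _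
  rw [this]
  rfl

/-! ### Integration over the center -/

/-- `∫ dx' g(x'+y, x')`. -/
noncomputable def diffInt (g : Spt × Spt → ℂ) : Spt → ℂ := fun y => ∫ x', g (x' + y, x')

theorem diffInt_eq_restrict (g : Spt × Spt → ℂ) (y : Spt) :
    diffInt g y = ∫ x' in Prod.snd '' tsupport g, g (x' + y, x') := by
  refine (setIntegral_eq_integral_of_forall_compl_eq_zero fun x hx => ?_).symm
  by_contra h0
  exact hx ⟨_, subset_tsupport _ h0, rfl⟩

theorem isFiniteMeasure_volume_restrict {K : Set Spt} (hK : IsCompact K) :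
    IsFiniteMeasure ((volume : Measure Spt).restrict K) :=
  ⟨by rw [Measure.restrict_apply_univ]; exact hK.measure_lt_top⟩

theorem contDiff_diffInt_integrand {g : Spt × Spt → ℂ} (hg : ContDiff ℝ ∞ g) :
    ContDiff ℝ ∞ (Function.uncurry fun (y x' : Spt) => g (x' + y, x')) :=
  hg.comp (by fun_prop : ContDiff ℝ ∞ fun z : Spt × Spt => (z.2 + z.1, z.2))

theorem IsTest.diffInt {g : Spt × Spt → ℂ} (hg : IsTest g) : IsTest1 (diffInt g) := by
  have hK : IsCompact (Prod.snd '' tsupport g) := hg.2.isCompact.image continuous_snd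
  constructor
  · rw [show StringQCD.diffInt g = _ from funext (diffInt_eq_restrict g)]
    have := isFiniteMeasure_volume_restrict hK
    exact contDiff_integral_of_compact hK (ae_restrict_mem hK.measurableSet)
      (contDiff_diffInt_integrand hg.1)
  · refine HasCompactSupport.intro (K := (fun z : Spt × Spt => z.1 - z.2) '' tsupport g)
      (hg.2.isCompact.image (by fun_prop)) fun y hy => ?_
    rw [StringQCD.diffInt, ← integral_zero Spt ℂ]
    congr 1; ext x
    by_contra h0
    exact hy ⟨_, subset_tsupport _ h0, by simp⟩

theorem pd_diffInt {g : Spt × Spt → ℂ} (hg : IsTest g) (μ : Fin 4) :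
    pd μ (diffInt g) = diffInt (pdx μ g) := by
  have hK : IsCompact (Prod.snd '' tsupport g) := hg.2.isCompact.image continuous_snd
  have := isFiniteMeasure_volume_restrict hK
  ext y
  rw [pd, show diffInt g = _ from funext (diffInt_eq_restrict g),
    fderiv_integral_of_compact hK (ae_restrict_mem hK.measurableSet)
      (contDiff_diffInt_integrand hg.1)]
  have h1 : ∀ x', fderiv ℝ (fun y => g (x' + y, x')) y (Pi.single μ 1) = pdx μ g (x' + y, x') := by
    intro x'
    have h2 : HasFDerivAt (fun y : Spt => (x' + y, x')) (ContinuousLinearMap.inl ℝ Spt Spt) y :=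
      ((hasFDerivAt_id y).const_add x').prodMk (hasFDerivAt_const x' y)
    have := ((hg.1.differentiable (by simp)) (x' + y, x')).hasFDerivAt.comp y h2
    exact congrArg (fun L : Spt →L[ℝ] ℂ => L (Pi.single μ 1)) this.fderiv
  simp_rw [h1]
  refine setIntegral_eq_integral_of_forall_compl_eq_zero fun x hx => ?_
  by_contra h0
  exact hx ⟨_, tsupport_fderiv_apply_subset ℝ _ (subset_tsupport _ h0), rfl⟩

theorem integrable_diffInt {g : Spt × Spt → ℂ} (hg : IsTest g) (y : Spt) :
    Integrable fun x' => g (x' + y, x') := by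
  refine Continuous.integrable_of_hasCompactSupport
    (hg.1.continuous.comp (by fun_prop)) ?_
  refine HasCompactSupport.intro (hg.2.isCompact.image continuous_snd) fun x hx => ?_
  by_contra h0
  exact hx ⟨_, subset_tsupport _ h0, rfl⟩

theorem diffInt_add {g h : Spt × Spt → ℂ} (hg : IsTest g) (hh : IsTest h) :
    diffInt (g + h) = diffInt g + diffInt h :=
  funext fun y => integral_add (integrable_diffInt hg y) (integrable_diffInt hh y)

theorem diffInt_smul (z : ℂ) (g : Spt × Spt → ℂ) : diffInt (z • g) = z • diffInt g :=
  funext fun _ => integral_const_mul z _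

theorem integral_fderiv_test {h : Spt → ℂ} (hh : IsTest1 h) (v : Spt) :
    ∫ x, fderiv ℝ h x v = 0 := by
  have hv : Integrable fun x => fderiv ℝ h x v :=
    ((contDiff_fderiv_const hh.1 v).continuous).integrable_of_hasCompactSupport
      (hh.2.fderiv_apply ℝ v)
  have := integral_mul_fderiv_eq_neg_fderiv_mul_of_integrable (μ := (volume : Measure Spt))
    (f := fun _ => (1 : ℂ)) (g := h) (v := v) (by simp) (by simpa using hv)
    (by simpa using hh.1.continuous.integrable_of_hasCompactSupport hh.2)
    (fun x _ => differentiableAt_const _) (fun x _ => (hh.1.differentiable (by simp)) x)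
  simpa using this

/-- The sum ∂ + ∂' differentiates along the diagonal direction, over which `diffInt` integrates. -/
theorem diffInt_pdx' {g : Spt × Spt → ℂ} (hg : IsTest g) (μ : Fin 4) :
    diffInt (pdx' μ g) = -diffInt (pdx μ g) := by
  ext y
  have h1 : IsTest1 fun x' => g (x' + y, x') := by
    refine ⟨hg.1.comp (by fun_prop), ?_⟩
    refine HasCompactSupport.intro (hg.2.isCompact.image continuous_snd) fun x hx => ?_
    by_contra h0
    exact hx ⟨_, subset_tsupport _ h0, rfl⟩
  have h2 : ∀ x', fderiv ℝ (fun x' => g (x' + y, x')) x' (Pi.single μ 1) =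
      pdx μ g (x' + y, x') + pdx' μ g (x' + y, x') := by
    intro x'
    have h3 : HasFDerivAt (fun x' : Spt => (x' + y, x'))
        ((ContinuousLinearMap.id ℝ Spt).prod (ContinuousLinearMap.id ℝ Spt)) x' :=
      ((hasFDerivAt_id x').add_const y).prodMk (hasFDerivAt_id x')
    have := ((hg.1.differentiable (by simp)) (x' + y, x')).hasFDerivAt.comp
      (f := fun x' : Spt => (x' + y, x')) x' h3
    rw [show fderiv ℝ (fun x' => g (x' + y, x')) x' = _ from this.fderiv]
    simp only [pdx, pdx', ContinuousLinearMap.comp_apply, ContinuousLinearMap.prod_apply,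
      ContinuousLinearMap.id_apply]
    rw [← map_add]; simp
  have h3 := integral_fderiv_test h1 (Pi.single μ 1)
  simp_rw [h2] at h3
  rw [integral_add (integrable_diffInt (hg.pdx μ) y) (integrable_diffInt (hg.pdx' μ) y)] at h3
  exact eq_neg_of_add_eq_zero_right h3

theorem delta_eq (g : Spt × Spt → ℂ) : delta g = diffInt g 0 := by simp [delta, diffInt]

/-! ### The kernel `T₀(x-x')` -/

theorem T0K_eq (g : Spt × Spt → ℂ) : T0K g = T0 (diffInt g) := rfl

theorem T0K_add {g h : Spt × Spt → ℂ} (hg : IsTest g) (hh : IsTest h) :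
    T0K (g + h) = T0K g + T0K h := by
  rw [T0K_eq, diffInt_add hg hh, T0_add hg.diffInt hh.diffInt]; rfl

theorem T0K_smul {g : Spt × Spt → ℂ} (hg : IsTest g) (z : ℂ) : T0K (z • g) = z * T0K g := by
  rw [T0K_eq, diffInt_smul, T0_smul hg.diffInt]; rfl

theorem T0K_box {g : Spt × Spt → ℂ} (hg : IsTest g) :
    ∑ μ, sgn μ * T0K (pdx μ (pdx μ g)) = -Complex.I * delta g := by
  rw [delta_eq, ← T0_box hg.diffInt]
  refine Finset.sum_congr rfl fun μ _ => ?_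
  rw [T0K_eq, ← pd_diffInt (hg.pdx μ), ← pd_diffInt hg]

/-- The average over translates of `x`. -/
noncomputable def avgX (c : Spt → ℝ) (R : ℝ) (g : Spt × Spt → ℂ) : Spt × Spt → ℂ := fun z =>
  ∫ e, (c e : ℂ) * g (z.1 - R • e, z.2) ∂sigma

theorem diffInt_avgX {c : Spt → ℝ} (hc : ContDiff ℝ ∞ c) (hcs : HasCompactSupport c)
    {g : Spt × Spt → ℂ} (hg : IsTest g) (R : ℝ) : diffInt (avgX c R g) = avg c R (diffInt g) := by
  ext y
  simp only [diffInt, avg, avgX, ← integral_const_mul]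
  rw [integral_integral_swap]
  · simp_rw [add_sub_assoc]
  · have hcont : Continuous (Function.uncurry fun (x e : Spt) =>
        (c e : ℂ) * g (x + y - R • e, x)) := by
      have h3 : Continuous fun z : Spt × Spt => (c z.2 : ℂ) :=
        Complex.continuous_ofReal.comp (hc.continuous.comp continuous_snd)
      have h4 : Continuous fun z : Spt × Spt => g (z.1 + y - R • z.2, z.1) :=
        hg.1.continuous.comp (by fun_prop)
      exact h3.mul h4
    refine hcont.integrable_of_hasCompactSupport (HasCompactSupport.intro
      ((hg.2.isCompact.image continuous_snd).prod hcs.isCompact) fun z hz => ?_)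
    by_contra h0
    obtain ⟨h1, h2⟩ := mul_ne_zero_iff.1 h0
    exact hz ⟨⟨_, subset_tsupport _ h2, rfl⟩, subset_tsupport _ (by simpa using h1)⟩

theorem tendsto_T0K_avgX {c : Spt → ℝ} (hc : ContDiff ℝ ∞ c) (hcs : HasCompactSupport c)
    {g : Spt × Spt → ℂ} (hg : IsTest g) : Tendsto (fun R => T0K (avgX c R g)) atTop (𝓝 0) := by
  simp_rw [T0K_eq, diffInt_avgX hc hcs hg]
  exact tendsto_T0_avg hc hcs hg.diffInt

/-! ### Finite strings -/

section Strings

variable {E : Type} [NormedAddCommGroup E] [NormedSpace ℝ E] [FiniteDimensional ℝ E]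

/-- `∫ dσ(e) u(e) ∫₀^R s^j ds g(z - s A e)`. -/
noncomputable def strG (u : Spt → ℂ) (j : ℕ) (R : ℝ) (A : Spt →L[ℝ] E) (g : E → ℂ) : E → ℂ :=
  fun z => ∫ e, u e * (∫ s in (0 : ℝ)..R, (s : ℂ) ^ j * g (z - s • A e)) ∂sigma

/-- The measure on finite strings. -/
noncomputable def strMeas (u : Spt → ℂ) (R : ℝ) : Measure (Spt × ℝ) :=
  (sigma.restrict (tsupport u)).prod (volume.restrict (Set.Icc 0 R))

theorem isFiniteMeasure_strMeas {u : Spt → ℂ} (hus : HasCompactSupport u) (R : ℝ) :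
    IsFiniteMeasure (strMeas u R) := by
  have := isFiniteMeasure_sigma_restrict hus.isCompact
  unfold strMeas; infer_instance

theorem strMeas_ae {u : Spt → ℂ} (R : ℝ) :
    ∀ᵐ q ∂strMeas u R, q ∈ tsupport u ×ˢ Set.Icc 0 R := by
  rw [strMeas, Measure.prod_restrict]
  exact ae_restrict_mem ((isClosed_tsupport u).measurableSet.prod measurableSet_Icc)

theorem contDiff_strG_integrand {u : Spt → ℂ} (hu : ContDiff ℝ ∞ u) (j : ℕ) (A : Spt →L[ℝ] E)
    {g : E → ℂ} (hg : ContDiff ℝ ∞ g) : ContDiff ℝ ∞ (Function.uncurry fun (z : E) (q : Spt × ℝ) =>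
      u q.1 * ((q.2 : ℂ) ^ j * g (z - q.2 • A q.1))) := by
  have h1 : ContDiff ℝ ∞ fun z : E × (Spt × ℝ) => u z.2.1 := hu.comp (by fun_prop)
  have h2 : ContDiff ℝ ∞ fun z : E × (Spt × ℝ) => ((z.2.2 : ℝ) : ℂ) :=
    Complex.ofRealCLM.contDiff.comp (by fun_prop)
  have h3 : ContDiff ℝ ∞ fun z : E × (Spt × ℝ) => z.1 - z.2.2 • A z.2.1 :=
    contDiff_fst.sub ((by fun_prop : ContDiff ℝ ∞ fun z : E × (Spt × ℝ) => z.2.2).smul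
      (A.contDiff.comp (by fun_prop)))
  exact h1.mul ((h2.pow j).mul (hg.comp h3))

theorem continuous_strG_integrand {u : Spt → ℂ} (hu : Continuous u) (j : ℕ) (A : Spt →L[ℝ] E)
    {g : E → ℂ} (hg : Continuous g) (z : E) : Continuous fun q : Spt × ℝ =>
      u q.1 * ((q.2 : ℂ) ^ j * g (z - q.2 • A q.1)) := by
  have h2 : Continuous fun z : Spt × ℝ => ((z.2 : ℝ) : ℂ) :=
    Complex.continuous_ofReal.comp continuous_snd
  exact (hu.comp continuous_fst).mul ((h2.pow j).mul (hg.comp (by fun_prop)))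

/-- Written as a single integral over a finite measure carried by a compact set, a finite string
inherits smoothness and differentiation under the integral sign. -/
theorem strG_eq {u : Spt → ℂ} (hu : Continuous u) (hus : HasCompactSupport u) (j : ℕ) {R : ℝ}
    (hR : 0 ≤ R) (A : Spt →L[ℝ] E) {g : E → ℂ} (hg : Continuous g) (z : E) :
    strG u j R A g z = ∫ q, u q.1 * ((q.2 : ℂ) ^ j * g (z - q.2 • A q.1)) ∂strMeas u R := by
  have := isFiniteMeasure_strMeas hus R
  have hi : Integrable (fun q : Spt × ℝ => u q.1 * ((q.2 : ℂ) ^ j * g (z - q.2 • A q.1)))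
      (strMeas u R) := integrable_of_continuous_of_compact (hus.isCompact.prod isCompact_Icc)
    (strMeas_ae R) (continuous_strG_integrand hu j A hg z)
  rw [strMeas, integral_prod _ hi, strG]
  simp_rw [integral_const_mul, intervalIntegral.integral_of_le hR, integral_Icc_eq_integral_Ioc]
  refine (setIntegral_eq_integral_of_forall_compl_eq_zero fun e he => ?_).symm
  rw [image_eq_zero_of_notMem_tsupport he, zero_mul]

theorem contDiff_strG {u : Spt → ℂ} (hu : ContDiff ℝ ∞ u) (hus : HasCompactSupport u) (j : ℕ)
    {R : ℝ} (hR : 0 ≤ R) (A : Spt →L[ℝ] E) {g : E → ℂ} (hg : ContDiff ℝ ∞ g) :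
    ContDiff ℝ ∞ (strG u j R A g) := by
  rw [show strG u j R A g = _ from
    funext (strG_eq hu.continuous hus j hR A hg.continuous)]
  have := isFiniteMeasure_strMeas hus R
  exact contDiff_integral_of_compact (hus.isCompact.prod isCompact_Icc) (strMeas_ae R)
    (contDiff_strG_integrand hu j A hg)

theorem fderiv_strG {u : Spt → ℂ} (hu : ContDiff ℝ ∞ u) (hus : HasCompactSupport u) (j : ℕ)
    {R : ℝ} (hR : 0 ≤ R) (A : Spt →L[ℝ] E) {g : E → ℂ} (hg : ContDiff ℝ ∞ g) (z v : E) :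
    fderiv ℝ (strG u j R A g) z v = strG u j R A (fun z => fderiv ℝ g z v) z := by
  rw [show strG u j R A g = _ from funext (strG_eq hu.continuous hus j hR A hg.continuous),
    strG_eq hu.continuous hus j hR A (contDiff_fderiv_const hg v).continuous]
  have := isFiniteMeasure_strMeas hus R
  rw [fderiv_integral_of_compact (hus.isCompact.prod isCompact_Icc) (strMeas_ae R)
    (contDiff_strG_integrand hu j A hg)]
  congr 1; ext q
  have h2 : HasFDerivAt (fun z : E => z - q.2 • A q.1) (ContinuousLinearMap.id ℝ E) z :=
    (hasFDerivAt_id z).sub_const _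
  have h3 := ((hg.differentiable (by simp)) (z - q.2 • A q.1)).hasFDerivAt.comp
    (f := fun z : E => z - q.2 • A q.1) z h2
  have := (h3.const_mul ((q.2 : ℂ) ^ j)).const_mul (u q.1)
  exact congrArg (fun L : E →L[ℝ] ℂ => L v) this.fderiv

theorem hasCompactSupport_strG {u : Spt → ℂ} (hus : HasCompactSupport u) (j : ℕ)
    {R : ℝ} (hR : 0 ≤ R) (A : Spt →L[ℝ] E) {g : E → ℂ} (hg : HasCompactSupport g) :
    HasCompactSupport (strG u j R A g) := by
  refine HasCompactSupport.intro (K := (fun z : E × (Spt × ℝ) => z.1 + z.2.2 • A z.2.1) ''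
    (tsupport g ×ˢ (tsupport u ×ˢ Set.Icc 0 R)))
    ((hg.isCompact.prod (hus.isCompact.prod isCompact_Icc)).image (by fun_prop)) fun z hz => ?_
  rw [strG, ← integral_zero Spt ℂ]
  congr 1; ext e
  by_contra h0
  obtain ⟨h1, h2⟩ := mul_ne_zero_iff.1 h0
  refine h2 ?_
  rw [intervalIntegral.integral_of_le hR]
  refine setIntegral_eq_zero_of_forall_eq_zero fun s hs => ?_
  by_contra h3
  obtain ⟨-, h4⟩ := mul_ne_zero_iff.1 h3
  exact hz ⟨(z - s • A e, e, s), ⟨subset_tsupport _ h4, subset_tsupport _ h1,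
    Set.Ioc_subset_Icc_self hs⟩, by simp⟩

end Strings

/-- The weight `c(e) e^ν`. -/
noncomputable def wt (c : Spt → ℝ) (ν : Fin 4) (e : Spt) : ℂ := (c e : ℂ) * (e ν : ℂ)

theorem contDiff_wt {c : Spt → ℝ} (hc : ContDiff ℝ ∞ c) (ν : Fin 4) : ContDiff ℝ ∞ (wt c ν) := by
  have h1 : ContDiff ℝ ∞ fun e : Spt => e ν := by fun_prop
  exact (Complex.ofRealCLM.contDiff.comp hc).mul (Complex.ofRealCLM.contDiff.comp h1)

theorem hasCompactSupport_wt {c : Spt → ℝ} (hcs : HasCompactSupport c) (ν : Fin 4) :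
    HasCompactSupport (wt c ν) :=
  HasCompactSupport.mul_right (f := fun e => (c e : ℂ)) (hcs.comp_left Complex.ofReal_zero)

theorem sum_coord_smul {E : Type*} [AddCommGroup E] [Module ℝ E] (A : Spt →ₗ[ℝ] E) (e : Spt) :
    ∑ l, e l • A (Pi.single l 1) = A e := by
  conv_rhs => rw [← Finset.univ_sum_single e]
  rw [map_sum]
  refine Finset.sum_congr rfl fun l _ => ?_
  rw [← map_smul, ← Pi.single_smul, smul_eq_mul, mul_one]

section

variable {E : Type} [NormedAddCommGroup E] [NormedSpace ℝ E] [FiniteDimensional ℝ E]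

theorem integral_string_derivative {g : E → ℂ} (hg : ContDiff ℝ ∞ g) (z w : E) (R : ℝ) :
    ∫ s in (0 : ℝ)..R, fderiv ℝ g (z - s • w) w = g z - g (z - R • w) := by
  have h1 : ∀ s : ℝ, HasDerivAt (fun s : ℝ => -g (z - s • w)) (fderiv ℝ g (z - s • w) w) s := by
    intro s
    have h2 : HasDerivAt (fun s : ℝ => z - s • w) (-w) s := by
      simpa using ((hasDerivAt_id s).smul_const w).const_sub z
    have := (((hg.differentiable (by simp)) (z - s • w)).hasFDerivAt.comp_hasDerivAt s h2).neg
    exact this.congr_deriv (by simp)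
  rw [intervalIntegral.integral_eq_sub_of_hasDerivAt (fun s _ => h1 s)]
  · simp; ring
  · refine Continuous.intervalIntegrable ?_ _ _
    exact (contDiff_fderiv_const hg w).continuous.comp (by fun_prop)

/-- The derivative of a string in its own direction. -/
theorem sum_strG_fderiv {c : Spt → ℝ} (hc : ContDiff ℝ ∞ c) (hcs : HasCompactSupport c)
    (R : ℝ) (A : Spt →L[ℝ] E) {g : E → ℂ} (hg : ContDiff ℝ ∞ g) (z : E) :
    ∑ l, strG (wt c l) 0 R A (fun z => fderiv ℝ g z (A (Pi.single l 1))) z =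
      ∫ e, (c e : ℂ) * (g z - g (z - R • A e)) ∂sigma := by
  have hcont : ∀ l, Continuous fun z => fderiv ℝ g z (A (Pi.single l 1)) := fun l =>
    (contDiff_fderiv_const hg _).continuous
  simp only [strG, pow_zero, one_mul]
  rw [← integral_finsetSum]
  · congr 1; ext e
    rw [← integral_string_derivative hg, ← intervalIntegral.integral_const_mul]
    simp_rw [← intervalIntegral.integral_const_mul]
    rw [← intervalIntegral.integral_finsetSum]
    · congr 1; ext s
      conv_rhs => rw [← ContinuousLinearMap.coe_coe A, ← sum_coord_smul (A : Spt →ₗ[ℝ] E) e, map_sum,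
        Finset.mul_sum]
      refine Finset.sum_congr rfl fun l _ => ?_
      rw [map_smul, Complex.real_smul, wt, mul_assoc]
      simp only [ContinuousLinearMap.coe_coe]
      rw [← ContinuousLinearMap.coe_coe A, sum_coord_smul (A : Spt →ₗ[ℝ] E) e]
    · intro l _
      exact (continuous_const.mul ((hcont l).comp (by fun_prop))).intervalIntegrable _ _
  · intro l _
    have h1 := contDiff_wt hc l
    have hs := hasCompactSupport_wt hcs l
    refine Continuous.integrable_of_hasCompactSupport (h1.continuous.mul ?_) hs.mul_right
    refine intervalIntegral.continuous_parametric_intervalIntegral_of_continuous' ?_ _ _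
    exact (hcont l).comp (by fun_prop)

end

/-! ### Strings acting on test functions of two points -/

/-- All finite strings are instances of `strG`: the embedding `inl` moves `x`, `inr` moves `x'`, and
±id acts on functions of one point. -/
theorem strX_eq (c : Spt → ℝ) (ν : Fin 4) (R : ℝ) (g : Spt × Spt → ℂ) :
    strX c ν R g = strG (wt c ν) 0 R (ContinuousLinearMap.inl ℝ Spt Spt) g := by
  ext z; simp [strX, strG, wt, Prod.sub_def]

theorem strX'_eq (c : Spt → ℝ) (ν : Fin 4) (R : ℝ) (g : Spt × Spt → ℂ) :
    strX' c ν R g = strG (wt c ν) 0 R (ContinuousLinearMap.inr ℝ Spt Spt) g := by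
  ext z; simp [strX', strG, wt, Prod.sub_def]

theorem IsTest.strX {c : Spt → ℝ} (hc : ContDiff ℝ ∞ c) (hcs : HasCompactSupport c)
    {g : Spt × Spt → ℂ} (hg : IsTest g) (ν : Fin 4) {R : ℝ} (hR : 0 ≤ R) : IsTest (strX c ν R g) := by
  rw [strX_eq]
  exact ⟨contDiff_strG (contDiff_wt hc ν) (hasCompactSupport_wt hcs ν) 0 hR _ hg.1,
    hasCompactSupport_strG (hasCompactSupport_wt hcs ν) 0 hR _ hg.2⟩

theorem IsTest.strX' {c : Spt → ℝ} (hc : ContDiff ℝ ∞ c) (hcs : HasCompactSupport c)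
    {g : Spt × Spt → ℂ} (hg : IsTest g) (ν : Fin 4) {R : ℝ} (hR : 0 ≤ R) :
    IsTest (strX' c ν R g) := by
  rw [strX'_eq]
  exact ⟨contDiff_strG (contDiff_wt hc ν) (hasCompactSupport_wt hcs ν) 0 hR _ hg.1,
    hasCompactSupport_strG (hasCompactSupport_wt hcs ν) 0 hR _ hg.2⟩

theorem pdx_strX {c : Spt → ℝ} (hc : ContDiff ℝ ∞ c) (hcs : HasCompactSupport c)
    {g : Spt × Spt → ℂ} (hg : IsTest g) (ν μ : Fin 4) {R : ℝ} (hR : 0 ≤ R) :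
    pdx μ (strX c ν R g) = strX c ν R (pdx μ g) := by
  ext z
  rw [strX_eq, strX_eq, pdx,
    fderiv_strG (contDiff_wt hc ν) (hasCompactSupport_wt hcs ν) 0 hR _ hg.1]
  rfl

theorem pdx_strX' {c : Spt → ℝ} (hc : ContDiff ℝ ∞ c) (hcs : HasCompactSupport c)
    {g : Spt × Spt → ℂ} (hg : IsTest g) (ν μ : Fin 4) {R : ℝ} (hR : 0 ≤ R) :
    pdx μ (strX' c ν R g) = strX' c ν R (pdx μ g) := by
  ext z
  rw [strX'_eq, strX'_eq, pdx,
    fderiv_strG (contDiff_wt hc ν) (hasCompactSupport_wt hcs ν) 0 hR _ hg.1]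
  rfl

/-- The divergence of a finite string consists of its end points. -/
theorem sum_pdx_strX {c : Spt → ℝ} (hc : ContDiff ℝ ∞ c) (hcs : HasCompactSupport c)
    {g : Spt × Spt → ℂ} (hw : ∫ e, c e ∂sigma = 1) (hg : IsTest g) {R : ℝ} (hR : 0 ≤ R) :
    ∑ l, pdx l (strX c l R g) = g + (-1 : ℂ) • avgX c R g := by
  ext z
  have h1 := sum_strG_fderiv hc hcs R (ContinuousLinearMap.inl ℝ Spt Spt) hg.1 z
  have h2 : ∀ l, pdx l (strX c l R g) z = strG (wt c l) 0 R (ContinuousLinearMap.inl ℝ Spt Spt)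
      (fun z => fderiv ℝ g z (ContinuousLinearMap.inl ℝ Spt Spt (Pi.single l 1))) z := fun l => by
    rw [pdx_strX hc hcs hg l l hR, strX_eq]; rfl
  rw [Finset.sum_apply, Finset.sum_congr rfl fun l _ => h2 l, h1]
  have hci : Integrable (fun e => (c e : ℂ)) sigma :=
    (hc.continuous.integrable_of_hasCompactSupport hcs).ofReal
  simp_rw [mul_sub]
  rw [integral_sub (hci.mul_const _), integral_mul_const, integral_complex_ofReal, hw]
  · have h3 : ∀ e, z - R • ContinuousLinearMap.inl ℝ Spt Spt e = (z.1 - R • e, z.2) := fun e => by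
      ext <;> simp
    simp_rw [h3]
    simp [avgX, sub_eq_add_neg]
  · refine Continuous.integrable_of_hasCompactSupport ?_ ?_
    · exact (Complex.continuous_ofReal.comp hc.continuous).mul (hg.1.continuous.comp (by fun_prop))
    · exact HasCompactSupport.mul_right (f := fun e => (c e : ℂ))
        (hcs.comp_left Complex.ofReal_zero)

/-! ### String integrals of the delta function -/

/-- On the hyperboloid 1 = |e|² - (e⁰)² ≤ 3‖e‖² for the supremum norm. A lower bound on ‖e‖ is what
makes all strings leave a compact set after a uniform length. -/
theorem one_le_two_mul_norm {e : Spt} (he : minkSq e = -1) : 1 ≤ 2 * ‖e‖ := by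
  have h := fun i => norm_le_pi_norm e i
  have h1 := h 1; have h2 := h 2; have h3 := h 3
  simp only [Real.norm_eq_abs] at h1 h2 h3
  unfold minkSq at he
  nlinarith [sq_abs (e 1), sq_abs (e 2), sq_abs (e 3), abs_nonneg (e 1), abs_nonneg (e 2),
    abs_nonneg (e 3), sq_nonneg (e 0), norm_nonneg e]

theorem IsTest1.eq_zero_of_string {h : Spt → ℂ} (hh : IsTest1 h) : ∃ S : ℝ, 0 ≤ S ∧
    ∀ e, minkSq e = -1 → ∀ s : ℝ, S < |s| → h (s • e) = 0 := by
  obtain ⟨M, hM⟩ := hh.2.isCompact.isBounded.exists_norm_le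
  refine ⟨2 * |M|, by positivity, fun e he s hs => ?_⟩
  by_contra h0
  have h1 := hM _ (subset_tsupport _ h0)
  rw [norm_smul, Real.norm_eq_abs] at h1
  have h2 := one_le_two_mul_norm he
  nlinarith [le_abs_self M, abs_nonneg s, abs_nonneg M]

theorem integral_Ioi_eq_interval {f : ℝ → ℂ} {S R : ℝ} (hSR : S ≤ R) (hR : 0 ≤ R)
    (hf : ∀ s, S < s → f s = 0) : ∫ s in Set.Ioi (0 : ℝ), f s = ∫ s in (0 : ℝ)..R, f s := by
  rw [intervalIntegral.integral_of_le hR]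
  refine setIntegral_eq_of_subset_of_forall_sdiff_eq_zero measurableSet_Ioi
    Set.Ioc_subset_Ioi_self fun s hs => hf s ?_
  have h1 : 0 < s := hs.1
  have h2 : ¬ (0 < s ∧ s ≤ R) := hs.2
  by_contra h3
  exact h2 ⟨h1, by linarith⟩

theorem strDelta_eq (c : Spt → ℝ) (ν : Fin 4) (g : Spt × Spt → ℂ) : strDelta c ν g =
    ∫ e, wt c ν e * (∫ s in Set.Ioi (0 : ℝ), diffInt g (-(s • e))) ∂sigma := by
  unfold strDelta wt diffInt
  congr 1; ext e; congr 2; ext s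
  refine (integral_sub_right_eq_self _ (s • e)).symm.trans ?_
  simp [sub_eq_add_neg]

theorem strDelta'_eq (c : Spt → ℝ) (ν : Fin 4) (g : Spt × Spt → ℂ) : strDelta' c ν g =
    ∫ e, wt c ν e * (∫ s in Set.Ioi (0 : ℝ), diffInt g (s • e)) ∂sigma := by
  unfold strDelta' wt diffInt
  congr 1; ext e; congr 2; ext s
  refine (integral_add_right_eq_self _ (s • e)).symm.trans ?_
  simp

/-- A test function sees only a bounded piece of every string, so finite strings agree with the
infinite one from some length on, and limits in `R` are eventually constant. -/
theorem strDelta_eq_strG (c : Spt → ℝ) (ν : Fin 4) {g : Spt × Spt → ℂ} (hg : IsTest g) :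
    ∃ S : ℝ, 0 ≤ S ∧ ∀ R, S ≤ R → strDelta c ν g =
      strG (wt c ν) 0 R (ContinuousLinearMap.id ℝ Spt) (diffInt g) 0 := by
  obtain ⟨S, hS, h⟩ := hg.diffInt.eq_zero_of_string
  refine ⟨S, hS, fun R hR => ?_⟩
  rw [strDelta_eq, strG]
  refine integral_congr_ae ?_
  filter_upwards [sigma_ae] with e he
  rw [integral_Ioi_eq_interval hR (hS.trans hR) fun s hs => by
    rw [← neg_smul]; exact h e he _ (by rw [abs_neg]; exact hs.trans_le (le_abs_self s))]
  simp

theorem strDelta'_eq_strG (c : Spt → ℝ) (ν : Fin 4) {g : Spt × Spt → ℂ} (hg : IsTest g) :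
    ∃ S : ℝ, 0 ≤ S ∧ ∀ R, S ≤ R → strDelta' c ν g =
      strG (wt c ν) 0 R (-ContinuousLinearMap.id ℝ Spt) (diffInt g) 0 := by
  obtain ⟨S, hS, h⟩ := hg.diffInt.eq_zero_of_string
  refine ⟨S, hS, fun R hR => ?_⟩
  rw [strDelta'_eq, strG]
  refine integral_congr_ae ?_
  filter_upwards [sigma_ae] with e he
  rw [integral_Ioi_eq_interval hR (hS.trans hR) fun s hs =>
    h e he _ (hs.trans_le (le_abs_self s))]
  simp

theorem strG_add {E : Type} [NormedAddCommGroup E] [NormedSpace ℝ E] [FiniteDimensional ℝ E]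
    {u : Spt → ℂ} (hu : Continuous u) (hus : HasCompactSupport u) (j : ℕ) {R : ℝ}
    (hR : 0 ≤ R) (A : Spt →L[ℝ] E) {g h : E → ℂ} (hg : Continuous g) (hh : Continuous h) (z : E) :
    strG u j R A (g + h) z = strG u j R A g z + strG u j R A h z := by
  have := isFiniteMeasure_strMeas hus R
  rw [strG_eq hu hus j hR A (hg.add hh), strG_eq hu hus j hR A hg, strG_eq hu hus j hR A hh,
    ← integral_add]
  · congr 1; ext q; simp only [Pi.add_apply]; ring
  · exact integrable_of_continuous_of_compact (hus.isCompact.prod isCompact_Icc)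
      (strMeas_ae R) (continuous_strG_integrand hu j A hg z)
  · exact integrable_of_continuous_of_compact (hus.isCompact.prod isCompact_Icc)
      (strMeas_ae R) (continuous_strG_integrand hu j A hh z)

theorem strDelta_isLinear {c : Spt → ℝ} (hc : ContDiff ℝ ∞ c) (hcs : HasCompactSupport c)
    (ν : Fin 4) : (strDelta c ν).IsLinear := by
  constructor
  · intro g h hg hh
    obtain ⟨S1, h1, e1⟩ := strDelta_eq_strG c ν hg
    obtain ⟨S2, h2, e2⟩ := strDelta_eq_strG c ν hh
    obtain ⟨S3, h3, e3⟩ := strDelta_eq_strG c ν (hg.add hh)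
    set R := max S1 (max S2 S3) with hR
    have r1 : S1 ≤ R := le_max_left _ _
    have r2 : S2 ≤ R := (le_max_left _ _).trans (le_max_right _ _)
    have r3 : S3 ≤ R := (le_max_right _ _).trans (le_max_right _ _)
    rw [e1 R r1, e2 R r2, e3 R r3, diffInt_add hg hh,
      strG_add (contDiff_wt hc ν).continuous (hasCompactSupport_wt hcs ν) 0 (h1.trans r1) _
        hg.diffInt.1.continuous hh.diffInt.1.continuous]
  · intro z g _
    rw [strDelta_eq, strDelta_eq, ← integral_const_mul]
    congr 1; ext e
    rw [diffInt_smul]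
    simp only [Pi.smul_apply, smul_eq_mul, integral_const_mul]
    ring

theorem delta_isLinear : delta.IsLinear := by
  constructor
  · intro g h hg hh
    rw [delta_eq, diffInt_add hg hh, delta_eq, delta_eq]; rfl
  · intro z g _
    rw [delta_eq, diffInt_smul, delta_eq]; rfl

theorem diffInt_swap (g : Spt × Spt → ℂ) (y : Spt) :
    diffInt (fun z => g (z.2, z.1)) y = diffInt g (-y) := by
  unfold diffInt
  refine (integral_sub_right_eq_self _ y).symm.trans ?_
  simp [sub_eq_add_neg]

theorem strDelta'_eq_swap (c : Spt → ℝ) (ν : Fin 4) (g : Spt × Spt → ℂ) :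
    strDelta' c ν g = strDelta c ν (fun z => g (z.2, z.1)) := by
  rw [strDelta_eq, strDelta'_eq]
  simp_rw [diffInt_swap, neg_neg]

theorem strDelta_pdx' (c : Spt → ℝ) (ν : Fin 4) {g : Spt × Spt → ℂ} (hg : IsTest g) (k : Fin 4) :
    strDelta c ν (pdx' k g) = -strDelta c ν (pdx k g) := by
  rw [strDelta_eq, strDelta_eq, diffInt_pdx' hg, ← integral_neg]
  congr 1; ext e
  simp only [Pi.neg_apply, integral_neg, mul_neg]

/-- On the diagonal, shifting x' by -se is shifting the difference x - x' by +se; this is why the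
string direction becomes -id. -/
theorem delta_strX' {c : Spt → ℝ} (hc : ContDiff ℝ ∞ c) (hcs : HasCompactSupport c) (ν : Fin 4)
    {g : Spt × Spt → ℂ} (hg : IsTest g) {R : ℝ} (hR : 0 ≤ R) : delta (strX' c ν R g) =
      strG (wt c ν) 0 R (-ContinuousLinearMap.id ℝ Spt) (diffInt g) 0 := by
  have hu := (contDiff_wt hc ν).continuous
  have hus := hasCompactSupport_wt hcs ν
  have := isFiniteMeasure_strMeas hus R
  rw [strX'_eq, strG_eq hu hus 0 hR _ hg.diffInt.1.continuous, delta]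
  simp_rw [strG_eq hu hus 0 hR _ hg.1.continuous]
  rw [integral_integral_swap]
  · congr 1; ext q
    rw [integral_const_mul, integral_const_mul, diffInt]
    congr 2
    refine (integral_add_right_eq_self _ (q.2 • q.1)).symm.trans ?_
    congr 1; ext x
    congr 1
    ext <;> simp
  · have hcont : Continuous (Function.uncurry fun (x : Spt) (q : Spt × ℝ) =>
        wt c ν q.1 * ((q.2 : ℂ) ^ 0 * g ((x, x) - q.2 • ContinuousLinearMap.inr ℝ Spt Spt q.1))) := by
      have h1 : Continuous fun z : Spt × (Spt × ℝ) => wt c ν z.2.1 := hu.comp (by fun_prop)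
      have h2 : Continuous fun z : Spt × (Spt × ℝ) => g ((z.1, z.1) - z.2.2 • ContinuousLinearMap.inr ℝ Spt Spt z.2.1) :=
        hg.1.continuous.comp (by fun_prop)
      simp only [Function.uncurry_def, pow_zero, one_mul]
      exact h1.mul h2
    have hK : IsCompact ((Prod.fst '' tsupport g) ×ˢ (tsupport (wt c ν) ×ˢ Set.Icc 0 R)) :=
      (hg.2.isCompact.image continuous_fst).prod (hus.isCompact.prod isCompact_Icc)
    obtain ⟨C, hC⟩ := hK.exists_bound_of_continuousOn hcont.continuousOn
    have hfm := isFiniteMeasure_volume_restrict (hg.2.isCompact.image continuous_fst)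
    have hi : Integrable (fun z : Spt × (Spt × ℝ) => (Prod.fst '' tsupport g).indicator (fun _ => C) z.1 * 1)
        ((volume : Measure Spt).prod (strMeas (wt c ν) R)) :=
      Integrable.mul_prod (f := (Prod.fst '' tsupport g).indicator (fun _ => C)) (g := fun _ => (1 : ℝ))
        ((integrable_indicator_iff (hg.2.isCompact.image continuous_fst).measurableSet).2
          (integrableOn_const ((hg.2.isCompact.image continuous_fst).measure_lt_top.ne)))
        (integrable_const _)
    refine hi.mono' hcont.aestronglyMeasurable ?_
    have hae : ∀ᵐ z ∂((volume : Measure Spt).prod (strMeas (wt c ν) R)),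
        z.2 ∈ tsupport (wt c ν) ×ˢ Set.Icc 0 R :=
      Measure.quasiMeasurePreserving_snd.ae (strMeas_ae R)
    filter_upwards [hae] with z hz
    rw [mul_one]
    by_cases hx : z.1 ∈ Prod.fst '' tsupport g
    · rw [Set.indicator_of_mem hx]
      exact hC z ⟨hx, hz⟩
    · rw [Set.indicator_of_notMem hx]
      have : g ((z.1, z.1) - z.2.2 • ContinuousLinearMap.inr ℝ Spt Spt z.2.1) = 0 := by
        by_contra h0
        exact hx ⟨_, subset_tsupport _ h0, by simp⟩
      simp only [Function.uncurry_def]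
      rw [this]; simp

theorem tendsto_delta_strX' {c : Spt → ℝ} (hc : ContDiff ℝ ∞ c) (hcs : HasCompactSupport c)
    (ν : Fin 4) {g : Spt × Spt → ℂ} (hg : IsTest g) :
    Tendsto (fun R => delta (strX' c ν R g)) atTop (𝓝 (strDelta' c ν g)) := by
  obtain ⟨S, hS, h⟩ := strDelta'_eq_strG c ν hg
  refine tendsto_const_nhds.congr' ?_
  filter_upwards [eventually_ge_atTop S] with R hR
  rw [h R hR, delta_strX' hc hcs ν hg (hS.trans hR)]

/-- The derivative acts on `x` while the string runs in `x'`, which costs a sign for functions of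
the difference. The derivative along the string then integrates to its two ends: the near end gives
`delta` by the unit weight of `c`, and the far end leaves the support. -/
theorem tendsto_delta_sum_pdx_strX' {c : Spt → ℝ} (hc : ContDiff ℝ ∞ c) (hcs : HasCompactSupport c)
    (hw : ∫ e, c e ∂sigma = 1) {g : Spt × Spt → ℂ} (hg : IsTest g) :
    Tendsto (fun R => ∑ l, delta (pdx l (strX' c l R g))) atTop (𝓝 (-delta g)) := by
  obtain ⟨S, hS, h⟩ := hg.diffInt.eq_zero_of_string
  refine tendsto_const_nhds.congr' ?_
  filter_upwards [eventually_gt_atTop S] with R hR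
  have hR0 : 0 ≤ R := hS.trans hR.le
  have h1 : ∀ l, delta (pdx l (strX' c l R g)) = -strG (wt c l) 0 R (-ContinuousLinearMap.id ℝ Spt)
      (fun z => fderiv ℝ (diffInt g) z ((-ContinuousLinearMap.id ℝ Spt) (Pi.single l 1))) 0 := by
    intro l
    rw [pdx_strX' hc hcs hg l l hR0, delta_strX' hc hcs l (hg.pdx l) hR0, ← pd_diffInt hg]
    simp only [strG, pd, ← integral_neg]
    congr 1; ext e
    rw [← mul_neg, ← intervalIntegral.integral_neg]
    simp
  simp_rw [h1]
  rw [Finset.sum_neg_distrib, sum_strG_fderiv hc hcs R _ hg.diffInt.1, delta_eq]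
  congr 1
  have h2 : ∫ e, (c e : ℂ) * (diffInt g 0 - diffInt g (0 - R • (-ContinuousLinearMap.id ℝ Spt) e))
      ∂sigma = ∫ e, (c e : ℂ) * diffInt g 0 ∂sigma := by
    refine integral_congr_ae ?_
    filter_upwards [sigma_ae] with e he
    have : diffInt g (0 - R • (-ContinuousLinearMap.id ℝ Spt) e) = 0 := by
      simpa using h e he R (hR.trans_le (le_abs_self R))
    rw [this, sub_zero]
  rw [h2, integral_mul_const, integral_complex_ofReal, hw]; simp

/-! ### The kinematic propagator -/

theorem TFFkin_eq (μ ν k l : Fin 4) (g : Spt × Spt → ℂ) : TFFkin μ ν k l g =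
    -(eta ν k * T0K (pdx l (pdx μ g)) - eta μ k * T0K (pdx l (pdx ν g))
      - eta ν l * T0K (pdx k (pdx μ g)) + eta μ l * T0K (pdx k (pdx ν g))) := by
  simp [TFFkin, Kern.dx]

theorem TFFkin_add (μ ν k l : Fin 4) {g h : Spt × Spt → ℂ} (hg : IsTest g) (hh : IsTest h) :
    TFFkin μ ν k l (g + h) = TFFkin μ ν k l g + TFFkin μ ν k l h := by
  have h1 : ∀ a b, T0K (pdx a (pdx b (g + h))) = T0K (pdx a (pdx b g)) + T0K (pdx a (pdx b h)) :=
    fun a b => by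
      rw [pdx_add hg hh, pdx_add (hg.pdx b) (hh.pdx b), T0K_add ((hg.pdx b).pdx a) ((hh.pdx b).pdx a)]
  simp only [TFFkin_eq, h1]; ring

theorem TFFkin_smul (μ ν k l : Fin 4) {g : Spt × Spt → ℂ} (hg : IsTest g) (z : ℂ) :
    TFFkin μ ν k l (z • g) = z * TFFkin μ ν k l g := by
  have h1 : ∀ a b, T0K (pdx a (pdx b (z • g))) = z * T0K (pdx a (pdx b g)) :=
    fun a b => by rw [pdx_smul, pdx_smul, T0K_smul ((hg.pdx b).pdx a)]
  simp only [TFFkin_eq, h1]; ring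

theorem TFFkin_sum (μ ν k l : Fin 4) {g : Fin 4 → Spt × Spt → ℂ} (hg : ∀ i, IsTest (g i)) :
    TFFkin μ ν k l (∑ i, g i) = ∑ i, TFFkin μ ν k l (g i) := by
  simp only [Fin.sum_univ_four]
  rw [TFFkin_add _ _ _ _ (((hg 0).add (hg 1)).add (hg 2)) (hg 3),
    TFFkin_add _ _ _ _ ((hg 0).add (hg 1)) (hg 2), TFFkin_add _ _ _ _ (hg 0) (hg 1)]

theorem sgn_mul_self (μ : Fin 4) : sgn μ * sgn μ = 1 := by
  unfold sgn; split_ifs <;> norm_num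

theorem sum_sgn_eta (k : Fin 4) (X : Fin 4 → ℂ) : ∑ μ, sgn μ * (eta μ k * X μ) = X k := by
  rw [Finset.sum_eq_single k]
  · rw [eta, if_pos rfl, ← mul_assoc, sgn_mul_self, one_mul]
  · intro μ _ h; rw [eta, if_neg h]; ring
  · simp

/-- The Maxwell equation holds up to a contact term. -/
theorem TFFkin_maxwell (ν k l : Fin 4) {g : Spt × Spt → ℂ} (hg : IsTest g) :
    ∑ μ, sgn μ * TFFkin μ ν k l (pdx μ g) =
      Complex.I * (eta ν k * delta (pdx l g) - eta ν l * delta (pdx k g)) := by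
  have h1 : ∀ a, ∑ μ, sgn μ * T0K (pdx a (pdx μ (pdx μ g))) = -Complex.I * delta (pdx a g) := by
    intro a
    rw [← T0K_box (hg.pdx a)]
    refine Finset.sum_congr rfl fun μ _ => ?_
    rw [pdx_comm (hg.pdx μ) a μ, pdx_comm hg a μ]
  have h2 : ∀ a b, ∑ μ, sgn μ * (eta μ a * T0K (pdx b (pdx ν (pdx μ g)))) =
      T0K (pdx b (pdx ν (pdx a g))) := fun a b =>
    sum_sgn_eta a fun μ => T0K (pdx b (pdx ν (pdx μ g)))
  have h3 : T0K (pdx l (pdx ν (pdx k g))) = T0K (pdx k (pdx ν (pdx l g))) := by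
    rw [pdx_comm hg ν k, pdx_comm (hg.pdx ν) l k, pdx_comm hg ν l]
  calc ∑ μ, sgn μ * TFFkin μ ν k l (pdx μ g)
      = -(eta ν k * ∑ μ, sgn μ * T0K (pdx l (pdx μ (pdx μ g)))
        - ∑ μ, sgn μ * (eta μ k * T0K (pdx l (pdx ν (pdx μ g))))
        - eta ν l * ∑ μ, sgn μ * T0K (pdx k (pdx μ (pdx μ g)))
        + ∑ μ, sgn μ * (eta μ l * T0K (pdx k (pdx ν (pdx μ g))))) := by
        simp only [TFFkin_eq, Fin.sum_univ_four]; ring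
    _ = _ := by rw [h1, h1, h2, h2, h3]; ring

theorem TFFkin_bianchi (μ ν ρ k l : Fin 4) {g : Spt × Spt → ℂ} (hg : IsTest g) :
    TFFkin ν ρ k l (pdx μ g) - TFFkin μ ρ k l (pdx ν g) = -TFFkin μ ν k l (pdx ρ g) := by
  simp only [TFFkin_eq]
  rw [pdx_comm hg ρ μ, pdx_comm hg ν μ, pdx_comm hg ρ ν]
  ring

/-- The divergence of a finite string is its starting point minus an average over the far end
points, and the latter is negligible because `T₀` decays in spacelike directions. This is the place
where the decay is needed. -/
theorem tendsto_TFFkin_avgX {c : Spt → ℝ} (hc : ContDiff ℝ ∞ c) (hcs : HasCompactSupport c)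
    (hw : ∫ e, c e ∂sigma = 1) (μ ν k l : Fin 4) {g : Spt × Spt → ℂ} (hg : IsTest g) :
    Tendsto (fun R => ∑ r, TFFkin μ ν k l (pdx r (strX c r R g))) atTop
      (𝓝 (TFFkin μ ν k l g)) := by
  -- The average over end points is a difference of a test function and derivatives of finite
  -- strings. That it is a test function, and that it commutes with derivatives, is read off from
  -- this.
  have hav : ∀ {R : ℝ}, 0 ≤ R → ∀ {h : Spt × Spt → ℂ}, IsTest h → IsTest (avgX c R h) := by
    intro R hR h hh
    have h1 := sum_pdx_strX hc hcs hw hh hR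
    have h2 : avgX c R h = h + (-1 : ℂ) • ∑ l, pdx l (strX c l R h) := by
      rw [h1]; ext z; simp
    rw [h2]
    exact hh.add ((IsTest.sum fun l _ => (IsTest.strX hc hcs hh l hR).pdx l).smul _)
  have hpav : ∀ {R : ℝ}, 0 ≤ R → ∀ {h : Spt × Spt → ℂ}, IsTest h → ∀ a,
      pdx a (avgX c R h) = avgX c R (pdx a h) := by
    intro R hR h hh a
    have h1 := sum_pdx_strX hc hcs hw hh hR
    have h2 : avgX c R h = h + (-1 : ℂ) • ∑ l, pdx l (strX c l R h) := by
      rw [h1]; ext z; simp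
    have h3 := sum_pdx_strX hc hcs hw (hh.pdx a) hR
    have h4 : avgX c R (pdx a h) = pdx a h + (-1 : ℂ) • ∑ l, pdx l (strX c l R (pdx a h)) := by
      rw [h3]; ext z; simp
    have ht := fun l => (IsTest.strX hc hcs hh l hR).pdx l
    rw [h2, h4, pdx_add hh ((IsTest.sum fun l _ => ht l).smul _), pdx_smul]
    congr 2
    simp only [Fin.sum_univ_four]
    rw [pdx_add (((ht 0).add (ht 1)).add (ht 2)) (ht 3), pdx_add ((ht 0).add (ht 1)) (ht 2),
      pdx_add (ht 0) (ht 1)]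
    simp only [pdx_comm (IsTest.strX hc hcs hh _ hR) a, pdx_strX hc hcs hh _ a hR]
  have h0 : Tendsto (fun R => TFFkin μ ν k l (avgX c R g)) atTop (𝓝 0) := by
    have t := fun a b => tendsto_T0K_avgX hc hcs ((hg.pdx b).pdx a)
    have := ((((t l μ).const_mul (eta ν k)).sub ((t l ν).const_mul (eta μ k))).sub
      ((t k μ).const_mul (eta ν l))).add ((t k ν).const_mul (eta μ l)) |>.neg
    simp only [mul_zero, sub_zero, add_zero, neg_zero] at this
    refine this.congr' ?_
    filter_upwards [eventually_ge_atTop 0] with R hR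
    rw [TFFkin_eq]
    simp only [hpav hR hg, hpav hR (hg.pdx _)]
  have h1 := (tendsto_const_nhds (x := TFFkin μ ν k l g)).add (h0.const_mul (-1))
  rw [mul_zero, add_zero] at h1
  refine h1.congr' ?_
  filter_upwards [eventually_ge_atTop 0] with R hR
  rw [← TFFkin_sum _ _ _ _ fun i => (IsTest.strX hc hcs hg i hR).pdx i,
    sum_pdx_strX hc hcs hw hg hR, TFFkin_add _ _ _ _ hg ((hav hR hg).smul _),
    TFFkin_smul _ _ _ _ (hav hR hg)]

/-! ### Contracted two-point obstructions -/

section TwoPoint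

variable {ι κ : Type*} [Fintype ι] [DecidableEq ι] [Fintype κ] [DecidableEq κ]
  {G : DiracMatrices} {Sm : Smearing} {cF : ℂ} (τ : TimeOrdering (ι := ι) (κ := κ) G Sm cF)

theorem twoPoint_eq (μ : Fin 4) (φ χ : LinField ι κ) (g : Spt × Spt → ℂ) :
    twoPoint τ μ φ χ g = τ.dT μ φ χ g + τ.T φ χ (pdx μ g) := by
  simp [twoPoint, Kern.dx]

theorem twoPoint_isLinear (μ : Fin 4) (φ χ : LinField ι κ) : (twoPoint τ μ φ χ).IsLinear := by
  constructor
  · intro g h hg hh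
    rw [twoPoint_eq, twoPoint_eq, twoPoint_eq, pdx_add hg hh, (τ.dT_linear μ φ χ).1 g h hg hh,
      (τ.T_linear φ χ).1 _ _ (hg.pdx μ) (hh.pdx μ)]
    ring
  · intro z g hg
    rw [twoPoint_eq, twoPoint_eq, pdx_smul, (τ.dT_linear μ φ χ).2 z g hg,
      (τ.T_linear φ χ).2 _ _ (hg.pdx μ)]
    ring

theorem twoPoint_w (μ : Fin 4) (a : ι) (χ : LinField ι κ) {g : Spt × Spt → ℂ} (hg : IsTest g) :
    twoPoint τ μ (.inl (.w a)) χ g = 0 := by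
  rw [twoPoint, τ.kin_w μ a χ g hg, sub_self]

/-- The Maxwell equation under the time-ordering removes the unspecified propagator of ∂F from this
contraction. -/
theorem sum_twoPoint_F (ν : Fin 4) (a : ι) (χ : LinField ι κ) {g : Spt × Spt → ℂ} (hg : IsTest g) :
    ∑ μ, sgn μ * twoPoint τ μ (.inl (.F μ ν a)) χ g =
      ∑ μ, sgn μ * τ.T (.inl (.F μ ν a)) χ (pdx μ g) := by
  simp_rw [twoPoint_eq, mul_add]
  rw [Finset.sum_add_distrib, τ.eom_F ν a χ g hg, zero_add]

/-- The kinematic propagator violates the Maxwell equation by a derivative of δ, and the divergence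
of the renormalization term has the same tensor structure; hence the factor 1 + c_F. -/
theorem sum_twoPoint_F_F (ν : Fin 4) (a : ι) (k l : Fin 4) (b : ι) {g : Spt × Spt → ℂ}
    (hg : IsTest g) : ∑ μ, sgn μ * twoPoint τ μ (.inl (.F μ ν a)) (.inl (.F k l b)) g =
      if a = b then Complex.I * (1 + cF) * (eta ν k * delta (pdx l g) - eta ν l * delta (pdx k g))
      else 0 := by
  rw [sum_twoPoint_F τ ν a _ hg]
  simp_rw [τ.T_F_F _ _ _ _ _ _ _ (hg.pdx _)]
  split_ifs with hab
  · simp only [TFFren]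
    have h1 := TFFkin_maxwell ν k l hg
    have h2 := sum_sgn_eta k fun μ => cF * eta l ν * (Complex.I * delta (pdx μ g))
    have h3 := sum_sgn_eta l fun μ => cF * eta k ν * (Complex.I * delta (pdx μ g))
    have e : ∀ i j, eta i j = eta j i := fun i j => by
      unfold eta; split_ifs with h h' h'
      · rw [h]
      · exact absurd h.symm h'
      · exact absurd h'.symm h
      · rfl
    calc _ = ∑ μ, sgn μ * TFFkin μ ν k l (pdx μ g)
          - ∑ μ, sgn μ * (eta μ k * (cF * eta l ν * (Complex.I * delta (pdx μ g))))
          + ∑ μ, sgn μ * (eta μ l * (cF * eta k ν * (Complex.I * delta (pdx μ g)))) := by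
          rw [← Finset.sum_sub_distrib, ← Finset.sum_add_distrib]
          exact Finset.sum_congr rfl fun μ _ => by ring
      _ = _ := by rw [h1, h2, h3, e l ν, e k ν]; ring
  · simp

/-- The contact term of ⟨T F F'⟩ is integrated along the string in `x'`. Its part with a derivative
along the string collapses to δ, the other part keeps the string. No c_F appears, since propagators
of `A` are built from the kinematic one. -/
theorem sum_twoPoint_F_A (ν : Fin 4) (a : ι) (k : Fin 4) (b : ι) {g : Spt × Spt → ℂ}
    (hg : IsTest g) : ∑ μ, sgn μ * twoPoint τ μ (.inl (.F μ ν a)) (.inl (.A k b)) g =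
      if a = b then -Complex.I * (eta ν k * delta g
        + ∑ l, eta ν l * strDelta' Sm.c l (pdx k g)) else 0 := by
  rw [sum_twoPoint_F τ ν a _ hg]
  have h1 : Tendsto (fun R => ∑ μ, sgn μ * (if a = b then
      ∑ l, TFFkin μ ν k l (strX' Sm.c l R (pdx μ g)) else 0)) atTop
      (𝓝 (∑ μ, sgn μ * τ.T (.inl (.F μ ν a)) (.inl (.A k b)) (pdx μ g))) :=
    tendsto_finsetSum _ fun μ _ => ((τ.T_F_A μ ν a k b) _ (hg.pdx μ)).const_mul (sgn μ)
  refine tendsto_nhds_unique h1 ?_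
  split_ifs with hab
  · have d1 := tendsto_delta_sum_pdx_strX' Sm.c_smooth Sm.c_supp Sm.c_weight hg
    have d2 := tendsto_finsetSum (Finset.univ : Finset (Fin 4)) fun l _ =>
      (tendsto_delta_strX' Sm.c_smooth Sm.c_supp l (hg.pdx k)).const_mul (eta ν l)
    have := ((d1.const_mul (eta ν k)).sub d2).const_mul Complex.I
    rw [show -Complex.I * (eta ν k * delta g + ∑ l, eta ν l * strDelta' Sm.c l (pdx k g)) =
      Complex.I * (eta ν k * -delta g - ∑ l, eta ν l * strDelta' Sm.c l (pdx k g)) by ring]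
    refine this.congr' ?_
    filter_upwards [eventually_ge_atTop 0] with R hR
    have e1 : ∀ l, ∑ μ, sgn μ * TFFkin μ ν k l (strX' Sm.c l R (pdx μ g)) =
        Complex.I * (eta ν k * delta (pdx l (strX' Sm.c l R g))
          - eta ν l * delta (strX' Sm.c l R (pdx k g))) := by
      intro l
      rw [← pdx_strX' Sm.c_smooth Sm.c_supp hg l k hR,
        ← TFFkin_maxwell ν k l (IsTest.strX' Sm.c_smooth Sm.c_supp hg l hR)]
      exact Finset.sum_congr rfl fun μ _ => by rw [pdx_strX' Sm.c_smooth Sm.c_supp hg l μ hR]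
    simp_rw [Finset.mul_sum]
    rw [Finset.sum_comm, Finset.sum_congr rfl fun l _ => e1 l]
    simp only [← Finset.mul_sum, Finset.sum_sub_distrib]
  · simp

theorem twoPoint_A_curl (μ ν : Fin 4) (a : ι) (χ : LinField ι κ) {g : Spt × Spt → ℂ}
    (hg : IsTest g) : twoPoint τ μ (.inl (.A ν a)) χ g - twoPoint τ ν (.inl (.A μ a)) χ g =
      τ.T (.inl (.F μ ν a)) χ g + (τ.T (.inl (.A ν a)) χ (pdx μ g)
        - τ.T (.inl (.A μ a)) χ (pdx ν g)) := by
  rw [twoPoint_eq, twoPoint_eq, ← τ.eom_A μ ν a χ g hg]; ring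

/-- By the Bianchi identity the curl of the string integrand is a derivative in the direction of the
string, which integrates to the kinematic propagator at its starting point. -/
theorem T_A_F_curl (μ ν : Fin 4) (a : ι) (k l : Fin 4) (b : ι) {g : Spt × Spt → ℂ}
    (hg : IsTest g) : τ.T (.inl (.A ν a)) (.inl (.F k l b)) (pdx μ g)
        - τ.T (.inl (.A μ a)) (.inl (.F k l b)) (pdx ν g) =
      if a = b then -TFFkin μ ν k l g else 0 := by
  have h1 := (τ.T_A_F ν a k l b _ (hg.pdx μ)).sub (τ.T_A_F μ a k l b _ (hg.pdx ν))
  refine tendsto_nhds_unique h1 ?_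
  split_ifs with hab
  · refine (tendsto_TFFkin_avgX Sm.c_smooth Sm.c_supp Sm.c_weight μ ν k l hg).neg.congr' ?_
    filter_upwards [eventually_ge_atTop 0] with R hR
    rw [← Finset.sum_sub_distrib, ← Finset.sum_neg_distrib]
    refine Finset.sum_congr rfl fun r _ => ?_
    rw [← TFFkin_bianchi μ ν r k l (IsTest.strX Sm.c_smooth Sm.c_supp hg r hR),
      pdx_strX Sm.c_smooth Sm.c_supp hg r μ hR, pdx_strX Sm.c_smooth Sm.c_supp hg r ν hR]
  · simp

/-- The free equation relates the curl of `A` to the renormalized propagator, whereas the string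
integral has the kinematic one as its curl. Only their difference, the c_F term, survives. -/
theorem twoPoint_A_curl_F (μ ν : Fin 4) (a : ι) (k l : Fin 4) (b : ι) {g : Spt × Spt → ℂ}
    (hg : IsTest g) : twoPoint τ μ (.inl (.A ν a)) (.inl (.F k l b)) g
        - twoPoint τ ν (.inl (.A μ a)) (.inl (.F k l b)) g =
      if a = b then -cF * (eta μ k * eta l ν - eta μ l * eta k ν) * (Complex.I * delta g)
      else 0 := by
  rw [twoPoint_A_curl τ μ ν a _ hg, T_A_F_curl τ μ ν a k l b hg, τ.T_F_F _ _ _ _ _ _ _ hg]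
  split_ifs with hab
  · rw [TFFren]; ring
  · simp

/-- With `A` at the second point both sides of the curl equation are strings over the kinematic
propagator, so no renormalization term is left over. -/
theorem twoPoint_A_curl_A (μ ν : Fin 4) (a : ι) (k : Fin 4) (b : ι) {g : Spt × Spt → ℂ}
    (hg : IsTest g) : twoPoint τ μ (.inl (.A ν a)) (.inl (.A k b)) g
        - twoPoint τ ν (.inl (.A μ a)) (.inl (.A k b)) g = 0 := by
  rw [twoPoint_A_curl τ μ ν a _ hg]
  have h1 := (τ.T_F_A μ ν a k b _ hg).add
    ((τ.T_A_A ν a k b _ (hg.pdx μ)).sub (τ.T_A_A μ a k b _ (hg.pdx ν)))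
  refine tendsto_nhds_unique h1 (tendsto_const_nhds.congr' ?_)
  filter_upwards [eventually_ge_atTop 0] with R hR
  rw [← Finset.sum_sub_distrib]
  have e1 : ∀ l, τ.T (.inl (.A ν a)) (.inl (.F k l b)) (strX' Sm.c l R (pdx μ g))
      - τ.T (.inl (.A μ a)) (.inl (.F k l b)) (strX' Sm.c l R (pdx ν g)) =
      if a = b then -TFFkin μ ν k l (strX' Sm.c l R g) else 0 := by
    intro l
    rw [← T_A_F_curl τ μ ν a k l b (IsTest.strX' Sm.c_smooth Sm.c_supp hg l hR),
      pdx_strX' Sm.c_smooth Sm.c_supp hg l μ hR, pdx_strX' Sm.c_smooth Sm.c_supp hg l ν hR]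
  rw [Finset.sum_congr rfl fun l _ => e1 l]
  split_ifs with hab
  · rw [Finset.sum_neg_distrib, add_neg_cancel]
  · simp

theorem twoPoint_A_curl_quark (μ ν : Fin 4) (a : ι) (χ : Quark κ) {g : Spt × Spt → ℂ}
    (hg : IsTest g) : twoPoint τ μ (.inl (.A ν a)) (.inr χ) g
        - twoPoint τ ν (.inl (.A μ a)) (.inr χ) g = 0 := by
  rw [twoPoint_A_curl τ μ ν a _ hg, τ.T_gluon_quark _ _ _ hg, τ.T_gluon_quark _ _ _ (hg.pdx μ),
    τ.T_gluon_quark _ _ _ (hg.pdx ν)]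
  simp

theorem sum_twoPoint_F_quark (ν : Fin 4) (a : ι) (χ : Quark κ) {g : Spt × Spt → ℂ}
    (hg : IsTest g) : ∑ μ, sgn μ * twoPoint τ μ (.inl (.F μ ν a)) (.inr χ) g = 0 := by
  rw [sum_twoPoint_F τ ν a _ hg]
  simp [τ.T_gluon_quark _ _ _ (hg.pdx _)]

theorem sum_twoPoint_psi (α : Fin 4) (m : κ) (χ : LinField ι κ) {g : Spt × Spt → ℂ}
    (hg : IsTest g) : ∑ μ, ∑ β, G.γ μ α β * twoPoint τ μ (.inr (.psi β m)) χ g =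
      ∑ μ, ∑ β, G.γ μ α β * τ.T (.inr (.psi β m)) χ (pdx μ g) := by
  simp_rw [twoPoint_eq, mul_add, Finset.sum_add_distrib]
  rw [τ.eom_psi α m χ g hg, zero_add]

theorem sum_twoPoint_bar (β : Fin 4) (m : κ) (χ : LinField ι κ) {g : Spt × Spt → ℂ}
    (hg : IsTest g) : ∑ μ, ∑ α, G.γ μ α β * twoPoint τ μ (.inr (.bar α m)) χ g =
      ∑ μ, ∑ α, G.γ μ α β * τ.T (.inr (.bar α m)) χ (pdx μ g) := by
  simp_rw [twoPoint_eq, mul_add, Finset.sum_add_distrib]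
  have := τ.eom_bar β m χ g hg
  simp_rw [mul_comm _ (G.γ _ _ _)] at this
  rw [this, zero_add]

/-- The square of the Dirac operator is the wave operator. -/
theorem sum_gamma_T0K (G : DiracMatrices) (α β : Fin 4) {g : Spt × Spt → ℂ} (hg : IsTest g) :
    ∑ μ, ∑ ν, (G.γ μ * G.γ ν) α β * T0K (pdx ν (pdx μ g)) =
      if α = β then -Complex.I * delta g else 0 := by
  have h1 : ∑ μ, ∑ ν, (G.γ μ * G.γ ν) α β * T0K (pdx ν (pdx μ g)) =
      ∑ μ, ∑ ν, (G.γ ν * G.γ μ) α β * T0K (pdx ν (pdx μ g)) := by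
    rw [Finset.sum_comm]
    exact Finset.sum_congr rfl fun μ _ => Finset.sum_congr rfl fun ν _ => by rw [pdx_comm hg]
  have h2 : ∑ μ, ∑ ν, (G.γ μ * G.γ ν) α β * T0K (pdx ν (pdx μ g)) +
      ∑ μ, ∑ ν, (G.γ ν * G.γ μ) α β * T0K (pdx ν (pdx μ g)) =
      2 * ((1 : Matrix (Fin 4) (Fin 4) ℂ) α β * ∑ μ, sgn μ * T0K (pdx μ (pdx μ g))) := by
    simp_rw [← Finset.sum_add_distrib, Finset.mul_sum]
    refine Finset.sum_congr rfl fun μ _ => ?_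
    rw [Finset.sum_eq_single μ]
    · rw [← add_mul, ← Matrix.add_apply, G.clifford, Matrix.smul_apply, eta, if_pos rfl, smul_eq_mul]
      ring
    · intro ν _ h
      rw [← add_mul, ← Matrix.add_apply, G.clifford, Matrix.smul_apply, eta, if_neg (Ne.symm h)]
      simp
    · simp
  rw [← h1, ← two_mul, T0K_box hg] at h2
  rw [mul_left_cancel₀ two_ne_zero h2, Matrix.one_apply]
  split_ifs <;> simp

theorem sum_twoPoint_psi_bar (α : Fin 4) (m : κ) (β : Fin 4) (n : κ) {g : Spt × Spt → ℂ}
    (hg : IsTest g) :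
    ∑ μ, ∑ ρ, G.γ μ α ρ * twoPoint τ μ (.inr (.psi ρ m)) (.inr (.bar β n)) g =
      if α = β ∧ m = n then -delta g else 0 := by
  rw [sum_twoPoint_psi τ α m _ hg]
  simp_rw [τ.T_psi_bar _ _ _ _ _ (hg.pdx _)]
  by_cases hmn : m = n
  · simp only [hmn, if_true, and_true]
    have h1 := sum_gamma_T0K G α β hg
    have h2 : ∑ μ, ∑ ρ, G.γ μ α ρ * ∑ ν, Complex.I * G.γ ν ρ β * T0K.dx ν (pdx μ g) =
        -Complex.I * ∑ μ, ∑ ν, (G.γ μ * G.γ ν) α β * T0K (pdx ν (pdx μ g)) := by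
      simp_rw [Matrix.mul_apply, Finset.sum_mul, Finset.mul_sum]
      refine Finset.sum_congr rfl fun μ _ => ?_
      rw [Finset.sum_comm]
      refine Finset.sum_congr rfl fun ν _ => Finset.sum_congr rfl fun ρ _ => ?_
      rw [Kern.dx]; ring
    rw [h2, h1]
    split_ifs
    · linear_combination delta g * Complex.I_sq
    · simp
  · simp [hmn]

theorem sum_twoPoint_bar_psi (β : Fin 4) (m : κ) (α : Fin 4) (n : κ) {g : Spt × Spt → ℂ}
    (hg : IsTest g) :
    ∑ μ, ∑ ρ, G.γ μ ρ β * twoPoint τ μ (.inr (.bar ρ m)) (.inr (.psi α n)) g =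
      if α = β ∧ m = n then -delta g else 0 := by
  rw [sum_twoPoint_bar τ β m _ hg]
  simp_rw [τ.T_bar_psi _ _ _ _ _ (hg.pdx _)]
  by_cases hmn : m = n
  · simp only [hmn, if_true, and_true]
    have h1 := sum_gamma_T0K G α β hg
    have h2 : ∑ μ, ∑ ρ, G.γ μ ρ β * ∑ ν, Complex.I * G.γ ν α ρ * T0K.dx ν (pdx μ g) =
        -Complex.I * ∑ μ, ∑ ν, (G.γ μ * G.γ ν) α β * T0K (pdx ν (pdx μ g)) := by
      rw [Finset.sum_comm (f := fun μ ν => (G.γ μ * G.γ ν) α β * T0K (pdx ν (pdx μ g)))]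
      simp_rw [Matrix.mul_apply, Finset.sum_mul, Finset.mul_sum]
      refine Finset.sum_congr rfl fun μ _ => ?_
      rw [Finset.sum_comm]
      refine Finset.sum_congr rfl fun ν _ => Finset.sum_congr rfl fun ρ _ => ?_
      rw [Kern.dx, pdx_comm hg μ ν]; ring
    rw [h2, h1]
    split_ifs
    · linear_combination delta g * Complex.I_sq
    · simp
  · simp [hmn]

theorem sum_twoPoint_psi_zero (α : Fin 4) (m : κ) (χ : LinField ι κ)
    (hχ : ∀ β n, χ ≠ .inr (.bar β n)) {g : Spt × Spt → ℂ} (hg : IsTest g) :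
    ∑ μ, ∑ ρ, G.γ μ α ρ * twoPoint τ μ (.inr (.psi ρ m)) χ g = 0 := by
  rw [sum_twoPoint_psi τ α m _ hg]
  rcases χ with χ | ⟨β, n⟩ | ⟨β, n⟩
  · simp [τ.T_quark_gluon _ _ _ (hg.pdx _)]
  · simp [τ.T_psi_psi _ _ _ _ _ (hg.pdx _)]
  · exact absurd rfl (hχ β n)

theorem sum_twoPoint_bar_zero (β : Fin 4) (m : κ) (χ : LinField ι κ)
    (hχ : ∀ α n, χ ≠ .inr (.psi α n)) {g : Spt × Spt → ℂ} (hg : IsTest g) :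
    ∑ μ, ∑ ρ, G.γ μ ρ β * twoPoint τ μ (.inr (.bar ρ m)) χ g = 0 := by
  rw [sum_twoPoint_bar τ β m _ hg]
  rcases χ with χ | ⟨α, n⟩ | ⟨α, n⟩
  · simp [τ.T_quark_gluon _ _ _ (hg.pdx _)]
  · exact absurd rfl (hχ α n)
  · simp [τ.T_bar_bar _ _ _ _ _ (hg.pdx _)]

end TwoPoint

/-! ### String integrals of classical fields -/

/-- Spacelike compact support. -/
def SpacelikeSupport (Φ : Spt → ℂ) : Prop := ∃ R : ℝ, ∀ x : Spt, |x 0| + R < ‖spv x‖ → Φ x = 0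

theorem SpacelikeSupport.fderiv {Φ : Spt → ℂ} (h : SpacelikeSupport Φ) (v : Spt) :
    SpacelikeSupport fun x => fderiv ℝ Φ x v := by
  obtain ⟨R, hR⟩ := h
  refine ⟨R, fun x hx => ?_⟩
  have ho : IsOpen {x : Spt | |x 0| + R < ‖spv x‖} :=
    isOpen_lt (by fun_prop) continuous_spv.norm
  have : Φ =ᶠ[𝓝 x] fun _ => 0 := by
    filter_upwards [ho.mem_nhds hx] with y hy using hR y hy
  change _root_.fderiv ℝ Φ x v = 0
  rw [this.fderiv_eq]; simp

theorem norm_spv_le (x : Spt) : ‖spv x‖ ≤ 2 * ‖x‖ := by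
  refine abs_le_of_sq_le_sq' ?_ (by positivity) |>.2
  have h := fun i => norm_le_pi_norm x i
  simp only [Real.norm_eq_abs] at h
  have h' := fun i => sq_le_sq' (abs_le.1 (h i)).1 (abs_le.1 (h i)).2
  rw [norm_spv_sq]
  nlinarith [h' 1, h' 2, h' 3, sq_nonneg ‖x‖]

/-- Along the string, space grows like s|e| and time like s|e⁰|, up to |x⁰| and the spatial length
of x, which together are at most 3‖x‖. -/
theorem SpacelikeSupport.eq_zero {Φ : Spt → ℂ} {R : ℝ}
    (hR : ∀ x : Spt, |x 0| + R < ‖spv x‖ → Φ x = 0) {x e : Spt} {s : ℝ} (hs : 0 ≤ s)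
    (h : 3 * ‖x‖ + R < s * (‖spv e‖ - |e 0|)) : Φ (x + s • e) = 0 := by
  refine hR _ ?_
  have h1 : spv (x + s • e) = s • spv e - -spv x := by
    ext i; fin_cases i <;> simp [spv, add_comm]
  have h2 := norm_sub_norm_le (s • spv e) (-spv x)
  rw [← h1, norm_smul, Real.norm_of_nonneg hs, norm_neg] at h2
  have h3 : |(x + s • e) 0| ≤ |x 0| + s * |e 0| := by
    simp only [Pi.add_apply, Pi.smul_apply, smul_eq_mul]
    refine (abs_add_le _ _).trans (le_of_eq ?_)
    rw [abs_mul, abs_of_nonneg hs]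
  have h4 : |x 0| ≤ ‖x‖ := norm_le_pi_norm x 0
  have h5 := norm_spv_le x
  linarith

/-- On the hyperboloid the difference of spatial length and |e⁰| is the reciprocal of their sum, and
the sum is at most 3‖e‖. -/
theorem exists_gap {K : Set Spt} (hK : IsCompact K) :
    ∃ δ > 0, ∀ e ∈ K, minkSq e = -1 → δ ≤ ‖spv e‖ - |e 0| := by
  obtain ⟨B, hB⟩ := hK.isBounded.exists_norm_le
  refine ⟨(3 * |B| + 1)⁻¹, by positivity, fun e he h => ?_⟩
  have h1 := norm_spv_sq e
  have h2 : |e 0| ≤ ‖e‖ := norm_le_pi_norm e 0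
  have h3 := norm_spv_le e
  have h4 := (hB e he).trans (le_abs_self B)
  have h5 := abs_time_lt_norm_spv (by rw [h]; norm_num : minkSq e < 0)
  unfold minkSq at h
  rw [inv_le_iff_one_le_mul₀ (by positivity)]
  have h6 : (‖spv e‖ - |e 0|) * (‖spv e‖ + |e 0|) = 1 := by
    have := sq_abs (e 0)
    nlinarith
  nlinarith [abs_nonneg (e 0)]

theorem SpacelikeSupport.exists_cutoff {Φ : Spt → ℂ} (h : SpacelikeSupport Φ) {K : Set Spt}
    (hK : IsCompact K) (r : ℝ) : ∃ S : ℝ, 0 ≤ S ∧ ∀ x, ‖x‖ ≤ r → ∀ e ∈ K, minkSq e = -1 →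
      ∀ s, S < s → Φ (x + s • e) = 0 := by
  obtain ⟨R, hR⟩ := h
  obtain ⟨δ, hδ, hd⟩ := exists_gap hK
  refine ⟨(3 * |r| + |R|) / δ, by positivity, fun x hx e he hm s hs => ?_⟩
  have hs0 : 0 ≤ s := (by positivity : 0 ≤ (3 * |r| + |R|) / δ).trans hs.le
  refine SpacelikeSupport.eq_zero hR hs0 ?_
  rw [div_lt_iff₀ hδ] at hs
  have := mul_le_mul_of_nonneg_left (hd e he hm) hs0
  linarith [le_abs_self r, le_abs_self R]

/-- `∫ dσ(e) u(e) ∫₀^∞ s^j ds Φ(x + s e)`. -/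
noncomputable def strInf (u : Spt → ℂ) (j : ℕ) (Φ : Spt → ℂ) (x : Spt) : ℂ :=
  ∫ e, u e * (∫ s in Set.Ioi (0 : ℝ), (s : ℂ) ^ j * Φ (x + s • e)) ∂sigma

theorem strInf_eq_strG {u : Spt → ℂ} (j : ℕ) {Φ : Spt → ℂ} {S R : ℝ} (hS : 0 ≤ S) (hSR : S ≤ R)
    {x : Spt} (h : ∀ e ∈ tsupport u, minkSq e = -1 → ∀ s, S < s → Φ (x + s • e) = 0) :
    strInf u j Φ x = strG u j R (-ContinuousLinearMap.id ℝ Spt) Φ x := by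
  rw [strInf, strG]
  refine integral_congr_ae ?_
  filter_upwards [sigma_ae] with e he
  by_cases hu : e ∈ tsupport u
  · rw [integral_Ioi_eq_interval hSR (hS.trans hSR) fun s hs => by rw [h e hu he s hs, mul_zero]]
    simp
  · rw [image_eq_zero_of_notMem_tsupport hu, zero_mul, zero_mul]

/-- The cutoff is uniform near `x`, so the infinite string equals a finite one on a whole
neighbourhood and shares its derivatives. -/
theorem strInf_eventuallyEq {u : Spt → ℂ} (hus : HasCompactSupport u) (j : ℕ) {Φ : Spt → ℂ}
    (hΦ : SpacelikeSupport Φ) (x : Spt) : ∃ S : ℝ, 0 ≤ S ∧ ∀ R, S ≤ R →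
      strInf u j Φ =ᶠ[𝓝 x] strG u j R (-ContinuousLinearMap.id ℝ Spt) Φ := by
  obtain ⟨S, hS, h⟩ := hΦ.exists_cutoff hus.isCompact (‖x‖ + 1)
  refine ⟨S, hS, fun R hR => ?_⟩
  filter_upwards [Metric.ball_mem_nhds x one_pos] with y hy
  have hy' : ‖y‖ ≤ ‖x‖ + 1 := by
    rw [mem_ball_iff_norm] at hy
    linarith [norm_sub_norm_le y x]
  exact strInf_eq_strG j hS hR (h y hy')

theorem contDiff_strInf {u : Spt → ℂ} (hu : ContDiff ℝ ∞ u) (hus : HasCompactSupport u) (j : ℕ)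
    {Φ : Spt → ℂ} (hΦ : ContDiff ℝ ∞ Φ) (hs : SpacelikeSupport Φ) :
    ContDiff ℝ ∞ (strInf u j Φ) := by
  refine contDiff_iff_contDiffAt.2 fun x => ?_
  obtain ⟨S, hS, h⟩ := strInf_eventuallyEq hus j hs x
  exact ((contDiff_strG hu hus j hS _ hΦ).contDiffAt).congr_of_eventuallyEq (h S le_rfl)

theorem fderiv_strInf {u : Spt → ℂ} (hu : ContDiff ℝ ∞ u) (hus : HasCompactSupport u) (j : ℕ)
    {Φ : Spt → ℂ} (hΦ : ContDiff ℝ ∞ Φ) (hs : SpacelikeSupport Φ) (x v : Spt) :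
    fderiv ℝ (strInf u j Φ) x v = strInf u j (fun x => fderiv ℝ Φ x v) x := by
  obtain ⟨S, hS, h⟩ := strInf_eventuallyEq hus j hs x
  obtain ⟨S', hS', h'⟩ := strInf_eventuallyEq hus j (hs.fderiv v) x
  rw [(h _ (le_max_left S S')).fderiv_eq, (h' _ (le_max_right S S')).eq_of_nhds,
    fderiv_strG hu hus j (hS.trans (le_max_left S S')) _ hΦ]

/-- The string integral over the components of a covector field. -/
theorem integrable_string {u : Spt → ℝ} (hu : ContDiff ℝ ∞ u) (hus : HasCompactSupport u) (j : ℕ)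
    {Φ : Fin 4 → Spt → ℂ} (hΦ : ∀ ν, ContDiff ℝ ∞ (Φ ν)) (hs : ∀ ν, SpacelikeSupport (Φ ν))
    (x : Spt) : Integrable (fun e => (u e : ℂ) *
      ∫ s in Set.Ioi (0 : ℝ), ∑ ν, (s : ℂ) ^ j * Φ ν (x + s • e) * (e ν : ℂ)) sigma ∧
    ∫ e, (u e : ℂ) * (∫ s in Set.Ioi (0 : ℝ), ∑ ν, (s : ℂ) ^ j * Φ ν (x + s • e) * (e ν : ℂ))
      ∂sigma = ∑ ν, strInf (wt u ν) j (Φ ν) x := by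
  choose S hS0 hS using fun ν => (hs ν).exists_cutoff hus.isCompact ‖x‖
  set R := ∑ ν, S ν with hR
  have hSR : ∀ ν, S ν ≤ R := fun ν => Finset.single_le_sum (fun i _ => hS0 i) (Finset.mem_univ ν)
  have hR0 : 0 ≤ R := (hS0 0).trans (hSR 0)
  have hsub : ∀ ν, tsupport (wt u ν) ⊆ tsupport u := fun ν =>
    (tsupport_mul_subset_left (f := fun e => (u e : ℂ))).trans
      (closure_mono fun e he h0 => he (by simp [h0]))
  have hcont : ∀ ν, Continuous fun z : Spt × ℝ => (z.2 : ℂ) ^ j * Φ ν (x + z.2 • z.1) := fun ν =>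
    ((Complex.continuous_ofReal.comp continuous_snd).pow j).mul
      ((hΦ ν).continuous.comp (by fun_prop))
  have hae : ∀ᵐ e ∂sigma, (u e : ℂ) *
      (∫ s in Set.Ioi (0 : ℝ), ∑ ν, (s : ℂ) ^ j * Φ ν (x + s • e) * (e ν : ℂ)) =
      ∑ ν, wt u ν e * ∫ s in (0 : ℝ)..R, (s : ℂ) ^ j *
        Φ ν (x - s • (-ContinuousLinearMap.id ℝ Spt) e) := by
    filter_upwards [sigma_ae] with e he
    by_cases hue : e ∈ tsupport u
    · rw [integral_Ioi_eq_interval le_rfl hR0, intervalIntegral.integral_finsetSum, Finset.mul_sum]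
      · refine Finset.sum_congr rfl fun ν _ => ?_
        rw [intervalIntegral.integral_mul_const, wt]
        simp; ring
      · intro ν _
        exact (((hcont ν).comp (by fun_prop : Continuous fun s : ℝ => (e, s))).mul
          continuous_const).intervalIntegrable _ _
      · intro s hs
        refine Finset.sum_eq_zero fun ν _ => ?_
        rw [hS ν x le_rfl e hue he s ((hSR ν).trans_lt hs)]; simp
    · simp [wt, image_eq_zero_of_notMem_tsupport hue]
  have hint : ∀ ν, Integrable (fun e => wt u ν e * ∫ s in (0 : ℝ)..R, (s : ℂ) ^ j *
        Φ ν (x - s • (-ContinuousLinearMap.id ℝ Spt) e)) sigma := by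
    intro ν
    refine Continuous.integrable_of_hasCompactSupport ((contDiff_wt hu ν).continuous.mul ?_)
      (hasCompactSupport_wt hus ν).mul_right
    refine intervalIntegral.continuous_parametric_intervalIntegral_of_continuous' ?_ _ _
    simpa [Function.uncurry_def] using hcont ν
  constructor
  · exact (integrable_finsetSum _ fun ν _ => hint ν).congr (hae.mono fun e he => he.symm)
  · rw [integral_congr_ae hae, integral_finsetSum _ fun ν _ => hint ν]
    refine Finset.sum_congr rfl fun ν _ => ?_
    rw [strInf_eq_strG j (hS0 ν) (hSR ν) fun e he => hS ν x le_rfl e (hsub ν he)]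
    rfl

/-! ### The potential and its gauge variation -/

section Gluon

variable {ι : Type*} (S : GluonSolution ι)

theorem GluonSolution.spacelikeSupport (a : ι) (μ ν : Fin 4) : SpacelikeSupport (S.F a μ ν) := by
  obtain ⟨R, hR⟩ := S.support
  refine ⟨R, fun x hx => hR a μ ν x ?_⟩
  rwa [← norm_spv_sq, Real.sqrt_sq (norm_nonneg _)]

theorem GluonSolution.pd_antisymm (a : ι) (μ ν ρ : Fin 4) (x : Spt) :
    pd ρ (S.F a ν μ) x = -pd ρ (S.F a μ ν) x := by
  have : S.F a ν μ = -S.F a μ ν := funext fun x => S.antisymm a μ ν x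
  rw [this, pd, fderiv_neg]; rfl

theorem potential_eq {c : Spt → ℝ} (hc : ContDiff ℝ ∞ c) (hcs : HasCompactSupport c) (a : ι)
    (μ : Fin 4) (x : Spt) : potential S c a μ x = ∑ ν, strInf (wt c ν) 0 (S.F a μ ν) x := by
  rw [← (integrable_string hc hcs 0 (S.smooth a μ) (S.spacelikeSupport a μ) x).2, potential]
  simp

theorem contDiff_potential {c : Spt → ℝ} (hc : ContDiff ℝ ∞ c) (hcs : HasCompactSupport c) (a : ι)
    (μ : Fin 4) : ContDiff ℝ ∞ (potential S c a μ) := by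
  rw [show potential S c a μ = _ from funext (potential_eq S hc hcs a μ)]
  exact ContDiff.sum fun ν _ => contDiff_strInf (contDiff_wt hc ν) (hasCompactSupport_wt hcs ν) 0
    (S.smooth a μ ν) (S.spacelikeSupport a μ ν)

theorem pd_potential {c : Spt → ℝ} (hc : ContDiff ℝ ∞ c) (hcs : HasCompactSupport c) (a : ι)
    (μ ν : Fin 4) (x : Spt) :
    pd μ (potential S c a ν) x = ∑ r, strInf (wt c r) 0 (pd μ (S.F a ν r)) x := by
  rw [show potential S c a ν = _ from funext (potential_eq S hc hcs a ν), pd,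
    fderiv_fun_sum fun r _ => (contDiff_strInf (contDiff_wt hc r) (hasCompactSupport_wt hcs r) 0
      (S.smooth a ν r) (S.spacelikeSupport a ν r)).differentiable (by simp) x,
    _root_.sum_apply]
  exact Finset.sum_congr rfl fun r _ => fderiv_strInf (contDiff_wt hc r)
    (hasCompactSupport_wt hcs r) 0 (S.smooth a ν r) (S.spacelikeSupport a ν r) x _

/-- The string-localized potential is a potential of the field strength. -/
theorem potential_curl {c : Spt → ℝ} (hc : ContDiff ℝ ∞ c) (hcs : HasCompactSupport c)
    (hw : ∫ e, c e ∂sigma = 1) (a : ι) (μ ν : Fin 4) (x : Spt) :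
    pd μ (potential S c a ν) x - pd ν (potential S c a μ) x = S.F a μ ν x := by
  rw [pd_potential S hc hcs, pd_potential S hc hcs, ← Finset.sum_sub_distrib]
  obtain ⟨S₀, hS₀, h₀⟩ := (S.spacelikeSupport a μ ν).exists_cutoff hcs.isCompact ‖x‖
  have hq : ∀ ρ σ τ r, ∃ S₁ : ℝ, 0 ≤ S₁ ∧ ∀ R, S₁ ≤ R → strInf (wt c r) 0 (pd ρ (S.F a σ τ)) x =
      strG (wt c r) 0 R (-ContinuousLinearMap.id ℝ Spt) (pd ρ (S.F a σ τ)) x := fun ρ σ τ r => by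
    obtain ⟨S₁, h1, h2⟩ := strInf_eventuallyEq (hasCompactSupport_wt hcs r) 0
      ((S.spacelikeSupport a σ τ).fderiv (Pi.single ρ 1)) x
    exact ⟨S₁, h1, fun R hR => (h2 R hR).eq_of_nhds⟩
  choose S₁ hS₁ h₁ using fun r => hq μ ν r r
  choose S₂ hS₂ h₂ using fun r => hq ν μ r r
  -- One length beyond all cutoffs; the summand 1 makes it strictly larger than `S₀`, so that `F`
  -- vanishes at the far end point.
  set R := S₀ + 1 + ∑ r, S₁ r + ∑ r, S₂ r with hR
  have b1 := Finset.sum_nonneg fun r (_ : r ∈ Finset.univ) => hS₁ r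
  have b2 := Finset.sum_nonneg fun r (_ : r ∈ Finset.univ) => hS₂ r
  have hR0 : 0 ≤ R := by linarith
  -- The Bianchi identity in the form ∂_μ F_{νr} - ∂_ν F_{μr} = -∂_r F_{μν}: contracted with e^r it
  -- is a derivative along the string. The sign is carried by -id.
  have hterm : ∀ r, strInf (wt c r) 0 (pd μ (S.F a ν r)) x - strInf (wt c r) 0 (pd ν (S.F a μ r)) x =
      strG (wt c r) 0 R (-ContinuousLinearMap.id ℝ Spt) (fun z => fderiv ℝ (S.F a μ ν) z
        ((-ContinuousLinearMap.id ℝ Spt) (Pi.single r 1))) x := by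
    intro r
    have l1 : S₁ r ≤ R := by
      have := Finset.single_le_sum (fun i _ => hS₁ i) (Finset.mem_univ r); linarith
    have l2 : S₂ r ≤ R := by
      have := Finset.single_le_sum (fun i _ => hS₂ i) (Finset.mem_univ r); linarith
    have hcd : ∀ ρ σ τ, ContDiff ℝ ∞ (pd ρ (S.F a σ τ)) := fun ρ σ τ =>
      contDiff_fderiv_const (S.smooth a σ τ) _
    rw [h₁ r R l1, h₂ r R l2, sub_eq_iff_eq_add,
      ← strG_add (contDiff_wt hc r).continuous (hasCompactSupport_wt hcs r) 0 hR0 _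
        (contDiff_fderiv_const (S.smooth a μ ν) _).continuous (hcd ν μ r).continuous]
    congr 1
    ext z
    have := S.bianchi a μ ν r z
    rw [S.pd_antisymm a μ r ν] at this
    simp only [Pi.add_apply, _root_.neg_apply, ContinuousLinearMap.id_apply, map_neg]
    change _ = -pd r (S.F a μ ν) z + _
    linear_combination this
  rw [Finset.sum_congr rfl fun r _ => hterm r, sum_strG_fderiv hc hcs R _ (S.smooth a μ ν)]
  have h3 : ∫ e, (c e : ℂ) * (S.F a μ ν x - S.F a μ ν (x - R • (-ContinuousLinearMap.id ℝ Spt) e))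
      ∂sigma = ∫ e, (c e : ℂ) * S.F a μ ν x ∂sigma := by
    refine integral_congr_ae ?_
    filter_upwards [sigma_ae] with e he
    by_cases hce : e ∈ tsupport c
    · have : S.F a μ ν (x - R • (-ContinuousLinearMap.id ℝ Spt) e) = 0 := by
        simpa using h₀ x le_rfl e hce he R (by linarith)
      rw [this, sub_zero]
    · simp [image_eq_zero_of_notMem_tsupport hce]
  rw [h3, integral_mul_const, integral_complex_ofReal, hw]; simp

theorem potential_add_smul {c d : Spt → ℝ} (hc : ContDiff ℝ ∞ c) (hcs : HasCompactSupport c)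
    (hd : ContDiff ℝ ∞ d) (hds : HasCompactSupport d) (t : ℝ) (a : ι) (μ : Fin 4) (x : Spt) :
    potential S (fun e => c e + t * d e) a μ x =
      potential S c a μ x + t * potential S d a μ x := by
  have h1 := (integrable_string hc hcs 0 (S.smooth a μ) (S.spacelikeSupport a μ) x).1
  have h2 := (integrable_string hd hds 0 (S.smooth a μ) (S.spacelikeSupport a μ) x).1
  simp only [pow_zero, one_mul] at h1 h2
  rw [potential, potential, potential, ← integral_const_mul, ← integral_add h1 (h2.const_mul _)]
  congr 1; ext e
  push_cast; ring

/-- The string integral that defines `w`, for a general tensor field. -/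
noncomputable def wGen (b : Fin 4 → Spt → ℝ) (Φ : Fin 4 → Fin 4 → Spt → ℂ) (x : Spt) : ℂ :=
  ∫ e, ∑ k, (b k e : ℂ) *
    (∫ s in Set.Ioi (0 : ℝ), ∑ ν, (s : ℂ) * Φ k ν (x + s • e) * (e ν : ℂ)) ∂sigma

theorem wGen_eq {b : Fin 4 → Spt → ℝ} (hb : ∀ k, ContDiff ℝ ∞ (b k))
    (hbs : ∀ k, HasCompactSupport (b k)) {Φ : Fin 4 → Fin 4 → Spt → ℂ}
    (hΦ : ∀ k ν, ContDiff ℝ ∞ (Φ k ν)) (hs : ∀ k ν, SpacelikeSupport (Φ k ν)) (x : Spt) :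
    wGen b Φ x = ∑ k, ∑ ν, strInf (wt (b k) ν) 1 (Φ k ν) x := by
  have h := fun k => integrable_string (hb k) (hbs k) 1 (hΦ k) (hs k) x
  simp only [pow_one] at h
  rw [wGen, integral_finsetSum _ fun k _ => (h k).1]
  exact Finset.sum_congr rfl fun k _ => (h k).2

theorem contDiff_wField {b : Fin 4 → Spt → ℝ} (hb : ∀ k, ContDiff ℝ ∞ (b k))
    (hbs : ∀ k, HasCompactSupport (b k)) (a : ι) : ContDiff ℝ ∞ (wField S b a) := by
  rw [show wField S b a = _ from
    funext (wGen_eq hb hbs (S.smooth a) (S.spacelikeSupport a))]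
  exact ContDiff.sum fun k _ => ContDiff.sum fun ν _ => contDiff_strInf (contDiff_wt (hb k) ν)
    (hasCompactSupport_wt (hbs k) ν) 1 (S.smooth a k ν) (S.spacelikeSupport a k ν)

theorem pd_wField {b : Fin 4 → Spt → ℝ} (hb : ∀ k, ContDiff ℝ ∞ (b k))
    (hbs : ∀ k, HasCompactSupport (b k)) (a : ι) (μ : Fin 4) (x : Spt) :
    pd μ (wField S b a) x = wGen b (fun k ν => pd μ (S.F a k ν)) x := by
  have hd := fun k ν => (contDiff_strInf (contDiff_wt (hb k) ν)
    (hasCompactSupport_wt (hbs k) ν) 1 (S.smooth a k ν)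
    (S.spacelikeSupport a k ν)).differentiable (by simp) x
  rw [wGen_eq (Φ := fun k ν => pd μ (S.F a k ν)) hb hbs (fun k ν => contDiff_fderiv_const (S.smooth a k ν) _)
    (fun k ν => (S.spacelikeSupport a k ν).fderiv _), show wField S b a = _ from
    funext (wGen_eq hb hbs (S.smooth a) (S.spacelikeSupport a)), pd,
    fderiv_fun_sum fun k _ => DifferentiableAt.fun_sum fun ν _ => hd k ν,
    _root_.sum_apply]
  refine Finset.sum_congr rfl fun k _ => ?_
  rw [fderiv_fun_sum fun ν _ => hd k ν, _root_.sum_apply]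
  exact Finset.sum_congr rfl fun ν _ => fderiv_strInf (contDiff_wt (hb k) ν)
    (hasCompactSupport_wt (hbs k) ν) 1 (S.smooth a k ν) (S.spacelikeSupport a k ν) x _

/-- The string integral of `F` as a function of the direction. -/
noncomputable def dirInt (S : GluonSolution ι) (a : ι) (μ : Fin 4) (x e : Spt) : ℂ :=
  ∫ s in Set.Ioi (0 : ℝ), ∑ ν, S.F a μ ν (x + s • e) * (e ν : ℂ)

/-- Half of the gap between spatial length and |e⁰| persists for directions close to `e`, on or off
the hyperboloid. This gives a cutoff uniform near `e`, as needed for differentiating in the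
direction. -/
theorem dirInt_eventuallyEq (a : ι) (μ : Fin 4) (x : Spt) {e : Spt} (he : minkSq e < 0) :
    ∃ R : ℝ, 0 ≤ R ∧ (∀ k ν, S.F a k ν (x + R • e) = 0 ∧
      ∀ s, R < s → ∀ v, S.F a k ν (x + s • e) = 0 ∧ fderiv ℝ (S.F a k ν) (x + s • e) v = 0) ∧
    dirInt S a μ x =ᶠ[𝓝 e] fun e => ∫ s in Set.Icc (0 : ℝ) R,
      ∑ ν, S.F a μ ν (x + s • e) * (e ν : ℂ) := by
  obtain ⟨R₀, hR₀⟩ := S.support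
  have hR₁ : ∀ k ν (x : Spt), |x 0| + R₀ < ‖spv x‖ → S.F a k ν x = 0 := fun k ν x hx =>
    hR₀ a k ν x (by rwa [← norm_spv_sq, Real.sqrt_sq (norm_nonneg _)])
  have hgap : 0 < ‖spv e‖ - |e 0| := sub_pos.2 (abs_time_lt_norm_spv he)
  set δ := (‖spv e‖ - |e 0|) / 2 with hδ
  have hδ0 : 0 < δ := half_pos hgap
  have hev : ∀ᶠ e' in 𝓝 e, δ < ‖spv e'‖ - |e' 0| := by
    have hc : Continuous fun e' : Spt => ‖spv e'‖ - |e' 0| := by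
      have := continuous_spv
      fun_prop
    exact hc.continuousAt.eventually_const_lt (by rw [hδ]; linarith)
  set R := (3 * ‖x‖ + |R₀|) / δ + 1 with hR
  have hR0 : 0 ≤ R := by positivity
  have hz : ∀ e', δ < ‖spv e'‖ - |e' 0| → ∀ s, R ≤ s → ∀ k ν, S.F a k ν (x + s • e') = 0 ∧
      ∀ v, fderiv ℝ (S.F a k ν) (x + s • e') v = 0 := by
    intro e' he' s hs k ν
    have h1 : 3 * ‖x‖ + R₀ < s * (‖spv e'‖ - |e' 0|) := by
      have h2 : (3 * ‖x‖ + |R₀|) / δ < s := by linarith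
      rw [div_lt_iff₀ hδ0] at h2
      have := mul_le_mul_of_nonneg_left he'.le (hR0.trans hs)
      linarith [le_abs_self R₀]
    refine ⟨SpacelikeSupport.eq_zero (hR₁ k ν) (hR0.trans hs) h1, fun v => ?_⟩
    have ho : IsOpen {x : Spt | |x 0| + R₀ < ‖spv x‖} :=
      isOpen_lt (by fun_prop) continuous_spv.norm
    refine SpacelikeSupport.eq_zero (Φ := fun y => fderiv ℝ (S.F a k ν) y v) (R := R₀)
      (fun y hy => ?_) (hR0.trans hs) h1
    have : S.F a k ν =ᶠ[𝓝 y] fun _ => 0 := by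
      filter_upwards [ho.mem_nhds hy] with z hz' using hR₁ k ν z hz'
    rw [this.fderiv_eq]; simp
  have hself : δ < ‖spv e‖ - |e 0| := by rw [hδ]; linarith
  refine ⟨R, hR0, fun k ν => ⟨(hz e hself R le_rfl k ν).1, fun s hs v =>
    ⟨(hz e hself s hs.le k ν).1, (hz e hself s hs.le k ν).2 v⟩⟩, ?_⟩
  filter_upwards [hev] with e' he'
  rw [dirInt, integral_Ioi_eq_interval le_rfl hR0 fun s hs =>
    Finset.sum_eq_zero fun ν _ => by rw [(hz e' he' s hs.le μ ν).1, zero_mul],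
    intervalIntegral.integral_of_le hR0, integral_Icc_eq_integral_Ioc]

theorem contDiff_dirInt_integrand (a : ι) (μ : Fin 4) (x : Spt) :
    ContDiff ℝ ∞ (Function.uncurry fun (e : Spt) (s : ℝ) =>
      ∑ ν, S.F a μ ν (x + s • e) * (e ν : ℂ)) := by
  refine ContDiff.sum fun ν _ => ContDiff.mul ?_ ?_
  · exact (S.smooth a μ ν).comp (by fun_prop : ContDiff ℝ ∞ fun z : Spt × ℝ => x + z.2 • z.1)
  · exact Complex.ofRealCLM.contDiff.comp (by fun_prop : ContDiff ℝ ∞ fun z : Spt × ℝ => z.1 ν)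

theorem contDiffOn_dirInt (a : ι) (μ : Fin 4) (x : Spt) :
    ContDiffOn ℝ ∞ (dirInt S a μ x) {e | minkSq e < 0} := by
  intro e he
  obtain ⟨R, hR, -, h⟩ := dirInt_eventuallyEq S a μ x he
  refine ContDiffAt.contDiffWithinAt ?_
  exact (contDiff_integral_of_compact isCompact_Icc (ae_restrict_mem measurableSet_Icc)
    (contDiff_dirInt_integrand S a μ x)).contDiffAt.congr_of_eventuallyEq h

/-- Differentiation in `e` gives s e^ν ∂_k F_{μν} + F_{μk}. By the Bianchi identity this differs
from s e^ν ∂_μ F_{kν} by the total derivative of s F_{μk}(x+se), which vanishes at both ends. It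
turns the variation of `A` into a gradient. -/
theorem pd_dirInt (a : ι) (μ k : Fin 4) (x : Spt) {e : Spt} (he : minkSq e < 0) :
    pd k (dirInt S a μ x) e = ∫ s in Set.Ioi (0 : ℝ),
      ∑ ν, (s : ℂ) * pd μ (S.F a k ν) (x + s • e) * (e ν : ℂ) := by
  obtain ⟨R, hR, hz, h⟩ := dirInt_eventuallyEq S a μ x he
  rw [pd, h.fderiv_eq, fderiv_integral_of_compact isCompact_Icc (ae_restrict_mem measurableSet_Icc)
    (contDiff_dirInt_integrand S a μ x), integral_Ioi_eq_interval le_rfl hR (fun s hs =>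
      Finset.sum_eq_zero fun ν _ => by
        rw [pd, ((hz k ν).2 s hs _).2]; simp), integral_Icc_eq_integral_Ioc,
    ← intervalIntegral.integral_of_le hR]
  have hF : ∀ i j, Continuous (S.F a i j) := fun i j => (S.smooth a i j).continuous
  have hpd : ∀ r i j, Continuous (pd r (S.F a i j)) := fun r i j =>
    (contDiff_fderiv_const (S.smooth a i j) _).continuous
  have hdF : ∀ i j (s : ℝ), HasDerivAt (fun s : ℝ => S.F a i j (x + s • e))
      (∑ ν, (e ν : ℂ) * pd ν (S.F a i j) (x + s • e)) s := by
    intro i j s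
    have h2 : HasDerivAt (fun s : ℝ => x + s • e) e s := by
      simpa using ((hasDerivAt_id s).smul_const e).const_add x
    have := (((S.smooth a i j).differentiable (by simp)) (x + s • e)).hasFDerivAt.comp_hasDerivAt s h2
    refine this.congr_deriv ?_
    have h3 := sum_coord_smul (ContinuousLinearMap.id ℝ Spt : Spt →ₗ[ℝ] Spt) e
    simp only [ContinuousLinearMap.coe_coe, ContinuousLinearMap.id_apply] at h3
    refine (congrArg (fderiv ℝ (S.F a i j) (x + s • e)) h3.symm).trans ?_
    rw [map_sum]
    refine Finset.sum_congr rfl fun ν _ => ?_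
    rw [map_smul, Complex.real_smul]; rfl
  have h1 : ∀ s : ℝ, fderiv ℝ (fun e : Spt => ∑ ν, S.F a μ ν (x + s • e) * (e ν : ℂ)) e
      (Pi.single k 1) = ∑ ν, (s : ℂ) * pd k (S.F a μ ν) (x + s • e) * (e ν : ℂ)
        + S.F a μ k (x + s • e) := by
    intro s
    have d1 : ∀ ν, HasFDerivAt (fun e : Spt => S.F a μ ν (x + s • e))
        ((fderiv ℝ (S.F a μ ν) (x + s • e)).comp (s • ContinuousLinearMap.id ℝ Spt)) e := fun ν =>
      (((S.smooth a μ ν).differentiable (by simp)) (x + s • e)).hasFDerivAt.comp e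
        (((hasFDerivAt_id e).const_smul s).const_add x)
    have d2 : ∀ ν : Fin 4, HasFDerivAt (fun e : Spt => (e ν : ℂ))
        (Complex.ofRealCLM.comp (ContinuousLinearMap.proj ν)) e := fun ν =>
      (Complex.ofRealCLM.comp (ContinuousLinearMap.proj (R := ℝ) (φ := fun _ : Fin 4 => ℝ) ν)).hasFDerivAt
    have d3 := HasFDerivAt.fun_sum fun ν (_ : ν ∈ (Finset.univ : Finset (Fin 4))) =>
      (d1 ν).fun_mul (d2 ν)
    rw [HasFDerivAt.fderiv d3, _root_.sum_apply]
    have e1 : ∀ ν : Fin 4, (S.F a μ ν (x + s • e) • (Complex.ofRealCLM.comp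
        (ContinuousLinearMap.proj (R := ℝ) (φ := fun _ : Fin 4 => ℝ) ν)) + (e ν : ℂ) •
        ((fderiv ℝ (S.F a μ ν) (x + s • e)).comp (s • ContinuousLinearMap.id ℝ Spt)) :
        Spt →L[ℝ] ℂ) (Pi.single k 1) = (if ν = k then S.F a μ k (x + s • e) else 0) +
        (s : ℂ) * pd k (S.F a μ ν) (x + s • e) * (e ν : ℂ) := by
      intro ν
      by_cases hν : ν = k
      · subst hν; simp [pd]; ring
      · simp [pd, hν]; ring
    rw [Finset.sum_congr rfl fun ν _ => e1 ν, Finset.sum_add_distrib, Finset.sum_ite_eq']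
    simp; ring
  simp_rw [h1]
  rw [← sub_eq_zero, ← intervalIntegral.integral_sub]
  · have h2 : ∀ s : ℝ, HasDerivAt (fun s : ℝ => (s : ℂ) * S.F a μ k (x + s • e))
        (∑ ν, (s : ℂ) * pd k (S.F a μ ν) (x + s • e) * (e ν : ℂ) + S.F a μ k (x + s • e) -
          ∑ ν, (s : ℂ) * pd μ (S.F a k ν) (x + s • e) * (e ν : ℂ)) s := by
      intro s
      refine ((hasDerivAt_id s).ofReal_comp.mul (hdF μ k s)).congr_deriv ?_
      have e2 : ∀ ν, (s : ℂ) * pd k (S.F a μ ν) (x + s • e) * (e ν : ℂ) -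
          (s : ℂ) * pd μ (S.F a k ν) (x + s • e) * (e ν : ℂ) =
          (s : ℂ) * ((e ν : ℂ) * pd ν (S.F a μ k) (x + s • e)) := by
        intro ν
        have := S.bianchi a μ k ν (x + s • e)
        rw [S.pd_antisymm a μ ν k] at this
        linear_combination (-(s : ℂ) * (e ν : ℂ)) * this
      rw [add_sub_right_comm, ← Finset.sum_sub_distrib, Finset.sum_congr rfl fun ν _ => e2 ν,
        ← Finset.mul_sum]
      simp; ring
    rw [intervalIntegral.integral_eq_sub_of_hasDerivAt (fun s _ => h2 s)]
    · rw [(hz μ k).1]; simp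
    · refine Continuous.intervalIntegrable ?_ _ _
      fun_prop
  · refine Continuous.intervalIntegrable ?_ _ _
    fun_prop
  · refine Continuous.intervalIntegrable ?_ _ _
    fun_prop

/-- The variation of the potential is a gradient. -/
theorem potential_variation (Sm : Smearing) (a : ι) (μ : Fin 4) (x : Spt) :
    potential S Sm.dc a μ x = pd μ (wField S Sm.b a) x := by
  rw [pd_wField S Sm.b_smooth Sm.b_supp, wGen]
  refine (Sm.dc_div _ (contDiffOn_dirInt S a μ x)).trans (integral_congr_ae ?_)
  filter_upwards [sigma_ae] with e he
  refine Finset.sum_congr rfl fun k _ => ?_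
  rw [pd_dirInt S a μ k x (by rw [he]; norm_num)]

end Gluon

/-! ### Linear functionals -/

theorem Kern.IsLinear.sum {K : Kern} (hK : K.IsLinear) {α : Type*} (s : Finset α)
    {g : α → Spt × Spt → ℂ} (hg : ∀ i ∈ s, IsTest (g i)) :
    K (fun z => ∑ i ∈ s, g i z) = ∑ i ∈ s, K (g i) := by
  classical
  induction s using Finset.induction_on with
  | empty =>
    have := hK.2 0 0 isTest_zero
    simpa [Pi.zero_def] using this
  | insert a s ha ih =>
    simp only [Finset.sum_insert ha]
    rw [← ih fun i hi => hg i (Finset.mem_insert_of_mem hi)]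
    have := IsTest.sum fun i hi => hg i (Finset.mem_insert_of_mem hi)
    rw [Finset.sum_fn] at this
    exact hK.1 _ _ (hg a (Finset.mem_insert_self a s)) this

theorem Kern.IsLinear.fun_add {K : Kern} (hK : K.IsLinear) {g h : Spt × Spt → ℂ}
    (hg : IsTest g) (hh : IsTest h) : K (fun z => g z + h z) = K g + K h := hK.1 g h hg hh

theorem Kern.IsLinear.fun_smul {K : Kern} (hK : K.IsLinear) (t : ℂ) {g : Spt × Spt → ℂ}
    (hg : IsTest g) : K (fun z => t * g z) = t * K g := hK.2 t g hg

/-! ### Derivatives of Wick polynomials -/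

section WickAlgebra

variable {ι κ : Type*} [Fintype ι] [DecidableEq ι] [Fintype κ] [DecidableEq κ]

/-- The kinds of gluon fields. -/
def bosonEquiv : (Fin 4 × Fin 4 × ι) ⊕ (Fin 4 × ι) ⊕ ι ≃ Boson ι where
  toFun
    | .inl (μ, ν, a) => .F μ ν a
    | .inr (.inl (μ, a)) => .A μ a
    | .inr (.inr a) => .w a
  invFun
    | .F μ ν a => .inl (μ, ν, a)
    | .A μ a => .inr (.inl (μ, a))
    | .w a => .inr (.inr a)
  left_inv := by rintro (⟨μ, ν, a⟩ | ⟨μ, a⟩ | a) <;> rfl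
  right_inv := by rintro (⟨μ, ν, a⟩ | ⟨μ, a⟩ | a) <;> rfl

/-- The kinds of quark fields. -/
def quarkEquiv : (Fin 4 × κ) ⊕ (Fin 4 × κ) ≃ Quark κ where
  toFun
    | .inl (α, m) => .psi α m
    | .inr (α, m) => .bar α m
  invFun
    | .psi α m => .inl (α, m)
    | .bar α m => .inr (α, m)
  left_inv := by rintro (⟨α, m⟩ | ⟨α, m⟩) <;> rfl
  right_inv := by rintro (⟨α, m⟩ | ⟨α, m⟩) <;> rfl

theorem sum_boson (f : Boson ι → ℂ) : ∑ i, f i =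
    ∑ μ, ∑ ν, ∑ a, f (.F μ ν a) + (∑ μ, ∑ a, f (.A μ a) + ∑ a, f (.w a)) := by
  rw [← bosonEquiv.sum_comp f]
  simp only [Fintype.sum_sum_type, Fintype.sum_prod_type]
  rfl

theorem sum_quark (f : Quark κ → ℂ) : ∑ i, f i =
    ∑ α, ∑ m, f (.psi α m) + ∑ α, ∑ m, f (.bar α m) := by
  rw [← quarkEquiv.sum_comp f]
  simp only [Fintype.sum_sum_type, Fintype.sum_prod_type]
  rfl

theorem dLeft_inl_tmul (i : Boson ι) (p : MvPolynomial (Boson ι) ℂ)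
    (q : ExteriorAlgebra ℂ (Quark κ → ℂ)) :
    dLeft (.inl i) (p ⊗ₜ[ℂ] q) = MvPolynomial.pderiv i p ⊗ₜ[ℂ] q := rfl

theorem dLeft_inl_mul (i : Boson ι) (Y X : Wick ι κ) :
    dLeft (.inl i) (Y * X) = dLeft (.inl i) Y * X + Y * dLeft (.inl i) X := by
  induction Y using TensorProduct.induction_on with
  | zero => simp
  | add y₁ y₂ h₁ h₂ => rw [add_mul, map_add, h₁, h₂, map_add, add_mul, add_mul]; abel
  | tmul p q =>
    induction X using TensorProduct.induction_on with
    | zero => simp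
    | add x₁ x₂ h₁ h₂ => rw [mul_add, map_add, h₁, h₂, map_add, mul_add, mul_add]; abel
    | tmul r s =>
      simp only [dLeft_inl_tmul, Algebra.TensorProduct.tmul_mul_tmul, Derivation.leibniz,
        smul_eq_mul, TensorProduct.add_tmul]
      rw [add_comm, mul_comm r]

theorem dLeft_inl_bos (i j : Boson ι) :
    dLeft (.inl i) (bos j : Wick ι κ) = if j = i then 1 else 0 := by
  simp only [dLeft_inl_tmul, bos, MvPolynomial.pderiv_X]
  by_cases h : j = i
  · subst h; simp [Algebra.TensorProduct.one_def]
  · simp [h]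

theorem dLeft_inl_quark (i : Boson ι) (q : Quark κ) : dLeft (.inl i) (quark q : Wick ι κ) = 0 := by
  simp [dLeft, quark]

theorem dLeft_inl_cur (D : ColorData ι κ) (G : DiracMatrices) (i : Boson ι) (μ : Fin 4) (a : ι) :
    dLeft (.inl i) (cur D G μ a) = 0 := by
  simp [cur, dLeft_inl_mul, dLeft_inl_quark]

theorem dLeft_inl_br (D : ColorData ι κ) (i : Boson ι) (X Z : ι → Wick ι κ) (c : ι) :
    dLeft (.inl i) (br D X Z c) =
      br D (fun a => dLeft (.inl i) (X a)) Z c + br D X (fun a => dLeft (.inl i) (Z a)) c := by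
  simp only [br, map_sum, map_smul, dLeft_inl_mul, smul_add, Finset.sum_add_distrib]

theorem dLeft_inl_ip (i : Boson ι) (X Z : ι → Wick ι κ) :
    dLeft (.inl i) (ip X Z) =
      ip (fun a => dLeft (.inl i) (X a)) Z + ip X (fun a => dLeft (.inl i) (Z a)) := by
  simp only [ip, map_sum, dLeft_inl_mul, Finset.sum_add_distrib]

theorem br_zero_left (D : ColorData ι κ) (Z : ι → Wick ι κ) (c : ι) : br D 0 Z c = 0 := by
  simp [br]

theorem br_zero_right (D : ColorData ι κ) (Z : ι → Wick ι κ) (c : ι) : br D Z 0 c = 0 := by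
  simp [br]

theorem ip_zero_left (Z : ι → Wick ι κ) : ip 0 Z = 0 := by simp [ip]

theorem dRight_F_Q1YM (D : ColorData ι κ) (ρ ν : Fin 4) (a : ι) (μ : Fin 4) :
    dRight (.inl (.F ρ ν a)) (Q1YM D μ) =
      if ρ = μ then (sgn μ * sgn ν) • br D ww (AA ν) a else 0 := by
  change dLeft (.inl (.F ρ ν a)) _ = _
  simp only [Q1YM, map_sum, map_smul, dLeft_inl_ip, dLeft_inl_br, ww, AA, FF, dLeft_inl_bos,
    reduceCtorEq, if_false]
  change ∑ σ, (sgn μ * sgn σ) • (ip _ _ + ip _ (fun a => br D 0 _ a + br D _ 0 a)) = _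
  simp only [br_zero_left, br_zero_right, ip, add_zero, mul_zero, Finset.sum_const_zero,
    Boson.F.injEq, ite_mul, one_mul, zero_mul]
  by_cases h : ρ = μ
  · subst h
    rw [Finset.sum_eq_single ν]
    · simp
    · intro b _ hb; simp [hb]
    · simp
  · simp [h, Ne.symm h]

/-- Cyclicity of the structure constants frees `A` from the bracket: ⟨F|i[w,A]⟩ = ⟨i[F,w]|A⟩. -/
theorem dRight_A_Q1YM (D : ColorData ι κ) (ν : Fin 4) (a : ι) (μ : Fin 4) :
    dRight (.inl (.A ν a)) (Q1YM D μ) = (sgn μ * sgn ν) • br D (FF μ ν) ww a := by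
  change dLeft (.inl (.A ν a)) _ = _
  simp only [Q1YM, map_sum, map_smul, dLeft_inl_ip, dLeft_inl_br, ww, AA, FF, dLeft_inl_bos,
    reduceCtorEq, if_false]
  change ∑ σ, (sgn μ * sgn σ) • (ip (0 : ι → Wick ι κ) _ + ip _ (fun a => br D 0 _ a + br D _ _ a)) = _
  simp only [br_zero_left, ip_zero_left, zero_add, Boson.A.injEq]
  simp only [ip]
  rw [Finset.sum_eq_single ν]
  · congr 1
    simp only [br, true_and, mul_ite, mul_one, mul_zero, smul_ite, smul_zero,
      Finset.sum_ite_eq', Finset.mem_univ, if_true, Finset.mul_sum, mul_smul_comm]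
    refine Finset.sum_congr rfl fun c _ => ?_
    refine Finset.sum_congr rfl fun b _ => ?_
    rw [D.f_cyclic c b a]
  · intro b _ hb
    simp [hb, br]
  · simp

theorem dLeft_F_L1YM (D : ColorData ι κ) (k l : Fin 4) (a : ι) :
    dLeft (.inl (.F k l a)) (L1YM D) =
      (1 / 2 * (sgn k * sgn l)) • br D (AA k) (AA l) a := by
  simp only [L1YM, map_sum, map_smul, dLeft_inl_ip, dLeft_inl_br, AA, FF, dLeft_inl_bos,
    reduceCtorEq, if_false]
  change (1 / 2 : ℂ) • ∑ μ, ∑ σ, (sgn μ * sgn σ) •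
    (ip _ _ + ip _ (fun a => br D 0 _ a + br D _ 0 a)) = _
  simp only [br_zero_left, br_zero_right, ip, add_zero, mul_zero, Finset.sum_const_zero,
    Boson.F.injEq, ite_mul, one_mul, zero_mul]
  rw [mul_smul, Finset.sum_eq_single k, Finset.sum_eq_single l]
  · simp
  · intro b _ hb; simp [hb]
  · simp
  · intro b _ hb; simp [hb]
  · simp

theorem dLeft_A_L1min (D : ColorData ι κ) (G : DiracMatrices) (k : Fin 4) (a : ι) :
    dLeft (.inl (.A k a)) (L1min D G) = cur D G k a := by
  simp only [L1min, map_sum, dLeft_inl_mul, AA, dLeft_inl_bos, dLeft_inl_cur, ip, mul_zero,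
    add_zero, Boson.A.injEq, ite_mul, one_mul, zero_mul]
  rw [Finset.sum_eq_single k]
  · simp
  · intro b _ hb; simp [hb]
  · simp

theorem dLeft_F_L1min (D : ColorData ι κ) (G : DiracMatrices) (k l : Fin 4) (a : ι) :
    dLeft (.inl (.F k l a)) (L1min D G) = 0 := by
  simp [L1min, dLeft_inl_mul, AA, dLeft_inl_bos, dLeft_inl_cur, ip]

theorem dLeft_w_L1min (D : ColorData ι κ) (G : DiracMatrices) (a : ι) :
    dLeft (.inl (.w a)) (L1min D G) = 0 := by
  simp [L1min, dLeft_inl_mul, AA, dLeft_inl_bos, dLeft_inl_cur, ip]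

theorem dLeft_w_L1YM (D : ColorData ι κ) (a : ι) : dLeft (.inl (.w a)) (L1YM D) = 0 := by
  simp [L1YM, dLeft_inl_mul, AA, FF, dLeft_inl_bos, ip, br]

theorem dRight_F_Q1min (D : ColorData ι κ) (G : DiracMatrices) (k l : Fin 4) (a : ι) (μ : Fin 4) :
    dRight (.inl (.F k l a)) (Q1min D G μ) = 0 := by
  change dLeft (.inl (.F k l a)) _ = _
  simp [Q1min, dLeft_inl_mul, ww, dLeft_inl_bos, dLeft_inl_cur, ip]

theorem dRight_A_Q1min (D : ColorData ι κ) (G : DiracMatrices) (k : Fin 4) (a : ι) (μ : Fin 4) :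
    dRight (.inl (.A k a)) (Q1min D G μ) = 0 := by
  change dLeft (.inl (.A k a)) _ = _
  simp [Q1min, dLeft_inl_mul, ww, dLeft_inl_bos, dLeft_inl_cur, ip]

/-- The Wick polynomials in the gluon fields. -/
noncomputable abbrev bosonic (ι κ : Type*) : Subalgebra ℂ (Wick ι κ) :=
  (Algebra.TensorProduct.includeLeft :
    MvPolynomial (Boson ι) ℂ →ₐ[ℂ] MvPolynomial (Boson ι) ℂ ⊗[ℂ] ExteriorAlgebra ℂ (Quark κ → ℂ)).range

theorem bos_mem_bosonic (i : Boson ι) : (bos i : Wick ι κ) ∈ bosonic ι κ := ⟨_, rfl⟩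

theorem br_mem_bosonic (D : ColorData ι κ) {X Z : ι → Wick ι κ} (hX : ∀ a, X a ∈ bosonic ι κ)
    (hZ : ∀ a, Z a ∈ bosonic ι κ) (c : ι) : br D X Z c ∈ bosonic ι κ :=
  sum_mem fun a _ => sum_mem fun b _ => Subalgebra.smul_mem _ (mul_mem (hX a) (hZ b)) _

theorem ip_mem_bosonic {X Z : ι → Wick ι κ} (hX : ∀ a, X a ∈ bosonic ι κ)
    (hZ : ∀ a, Z a ∈ bosonic ι κ) : ip X Z ∈ bosonic ι κ :=
  sum_mem fun a _ => mul_mem (hX a) (hZ a)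

theorem L1YM_mem_bosonic (D : ColorData ι κ) : L1YM D ∈ bosonic ι κ :=
  Subalgebra.smul_mem _ (sum_mem fun _ _ => sum_mem fun _ _ => Subalgebra.smul_mem _
    (ip_mem_bosonic (fun _ => bos_mem_bosonic _) (br_mem_bosonic D (fun _ => bos_mem_bosonic _)
      fun _ => bos_mem_bosonic _)) _) _

theorem Q1YM_mem_bosonic (D : ColorData ι κ) (μ : Fin 4) : Q1YM D μ ∈ bosonic ι κ :=
  sum_mem fun _ _ => Subalgebra.smul_mem _
    (ip_mem_bosonic (fun _ => bos_mem_bosonic _) (br_mem_bosonic D (fun _ => bos_mem_bosonic _)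
      fun _ => bos_mem_bosonic _)) _

theorem dLeft_inr_of_mem_bosonic (q : Quark κ) {Y : Wick ι κ} (hY : Y ∈ bosonic ι κ) :
    dLeft (.inr q) Y = 0 := by
  obtain ⟨p, rfl⟩ := hY
  simp [dLeft]

theorem dRight_inr_of_mem_bosonic (q : Quark κ) {Y : Wick ι κ} (hY : Y ∈ bosonic ι κ) :
    dRight (.inr q) Y = 0 := by
  obtain ⟨p, rfl⟩ := hY
  simp [dRight]

/-- The left derivative reaches the second quark only past the first, at the price of a sign. For
the right derivative the roles are exchanged, so the two derivatives of a quark bilinear are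
opposite. -/
theorem dLeft_quark_cubic (q : Quark κ) (i : Boson ι) (r s : Quark κ) :
    dLeft (.inr q) (bos i * (quark r * quark s) : Wick ι κ) =
      (if r = q then bos i * quark s else 0) - (if s = q then bos i * quark r else 0) := by
  simp only [dLeft, bos, quark, Algebra.TensorProduct.tmul_mul_tmul, one_mul, mul_one,
    TensorProduct.map_tmul, LinearMap.id_coe, id_eq]
  rw [show (ExteriorAlgebra.ι ℂ (Pi.single r 1) : ExteriorAlgebra ℂ (Quark κ → ℂ)) =
    CliffordAlgebra.ι 0 (Pi.single r 1) from rfl,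
    show (ExteriorAlgebra.ι ℂ (Pi.single s 1) : ExteriorAlgebra ℂ (Quark κ → ℂ)) =
    CliffordAlgebra.ι 0 (Pi.single s 1) from rfl, CliffordAlgebra.contractLeft_ι_mul,
    CliffordAlgebra.contractLeft_ι]
  simp only [LinearMap.proj_apply, Pi.single_apply, TensorProduct.tmul_sub, eq_comm (a := q)]
  split_ifs <;> simp

theorem dRight_quark_cubic (q : Quark κ) (i : Boson ι) (r s : Quark κ) :
    dRight (.inr q) (bos i * (quark r * quark s) : Wick ι κ) =
      (if s = q then bos i * quark r else 0) - (if r = q then bos i * quark s else 0) := by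
  simp only [dRight, bos, quark, Algebra.TensorProduct.tmul_mul_tmul, one_mul, mul_one,
    TensorProduct.map_tmul, LinearMap.id_coe, id_eq, LinearMap.flip_apply]
  rw [show (ExteriorAlgebra.ι ℂ (Pi.single r 1) : ExteriorAlgebra ℂ (Quark κ → ℂ)) =
    CliffordAlgebra.ι 0 (Pi.single r 1) from rfl,
    show (ExteriorAlgebra.ι ℂ (Pi.single s 1) : ExteriorAlgebra ℂ (Quark κ → ℂ)) =
    CliffordAlgebra.ι 0 (Pi.single s 1) from rfl, CliffordAlgebra.contractRight_mul_ι,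
    CliffordAlgebra.contractRight_ι]
  simp only [LinearMap.proj_apply, Pi.single_apply, TensorProduct.tmul_sub, eq_comm (a := q)]
  split_ifs <;> simp [Algebra.algebraMap_eq_smul_one]

theorem dRight_psi_Q1min (D : ColorData ι κ) (G : DiracMatrices) (β : Fin 4) (n : κ) (μ : Fin 4) :
    dRight (.inr (.psi β n)) (Q1min D G μ) = ∑ a, ∑ α, ∑ m,
      (G.γ μ α β * D.rep a m n) • (bos (.w a) * quark (.bar α m) : Wick ι κ) := by
  simp only [Q1min, ip, cur, ww, Finset.mul_sum, mul_smul_comm, map_sum, map_smul,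
    dRight_quark_cubic, reduceCtorEq, if_false, sub_zero, Quark.psi.injEq, smul_ite, smul_zero]
  refine Finset.sum_congr rfl fun a _ => Finset.sum_congr rfl fun α _ => ?_
  rw [Finset.sum_comm]
  refine Finset.sum_congr rfl fun m _ => ?_
  rw [Finset.sum_eq_single β]
  · simp
  · intro b _ hb; simp [hb]
  · simp

theorem dRight_bar_Q1min (D : ColorData ι κ) (G : DiracMatrices) (α : Fin 4) (m : κ) (μ : Fin 4) :
    dRight (.inr (.bar α m)) (Q1min D G μ) = ∑ a, ∑ β, ∑ n,
      (G.γ μ α β * D.rep a m n) • (-(bos (.w a) * quark (.psi β n)) : Wick ι κ) := by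
  simp only [Q1min, ip, cur, ww, Finset.mul_sum, mul_smul_comm, map_sum, map_smul,
    dRight_quark_cubic, reduceCtorEq, if_false, zero_sub, Quark.bar.injEq]
  refine Finset.sum_congr rfl fun a _ => ?_
  rw [Finset.sum_eq_single α]
  · refine Finset.sum_congr rfl fun β _ => ?_
    rw [Finset.sum_eq_single m]
    · simp
    · intro b _ hb; simp [hb]
    · simp
  · intro b _ hb; simp [hb]
  · simp

theorem dLeft_psi_L1min (D : ColorData ι κ) (G : DiracMatrices) (β : Fin 4) (n : κ) :
    dLeft (.inr (.psi β n)) (L1min D G) = ∑ μ, ∑ a, ∑ α, ∑ m,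
      (G.γ μ α β * D.rep a m n) • (-(bos (.A μ a) * quark (.bar α m)) : Wick ι κ) := by
  simp only [L1min, ip, cur, AA, Finset.mul_sum, mul_smul_comm, map_sum, map_smul,
    dLeft_quark_cubic, reduceCtorEq, if_false, zero_sub, Quark.psi.injEq]
  refine Finset.sum_congr rfl fun μ _ => Finset.sum_congr rfl fun a _ =>
    Finset.sum_congr rfl fun α _ => ?_
  rw [Finset.sum_comm]
  refine Finset.sum_congr rfl fun m _ => ?_
  rw [Finset.sum_eq_single β]
  · simp
  · intro b _ hb; simp [hb]
  · simp

theorem dLeft_bar_L1min (D : ColorData ι κ) (G : DiracMatrices) (α : Fin 4) (m : κ) :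
    dLeft (.inr (.bar α m)) (L1min D G) = ∑ μ, ∑ a, ∑ β, ∑ n,
      (G.γ μ α β * D.rep a m n) • (bos (.A μ a) * quark (.psi β n) : Wick ι κ) := by
  simp only [L1min, ip, cur, AA, Finset.mul_sum, mul_smul_comm, map_sum, map_smul,
    dLeft_quark_cubic, reduceCtorEq, if_false, sub_zero, Quark.bar.injEq, smul_ite, smul_zero]
  refine Finset.sum_congr rfl fun μ _ => Finset.sum_congr rfl fun a _ => ?_
  rw [Finset.sum_eq_single α]
  · refine Finset.sum_congr rfl fun β _ => ?_
    rw [Finset.sum_eq_single m]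
    · simp
    · intro b _ hb; simp [hb]
    · simp
  · intro b _ hb; simp [hb]
  · simp

end WickAlgebra

/-! ### Smooth Grassmann-valued functions -/

/-- Smooth functions with values in the Grassmann algebra. -/
def grassmannSmooth (n : ℕ) : Submodule ℂ (Spt → ExteriorAlgebra ℂ (Fin n → ℂ)) :=
  Submodule.span ℂ {f | ∃ φ : Spt → ℂ, ContDiff ℝ ∞ φ ∧ ∃ e, f = fun x => φ x • e}

theorem smul_mem_grassmannSmooth {n : ℕ} {φ : Spt → ℂ} (hφ : ContDiff ℝ ∞ φ)
    (e : ExteriorAlgebra ℂ (Fin n → ℂ)) : (fun x => φ x • e) ∈ grassmannSmooth n :=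
  Submodule.subset_span ⟨φ, hφ, e, rfl⟩

theorem algebraMap_mem_grassmannSmooth {n : ℕ} {φ : Spt → ℂ} (hφ : ContDiff ℝ ∞ φ) :
    (fun x => algebraMap ℂ (ExteriorAlgebra ℂ (Fin n → ℂ)) (φ x)) ∈ grassmannSmooth n := by
  simp only [Algebra.algebraMap_eq_smul_one]
  exact smul_mem_grassmannSmooth hφ 1

theorem mul_mem_grassmannSmooth {n : ℕ} {f h : Spt → ExteriorAlgebra ℂ (Fin n → ℂ)}
    (hf : f ∈ grassmannSmooth n) (hh : h ∈ grassmannSmooth n) : f * h ∈ grassmannSmooth n := by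
  have := Submodule.mul_mem_mul hf hh
  rw [grassmannSmooth, Submodule.span_mul_span] at this
  refine Submodule.span_mono ?_ this
  rintro _ ⟨_, ⟨φ, hφ, e, rfl⟩, _, ⟨χ, hχ, d, rfl⟩, rfl⟩
  refine ⟨fun x => φ x * χ x, hφ.mul hχ, e * d, ?_⟩
  ext x
  simp [mul_smul, smul_comm (χ x)]

/-- Membership in the span reduces the claim to products φ(x)χ(x')ℓ(ed) of scalar functions, so no
topology on the Grassmann algebra is involved. -/
theorem contDiff_two_point {n : ℕ} {f h : Spt → ExteriorAlgebra ℂ (Fin n → ℂ)}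
    (hf : f ∈ grassmannSmooth n) (hh : h ∈ grassmannSmooth n)
    (ℓ : Module.Dual ℂ (ExteriorAlgebra ℂ (Fin n → ℂ))) :
    ContDiff ℝ ∞ fun z : Spt × Spt => ℓ (f z.1 * h z.2) := by
  induction hf using Submodule.span_induction with
  | zero => simpa using contDiff_const
  | add f₁ f₂ _ _ h₁ h₂ => simpa [add_mul] using h₁.add h₂
  | smul a f _ h => simpa using h.const_smul a
  | mem f hf =>
    obtain ⟨φ, hφ, e, rfl⟩ := hf
    induction hh using Submodule.span_induction with
    | zero => simpa using contDiff_const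
    | add f₁ f₂ _ _ h₁ h₂ => simpa [mul_add] using h₁.add h₂
    | smul a f _ h =>
      have := h.const_smul a
      simp only [Pi.smul_apply, mul_smul_comm, map_smul] 
      exact this
    | mem h hh =>
      obtain ⟨χ, hχ, d, rfl⟩ := hh
      simp only [smul_mul_smul_comm, map_smul, smul_eq_mul]
      exact ((hφ.comp contDiff_fst).mul (hχ.comp contDiff_snd)).mul contDiff_const

section Values

variable {ι κ : Type*} [Fintype ι] [DecidableEq ι] [Fintype κ] [DecidableEq κ]
  {G : DiracMatrices} {n : ℕ} (S : GluonSolution ι) (P : QuarkSolution κ G n) (Sm : Smearing)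

theorem contDiff_gluonValue (i : Boson ι) :
    ContDiff ℝ ∞ fun x => gluonValue S Sm.c Sm.b x i := by
  cases i with
  | F μ ν a => exact S.smooth a μ ν
  | A μ a => exact contDiff_potential S Sm.c_smooth Sm.c_supp a μ
  | w a => exact contDiff_wField S Sm.b_smooth Sm.b_supp a

theorem contDiff_quarkValue (q : Quark κ) (k : Fin n) :
    ContDiff ℝ ∞ fun x => quarkValue P x q k := by
  cases q with
  | psi α m => exact P.u_smooth α m k
  | bar α m => exact P.v_smooth α m k

theorem value_tmul (c : Spt → ℝ) (b : Fin 4 → Spt → ℝ) (x : Spt)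
    (p : MvPolynomial (Boson ι) ℂ) (q : ExteriorAlgebra ℂ (Quark κ → ℂ)) :
    value S P c b x (p ⊗ₜ[ℂ] q) =
      algebraMap ℂ _ (MvPolynomial.aeval (gluonValue S c b x) p) *
      ExteriorAlgebra.map (Fintype.linearCombination ℂ (quarkValue P x)) q :=
  Algebra.TensorProduct.lift_tmul
    ((Algebra.ofId ℂ (ExteriorAlgebra ℂ (Fin n → ℂ))).comp
      (MvPolynomial.aeval (gluonValue S c b x)))
    (ExteriorAlgebra.map (Fintype.linearCombination ℂ (quarkValue P x)))
    (fun p q => Algebra.commutes (MvPolynomial.aeval (gluonValue S c b x) p)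
      (ExteriorAlgebra.map (Fintype.linearCombination ℂ (quarkValue P x)) q)) p q

theorem value_bos (c : Spt → ℝ) (b : Fin 4 → Spt → ℝ) (x : Spt) (i : Boson ι) :
    value S P c b x (bos i) = algebraMap ℂ _ (gluonValue S c b x i) := by
  rw [bos, value_tmul]; simp

theorem value_quark (c : Spt → ℝ) (b : Fin 4 → Spt → ℝ) (x : Spt) (q : Quark κ) :
    value S P c b x (quark q) = ExteriorAlgebra.ι ℂ (quarkValue P x q) := by
  rw [quark, value_tmul]; simp

theorem map_sum_single_smul {M : Type*} [AddCommMonoid M] [Module ℂ M]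
    (T : (Fin n → ℂ) →ₗ[ℂ] M) (v : Fin n → ℂ) : ∑ k, v k • T (Pi.single k 1) = T v := by
  rw [← Finset.sum_congr rfl fun k _ => map_smul T (v k) (Pi.single k 1), ← map_sum]
  congr 1; ext k
  simp [Finset.sum_apply, Pi.single_apply]

theorem value_mem_grassmannSmooth (Y : Wick ι κ) :
    (fun x => value S P Sm.c Sm.b x Y) ∈ grassmannSmooth n := by
  induction Y using TensorProduct.induction_on with
  | zero => simp only [map_zero]; exact zero_mem _
  | add y₁ y₂ h₁ h₂ => simp only [map_add]; exact add_mem h₁ h₂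
  | tmul p q =>
    have hv : (fun x => value S P Sm.c Sm.b x (p ⊗ₜ[ℂ] q)) =
        (fun x => algebraMap ℂ _ (MvPolynomial.aeval (gluonValue S Sm.c Sm.b x) p)) *
        fun x => ExteriorAlgebra.map (Fintype.linearCombination ℂ (quarkValue P x)) q := by
      ext x; exact value_tmul S P _ _ x p q
    rw [hv]; clear hv
    refine mul_mem_grassmannSmooth (algebraMap_mem_grassmannSmooth ?_) ?_
    · induction p using MvPolynomial.induction_on with
      | C a => simpa using contDiff_const
      | add p q hp hq => simpa using hp.add hq
      | mul_X p i hp => simpa using hp.mul (contDiff_gluonValue S Sm i)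
    · induction q using ExteriorAlgebra.induction with
      | algebraMap r =>
        simpa using algebraMap_mem_grassmannSmooth (φ := fun _ => r) contDiff_const
      | add a b ha hb => simp only [map_add]; exact add_mem ha hb
      | mul a b ha hb => simp only [map_mul]; exact mul_mem_grassmannSmooth ha hb
      | ι v =>
        have : (fun x => ExteriorAlgebra.map (Fintype.linearCombination ℂ (quarkValue P x))
            (ExteriorAlgebra.ι ℂ v)) = ∑ q, ∑ k, fun x => (v q * quarkValue P x q k) •
              ExteriorAlgebra.ι ℂ (Pi.single k 1 : Fin n → ℂ) := by
          ext x
          simp only [ExteriorAlgebra.map_apply_ι, Fintype.linearCombination_apply, map_sum,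
            map_smul, Finset.sum_apply, mul_smul, ← Finset.smul_sum]
          refine Finset.sum_congr rfl fun q _ => ?_
          congr 1
          rw [← map_sum_single_smul]
        rw [this]
        exact sum_mem fun q _ => sum_mem fun k _ => smul_mem_grassmannSmooth
          (contDiff_const.mul (contDiff_quarkValue P q k)) _

end Values

section Obstructions

variable {ι κ : Type*} [Fintype ι] [DecidableEq ι] [Fintype κ] [DecidableEq κ]
  {G : DiracMatrices} {Sm : Smearing} {cF : ℂ} {n : ℕ}
  (S : GluonSolution ι) (P : QuarkSolution κ G n)
  (ℓ : Module.Dual ℂ (ExteriorAlgebra ℂ (Fin n → ℂ)))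

/-! ### Two-point fields -/

/-- The test function with which `:Y(x) X(x'): K(x,x')` tests the kernel `K`. -/
noncomputable def smear (Sm : Smearing) (Y X : Wick ι κ) (g : Spt × Spt → ℂ) : Spt × Spt → ℂ :=
  fun z => ℓ (value S P Sm.c Sm.b z.1 Y * value S P Sm.c Sm.b z.2 X) * g z

theorem bilocal_eq (Y X : Wick ι κ) (K : Kern) (g : Spt × Spt → ℂ) :
    bilocal S P Sm ℓ Y X K g = K (smear S P ℓ Sm Y X g) := rfl

theorem isTest_smear (Y X : Wick ι κ) {g : Spt × Spt → ℂ} (hg : IsTest g) :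
    IsTest (smear S P ℓ Sm Y X g) :=
  ⟨(contDiff_two_point (value_mem_grassmannSmooth S P Sm Y) (value_mem_grassmannSmooth S P Sm X)
    ℓ).mul hg.1, hg.2.mul_left⟩

/-- A two-point field is bilinear in the Wick polynomials. -/
noncomputable def bilin (Sm : Smearing) {K : Kern} (hK : K.IsLinear) {g : Spt × Spt → ℂ}
    (hg : IsTest g) :
    Wick ι κ →ₗ[ℂ] Wick ι κ →ₗ[ℂ] ℂ :=
  LinearMap.mk₂ ℂ (fun Y X => bilocal S P Sm ℓ Y X K g)
    (fun Y Y' X => by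
      simp only [bilocal_eq]
      rw [← hK.1 _ _ (isTest_smear S P ℓ Y X hg) (isTest_smear S P ℓ Y' X hg)]
      congr 1; ext z; simp [smear, add_mul])
    (fun t Y X => by
      simp only [bilocal_eq]
      rw [smul_eq_mul, ← hK.2 _ _ (isTest_smear S P ℓ Y X hg)]
      congr 1; ext z; simp [smear, mul_assoc])
    (fun Y X X' => by
      simp only [bilocal_eq]
      rw [← hK.1 _ _ (isTest_smear S P ℓ Y X hg) (isTest_smear S P ℓ Y X' hg)]
      congr 1; ext z; simp [smear, mul_add, add_mul])
    (fun t Y X => by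
      simp only [bilocal_eq]
      rw [smul_eq_mul, ← hK.2 _ _ (isTest_smear S P ℓ Y X hg)]
      congr 1; ext z; simp [smear, mul_assoc])

theorem bilin_apply {K : Kern} (hK : K.IsLinear) {g : Spt × Spt → ℂ} (hg : IsTest g)
    (Y X : Wick ι κ) : bilin S P ℓ Sm hK hg Y X = K (smear S P ℓ Sm Y X g) := rfl

theorem smear_congr_right {X X' : Wick ι κ} (h : ∀ x, value S P Sm.c Sm.b x X =
    value S P Sm.c Sm.b x X') (Y : Wick ι κ) (g : Spt × Spt → ℂ) :
    smear S P ℓ Sm Y X g = smear S P ℓ Sm Y X' g := by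
  ext z; rw [smear, smear, h]

/-- At coinciding points, a two-point field is a Wick product. -/
theorem delta_smear (Y X : Wick ι κ) (g : Spt × Spt → ℂ) :
    delta (smear S P ℓ Sm Y X g) = delta (smear S P ℓ Sm (Y * X) 1 g) := by
  simp [delta, smear]

variable (τ : TimeOrdering (ι := ι) (κ := κ) G Sm cF)

/-! ### Linearity of the obstruction map -/

theorem obs_add_left (Y Y' : Fin 4 → Wick ι κ) (X : Wick ι κ) {g : Spt × Spt → ℂ} (hg : IsTest g) :
    obs τ S P ℓ (fun μ => Y μ + Y' μ) X g = obs τ S P ℓ Y X g + obs τ S P ℓ Y' X g := by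
  simp only [obs, ← Finset.sum_add_distrib]
  refine Finset.sum_congr rfl fun μ _ => Finset.sum_congr rfl fun φ _ =>
    Finset.sum_congr rfl fun χ _ => ?_
  have := (bilin S P ℓ Sm (twoPoint_isLinear τ μ φ χ) hg).map_add₂ (dRight φ (Y μ))
    (dRight φ (Y' μ)) (dLeft χ X)
  rw [map_add]
  exact this

theorem obs_add_right (Y : Fin 4 → Wick ι κ) (X X' : Wick ι κ) {g : Spt × Spt → ℂ} (hg : IsTest g) :
    obs τ S P ℓ Y (X + X') g = obs τ S P ℓ Y X g + obs τ S P ℓ Y X' g := by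
  simp only [obs, ← Finset.sum_add_distrib]
  refine Finset.sum_congr rfl fun μ _ => Finset.sum_congr rfl fun φ _ =>
    Finset.sum_congr rfl fun χ _ => ?_
  rw [map_add]
  exact map_add (bilin S P ℓ Sm (twoPoint_isLinear τ μ φ χ) hg (dRight φ (Y μ))) _ _

theorem obs_eq_sum (Y : Fin 4 → Wick ι κ) (X : Wick ι κ) (g : Spt × Spt → ℂ) :
    obs τ S P ℓ Y X g = ∑ χ, ∑ φ, ∑ μ,
      twoPoint τ μ φ χ (smear S P ℓ Sm (dRight φ (Y μ)) (dLeft χ X) g) := by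
  rw [obs, Finset.sum_comm, Finset.sum_congr rfl fun φ _ => Finset.sum_comm, Finset.sum_comm]
  rfl

theorem smear_zero_right (Y : Wick ι κ) (g : Spt × Spt → ℂ) : smear S P ℓ Sm Y 0 g = 0 := by
  ext z; simp [smear]

theorem smear_zero_left (Y : Wick ι κ) (g : Spt × Spt → ℂ) : smear S P ℓ Sm 0 Y g = 0 := by
  ext z; simp [smear]

theorem Kern.IsLinear.map_zero {K : Kern} (hK : K.IsLinear) : K 0 = 0 := by
  simpa using hK.2 0 0 isTest_zero

theorem Kern.IsLinear.map_neg {K : Kern} (hK : K.IsLinear) {g : Spt × Spt → ℂ} (hg : IsTest g) :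
    K (-g) = -K g := by
  simpa using hK.2 (-1) g hg

theorem smear_smul_left (t : ℂ) (Y X : Wick ι κ) (g : Spt × Spt → ℂ) :
    smear S P ℓ Sm (t • Y) X g = t • smear S P ℓ Sm Y X g := by
  ext z; simp [smear, mul_assoc]

/-! ### The Yang-Mills current -/

/-- In the Wick algebra F_{μν} and F_{νμ} are independent generators; antisymmetry becomes available
only after evaluation on a solution. -/
theorem smear_br_F_antisymm (D : ColorData ι κ) (μ ν : Fin 4) (a : ι) (X : Wick ι κ)
    (g : Spt × Spt → ℂ) : smear S P ℓ Sm (br D (FF ν μ) ww a) X g =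
      -smear S P ℓ Sm (br D (FF μ ν) ww a) X g := by
  have h : ∀ x, value S P Sm.c Sm.b x (br D (FF ν μ) ww a) =
      -value S P Sm.c Sm.b x (br D (FF μ ν) ww a) := by
    intro x
    simp only [br, FF, map_sum, map_smul, map_mul, value_bos, gluonValue, S.antisymm _ μ ν x,
      map_neg, neg_mul, smul_neg, Finset.sum_neg_distrib]
  ext z
  simp [smear, h]

/-- The contribution of one field `χ` to the obstruction of `Q₁`. -/
theorem obs_Q1YM_field (D : ColorData ι κ) (χ : LinField ι κ) (X : Wick ι κ) {g : Spt × Spt → ℂ}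
    (hg : IsTest g) :
    ∑ φ, ∑ μ, twoPoint τ μ φ χ (smear S P ℓ Sm (dRight φ (Q1YM D μ)) X g) =
      ∑ ν, ∑ a, sgn ν * ∑ μ, sgn μ * twoPoint τ μ (.inl (.F μ ν a)) χ
        (smear S P ℓ Sm (br D ww (AA ν) a) X g) +
      (1 / 2 : ℂ) * ∑ μ, ∑ ν, ∑ a, sgn μ * sgn ν *
        (twoPoint τ μ (.inl (.A ν a)) χ (smear S P ℓ Sm (br D (FF μ ν) ww a) X g) -
          twoPoint τ ν (.inl (.A μ a)) χ (smear S P ℓ Sm (br D (FF μ ν) ww a) X g)) := by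
  have hlin := fun μ φ => twoPoint_isLinear τ μ φ χ
  have hq : ∀ q : Quark κ, ∑ μ, twoPoint τ μ (.inr q) χ
      (smear S P ℓ Sm (dRight (.inr q) (Q1YM D μ)) X g) = 0 := by
    intro q
    refine Finset.sum_eq_zero fun μ _ => ?_
    rw [dRight_inr_of_mem_bosonic q (Q1YM_mem_bosonic D μ), smear_zero_left, (hlin _ _).map_zero]
  have hF : ∀ ρ ν a, ∑ μ, twoPoint τ μ (.inl (.F ρ ν a)) χ
      (smear S P ℓ Sm (dRight (.inl (.F ρ ν a)) (Q1YM D μ)) X g) =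
      sgn ρ * sgn ν * twoPoint τ ρ (.inl (.F ρ ν a)) χ
        (smear S P ℓ Sm (br D ww (AA ν) a) X g) := by
    intro ρ ν a
    rw [Finset.sum_eq_single ρ]
    · rw [dRight_F_Q1YM, if_pos rfl, smear_smul_left,
        (hlin _ _).2 _ _ (isTest_smear S P ℓ _ _ hg)]
    · intro μ _ h
      rw [dRight_F_Q1YM, if_neg h.symm, smear_zero_left, (hlin _ _).map_zero]
    · simp
  have hA : ∀ ν a, ∑ μ, twoPoint τ μ (.inl (.A ν a)) χ
      (smear S P ℓ Sm (dRight (.inl (.A ν a)) (Q1YM D μ)) X g) =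
      ∑ μ, sgn μ * sgn ν * twoPoint τ μ (.inl (.A ν a)) χ
        (smear S P ℓ Sm (br D (FF μ ν) ww a) X g) := by
    intro ν a
    refine Finset.sum_congr rfl fun μ _ => ?_
    rw [dRight_A_Q1YM, smear_smul_left, (hlin _ _).2 _ _ (isTest_smear S P ℓ _ _ hg)]
  have hw : ∀ a, ∑ μ, twoPoint τ μ (.inl (.w a)) χ
      (smear S P ℓ Sm (dRight (.inl (.w a)) (Q1YM D μ)) X g) = 0 := fun a =>
    Finset.sum_eq_zero fun μ _ => twoPoint_w τ μ a χ (isTest_smear S P ℓ _ _ hg)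
  rw [Fintype.sum_sum_type, Finset.sum_eq_zero fun q _ => hq q, add_zero, sum_boson]
  simp only [hF, hA, hw, Finset.sum_const_zero, add_zero]
  congr 1
  · rw [Finset.sum_comm]
    refine Finset.sum_congr rfl fun ν _ => ?_
    rw [Finset.sum_comm]
    refine Finset.sum_congr rfl fun a _ => ?_
    rw [Finset.mul_sum]
    refine Finset.sum_congr rfl fun μ _ => ?_
    ring
  -- Since the coefficient i[F^{μν},w] is antisymmetric, the contraction sees half of the curl of
  -- `A`, and its obstruction is determined by the free equations.
  · set Z : Fin 4 → Fin 4 → ι → ℂ := fun μ ν a => sgn μ * sgn ν *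
      twoPoint τ μ (.inl (.A ν a)) χ (smear S P ℓ Sm (br D (FF μ ν) ww a) X g) with hZ
    have h1 : ∀ μ ν a, sgn μ * sgn ν *
        (twoPoint τ μ (.inl (.A ν a)) χ (smear S P ℓ Sm (br D (FF μ ν) ww a) X g) -
          twoPoint τ ν (.inl (.A μ a)) χ (smear S P ℓ Sm (br D (FF μ ν) ww a) X g)) =
        Z μ ν a + Z ν μ a := by
      intro μ ν a
      simp only [hZ]
      rw [smear_br_F_antisymm S P ℓ D μ ν, (hlin _ _).map_neg (isTest_smear S P ℓ _ _ hg)]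
      ring
    have h2 : ∑ ν, ∑ a, ∑ μ, Z μ ν a = ∑ μ, ∑ ν, ∑ a, Z μ ν a := by
      rw [Finset.sum_congr rfl fun ν _ => Finset.sum_comm, Finset.sum_comm]
    have h3 : ∑ μ, ∑ ν, ∑ a, Z ν μ a = ∑ μ, ∑ ν, ∑ a, Z μ ν a := Finset.sum_comm
    simp only [h1, Finset.sum_add_distrib, h3]
    rw [← h2]; ring

theorem sum_sgn_eta' (k : Fin 4) (X : Fin 4 → ℂ) : ∑ μ, sgn μ * (eta k μ * X μ) = X k := by
  rw [← sum_sgn_eta k X]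
  refine Finset.sum_congr rfl fun μ _ => ?_
  unfold eta
  by_cases h : k = μ
  · subst h; rfl
  · rw [if_neg h, if_neg (Ne.symm h)]

/-- The factor 1 + c_F stems from the divergence of `F`, the separate c_F from the curl of `A`. The
two terms of the latter are equal by antisymmetry of `F` and cancel the factor 1/2. -/
theorem obs_Q1YM_F (D : ColorData ι κ) (k l : Fin 4) (b : ι) (X : Wick ι κ) {g : Spt × Spt → ℂ}
    (hg : IsTest g) :
    ∑ φ, ∑ μ, twoPoint τ μ φ (.inl (.F k l b)) (smear S P ℓ Sm (dRight φ (Q1YM D μ)) X g) =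
      Complex.I * (1 + cF) * (delta (pdx l (smear S P ℓ Sm (br D ww (AA k) b) X g)) -
        delta (pdx k (smear S P ℓ Sm (br D ww (AA l) b) X g))) -
      cF * (Complex.I * delta (smear S P ℓ Sm (br D (FF k l) ww b) X g)) := by
  rw [obs_Q1YM_field S P ℓ τ D _ X hg]
  simp only [sum_twoPoint_F_F τ _ _ _ _ _ (isTest_smear S P ℓ _ _ hg),
    twoPoint_A_curl_F τ _ _ _ _ _ _ (isTest_smear S P ℓ _ _ hg), mul_ite, mul_zero,
    Finset.sum_ite_eq', Finset.mem_univ, if_true]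
  have h1 : ∀ (Z Z' : Fin 4 → ℂ), ∑ ν, sgn ν * (Complex.I * (1 + cF) *
      (eta ν k * Z ν - eta ν l * Z' ν)) = Complex.I * (1 + cF) * (Z k - Z' l) := by
    intro Z Z'
    rw [← sum_sgn_eta k Z, ← sum_sgn_eta l Z', ← Finset.sum_sub_distrib, Finset.mul_sum]
    exact Finset.sum_congr rfl fun ν _ => by ring
  have h2 : ∀ Z : Fin 4 → Fin 4 → ℂ, ∑ μ, ∑ ν, sgn μ * sgn ν *
      (-cF * (eta μ k * eta l ν - eta μ l * eta k ν) * (Complex.I * Z μ ν)) =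
      -cF * Complex.I * (Z k l - Z l k) := by
    intro Z
    have h3 : ∀ k l, ∑ μ, sgn μ * (eta μ k * ∑ ν, sgn ν * (eta l ν * Z μ ν)) = Z k l := by
      intro k l
      rw [sum_sgn_eta k fun μ => ∑ ν, sgn ν * (eta l ν * Z μ ν), sum_sgn_eta']
    rw [← h3 k l, ← h3 l k, ← Finset.sum_sub_distrib, Finset.mul_sum]
    refine Finset.sum_congr rfl fun μ _ => ?_
    simp only [Finset.mul_sum, ← Finset.sum_sub_distrib]
    exact Finset.sum_congr rfl fun ν _ => by ring
  rw [h1, h2 fun μ ν => delta (smear S P ℓ Sm (br D (FF μ ν) ww b) X g),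
    smear_br_F_antisymm S P ℓ D k l, delta_isLinear.map_neg (isTest_smear S P ℓ _ _ hg)]
  ring

theorem obs_Q1YM_A (D : ColorData ι κ) (k : Fin 4) (b : ι) (X : Wick ι κ) {g : Spt × Spt → ℂ}
    (hg : IsTest g) :
    ∑ φ, ∑ μ, twoPoint τ μ φ (.inl (.A k b)) (smear S P ℓ Sm (dRight φ (Q1YM D μ)) X g) =
      -Complex.I * (delta (smear S P ℓ Sm (br D ww (AA k) b) X g) +
        ∑ ν, strDelta' Sm.c ν (pdx k (smear S P ℓ Sm (br D ww (AA ν) b) X g))) := by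
  rw [obs_Q1YM_field S P ℓ τ D _ X hg]
  simp only [sum_twoPoint_F_A τ _ _ _ _ (isTest_smear S P ℓ _ _ hg),
    twoPoint_A_curl_A τ _ _ _ _ _ (isTest_smear S P ℓ _ _ hg), mul_ite, mul_zero,
    Finset.sum_ite_eq', Finset.mem_univ, if_true, Finset.sum_const_zero, add_zero]
  have h1 : ∀ (Z : Fin 4 → ℂ) (Y : Fin 4 → Fin 4 → ℂ), ∑ ν, sgn ν * (-Complex.I *
      (eta ν k * Z ν + ∑ l, eta ν l * Y l ν)) = -Complex.I * (Z k + ∑ l, Y l l) := by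
    intro Z Y
    rw [← sum_sgn_eta k Z, ← Finset.sum_congr rfl fun l _ => sum_sgn_eta l (Y l),
      Finset.sum_comm (f := fun l ν => sgn ν * (eta ν l * Y l ν)), ← Finset.sum_add_distrib,
      Finset.mul_sum]
    refine Finset.sum_congr rfl fun ν _ => ?_
    simp only [← Finset.mul_sum]
    ring
  exact h1 (fun ν => delta (smear S P ℓ Sm (br D ww (AA ν) b) X g))
    fun l ν => strDelta' Sm.c l (pdx k (smear S P ℓ Sm (br D ww (AA ν) b) X g))

theorem obs_Q1YM_quark (D : ColorData ι κ) (q : Quark κ) (X : Wick ι κ) {g : Spt × Spt → ℂ}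
    (hg : IsTest g) :
    ∑ φ, ∑ μ, twoPoint τ μ φ (.inr q) (smear S P ℓ Sm (dRight φ (Q1YM D μ)) X g) = 0 := by
  rw [obs_Q1YM_field S P ℓ τ D _ X hg]
  simp only [sum_twoPoint_F_quark τ _ _ _ (isTest_smear S P ℓ _ _ hg),
    twoPoint_A_curl_quark τ _ _ _ _ (isTest_smear S P ℓ _ _ hg), mul_zero, Finset.sum_const_zero,
    add_zero]

/-- The obstruction of `Q_{1,YM}` with a Wick polynomial that does not contain `w`. -/
theorem obs_Q1YM (D : ColorData ι κ) {X : Wick ι κ} (hX : ∀ a, dLeft (.inl (.w a)) X = 0)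
    {g : Spt × Spt → ℂ} (hg : IsTest g) :
    obs τ S P ℓ (Q1YM D) X g = ∑ k, ∑ l, ∑ b, (Complex.I * (1 + cF) *
        (delta (pdx l (smear S P ℓ Sm (br D ww (AA k) b) (dLeft (.inl (.F k l b)) X) g)) -
        delta (pdx k (smear S P ℓ Sm (br D ww (AA l) b) (dLeft (.inl (.F k l b)) X) g))) -
        cF * (Complex.I * delta
          (smear S P ℓ Sm (br D (FF k l) ww b) (dLeft (.inl (.F k l b)) X) g))) +
      ∑ k, ∑ b, -Complex.I *
        (delta (smear S P ℓ Sm (br D ww (AA k) b) (dLeft (.inl (.A k b)) X) g) +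
        ∑ ν, strDelta' Sm.c ν
          (pdx k (smear S P ℓ Sm (br D ww (AA ν) b) (dLeft (.inl (.A k b)) X) g))) := by
  rw [obs_eq_sum, Fintype.sum_sum_type,
    Finset.sum_eq_zero fun q _ => obs_Q1YM_quark S P ℓ τ D q _ hg, add_zero, sum_boson]
  simp only [obs_Q1YM_F S P ℓ τ D _ _ _ _ hg, obs_Q1YM_A S P ℓ τ D _ _ _ hg, hX,
    smear_zero_right, (twoPoint_isLinear τ _ _ _).map_zero, Finset.sum_const_zero, add_zero]

/-- The quark-gluon cross-term. -/
theorem obs_Q1YM_L1min (D : ColorData ι κ) {g : Spt × Spt → ℂ} (hg : IsTest g) :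
    obs τ S P ℓ (Q1YM D) (L1min D G) g = ∑ k, ∑ b, -Complex.I *
        (delta (smear S P ℓ Sm (br D ww (AA k) b) (cur D G k b) g) +
        ∑ ν, strDelta' Sm.c ν (pdx k (smear S P ℓ Sm (br D ww (AA ν) b) (cur D G k b) g))) := by
  rw [obs_Q1YM S P ℓ τ D (dLeft_w_L1min D G) hg]
  have h0 : ∀ k, pdx k 0 = 0 := fun k => by ext z; simp [pdx]
  simp only [dLeft_F_L1min, dLeft_A_L1min, smear_zero_right, h0, delta_isLinear.map_zero,
    mul_zero, sub_zero, Finset.sum_const_zero, zero_add]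

/-! ### The quark current -/

/-- The sums are arranged so that the obstructions appear as `γ^μ` contracted with O_μ(ψ,·) and
O_μ(ψ̄,·), the combinations that the Dirac equation determines. -/
theorem obs_Q1min_field (D : ColorData ι κ) (χ : LinField ι κ) (X : Wick ι κ) {g : Spt × Spt → ℂ}
    (hg : IsTest g) :
    ∑ φ, ∑ μ, twoPoint τ μ φ χ (smear S P ℓ Sm (dRight φ (Q1min D G μ)) X g) =
      ∑ a, ∑ α, ∑ m, ∑ n, D.rep a m n * ∑ μ, ∑ β, G.γ μ α β * twoPoint τ μ (.inr (.psi β n)) χ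
        (smear S P ℓ Sm (bos (.w a) * quark (.bar α m)) X g) +
      ∑ a, ∑ β, ∑ m, ∑ n, D.rep a m n * ∑ μ, ∑ α, G.γ μ α β * twoPoint τ μ (.inr (.bar α m)) χ
        (smear S P ℓ Sm (-(bos (.w a) * quark (.psi β n))) X g) := by
  have hlin := fun μ φ => twoPoint_isLinear τ μ φ χ
  have hF : ∀ i : Boson ι, ∑ μ, twoPoint τ μ (.inl i) χ
      (smear S P ℓ Sm (dRight (.inl i) (Q1min D G μ)) X g) = 0 := by
    intro i
    refine Finset.sum_eq_zero fun μ _ => ?_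
    cases i with
    | F k l a => rw [dRight_F_Q1min, smear_zero_left, (hlin _ _).map_zero]
    | A k a => rw [dRight_A_Q1min, smear_zero_left, (hlin _ _).map_zero]
    | w a => exact twoPoint_w τ μ a χ (isTest_smear S P ℓ _ _ hg)
  have hpsi : ∀ β n μ, twoPoint τ μ (.inr (.psi β n)) χ
      (smear S P ℓ Sm (dRight (.inr (.psi β n)) (Q1min D G μ)) X g) =
      ∑ a, ∑ α, ∑ m, G.γ μ α β * D.rep a m n * twoPoint τ μ (.inr (.psi β n)) χ
        (smear S P ℓ Sm (bos (.w a) * quark (.bar α m)) X g) := by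
    intro β n μ
    rw [dRight_psi_Q1min, ← bilin_apply S P ℓ (hlin μ _) hg]
    simp only [map_sum, map_smul, LinearMap.sum_apply, LinearMap.smul_apply, smul_eq_mul]
    rfl
  have hbar : ∀ α m μ, twoPoint τ μ (.inr (.bar α m)) χ
      (smear S P ℓ Sm (dRight (.inr (.bar α m)) (Q1min D G μ)) X g) =
      ∑ a, ∑ β, ∑ n, G.γ μ α β * D.rep a m n * twoPoint τ μ (.inr (.bar α m)) χ
        (smear S P ℓ Sm (-(bos (.w a) * quark (.psi β n))) X g) := by
    intro α m μ
    rw [dRight_bar_Q1min, ← bilin_apply S P ℓ (hlin μ _) hg]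
    simp only [map_sum, map_smul, LinearMap.sum_apply, LinearMap.smul_apply, smul_eq_mul]
    rfl
  rw [Fintype.sum_sum_type, Finset.sum_eq_zero fun i _ => hF i, zero_add, sum_quark]
  simp only [hpsi, hbar, Finset.mul_sum]
  congr 1
  -- The six nested sums are permuted by a bijection of the product index types.
  · calc
      _ = ∑ x : (((((Fin 4 × κ) × Fin 4) × ι) × Fin 4) × κ), G.γ x.1.1.1.2 x.1.2 x.1.1.1.1.1 *
          D.rep x.1.1.2 x.2 x.1.1.1.1.2 *
          twoPoint τ x.1.1.1.2 (.inr (.psi x.1.1.1.1.1 x.1.1.1.1.2)) χ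
            (smear S P ℓ Sm (bos (.w x.1.1.2) * quark (.bar x.1.2 x.2)) X g) := by
        simp only [Fintype.sum_prod_type]
      _ = ∑ y : (((((ι × Fin 4) × κ) × κ) × Fin 4) × Fin 4), D.rep y.1.1.1.1.1 y.1.1.1.2 y.1.1.2 *
          (G.γ y.1.2 y.1.1.1.1.2 y.2 * twoPoint τ y.1.2 (.inr (.psi y.2 y.1.1.2)) χ
            (smear S P ℓ Sm (bos (.w y.1.1.1.1.1) * quark (.bar y.1.1.1.1.2 y.1.1.1.2)) X g)) := by
        refine Fintype.sum_equiv
          ⟨fun x => (((((x.1.1.2, x.1.2), x.2), x.1.1.1.1.2), x.1.1.1.2), x.1.1.1.1.1),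
            fun y => (((((y.2, y.1.1.2), y.1.2), y.1.1.1.1.1), y.1.1.1.1.2), y.1.1.1.2),
            fun x => rfl, fun y => rfl⟩ _ _ fun x => ?_
        simp only [Equiv.coe_fn_mk]
        ring
      _ = _ := by simp only [Fintype.sum_prod_type]
  · calc
      _ = ∑ x : (((((Fin 4 × κ) × Fin 4) × ι) × Fin 4) × κ), G.γ x.1.1.1.2 x.1.1.1.1.1 x.1.2 *
          D.rep x.1.1.2 x.1.1.1.1.2 x.2 *
          twoPoint τ x.1.1.1.2 (.inr (.bar x.1.1.1.1.1 x.1.1.1.1.2)) χ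
            (smear S P ℓ Sm (-(bos (.w x.1.1.2) * quark (.psi x.1.2 x.2))) X g) := by
        simp only [Fintype.sum_prod_type]
      _ = ∑ y : (((((ι × Fin 4) × κ) × κ) × Fin 4) × Fin 4), D.rep y.1.1.1.1.1 y.1.1.1.2 y.1.1.2 *
          (G.γ y.1.2 y.2 y.1.1.1.1.2 * twoPoint τ y.1.2 (.inr (.bar y.2 y.1.1.1.2)) χ
            (smear S P ℓ Sm (-(bos (.w y.1.1.1.1.1) * quark (.psi y.1.1.1.1.2 y.1.1.2))) X g)) := by
        refine Fintype.sum_equiv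
          ⟨fun x => (((((x.1.1.2, x.1.2), x.1.1.1.1.2), x.2), x.1.1.1.2), x.1.1.1.1.1),
            fun y => (((((y.2, y.1.1.1.2), y.1.2), y.1.1.1.1.1), y.1.1.1.1.2), y.1.1.2),
            fun x => rfl, fun y => rfl⟩ _ _ fun x => ?_
        simp only [Equiv.coe_fn_mk]
        ring
      _ = _ := by simp only [Fintype.sum_prod_type]

theorem obs_Q1min_bar (D : ColorData ι κ) (ρ : Fin 4) (p : κ) (X : Wick ι κ) {g : Spt × Spt → ℂ}
    (hg : IsTest g) :
    ∑ φ, ∑ μ, twoPoint τ μ φ (.inr (.bar ρ p)) (smear S P ℓ Sm (dRight φ (Q1min D G μ)) X g) =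
      -∑ a, ∑ m, D.rep a m p * delta (smear S P ℓ Sm (bos (.w a) * quark (.bar ρ m)) X g) := by
  rw [obs_Q1min_field S P ℓ τ D _ X hg]
  simp only [sum_twoPoint_psi_bar τ _ _ _ _ (isTest_smear S P ℓ _ _ hg),
    sum_twoPoint_bar_zero τ _ _ (.inr (.bar ρ p)) (by simp) (isTest_smear S P ℓ _ _ hg),
    mul_zero, Finset.sum_const_zero, add_zero, ← Finset.sum_neg_distrib]
  refine Finset.sum_congr rfl fun a _ => ?_
  rw [Finset.sum_eq_single ρ]
  · refine Finset.sum_congr rfl fun m _ => ?_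
    rw [Finset.sum_eq_single p]
    · simp
    · intro b _ h; simp [h]
    · simp
  · intro b _ h; simp [h]
  · simp

theorem obs_Q1min_psi (D : ColorData ι κ) (ρ : Fin 4) (p : κ) (X : Wick ι κ) {g : Spt × Spt → ℂ}
    (hg : IsTest g) :
    ∑ φ, ∑ μ, twoPoint τ μ φ (.inr (.psi ρ p)) (smear S P ℓ Sm (dRight φ (Q1min D G μ)) X g) =
      -∑ a, ∑ n, D.rep a p n * delta (smear S P ℓ Sm (-(bos (.w a) * quark (.psi ρ n))) X g) := by
  rw [obs_Q1min_field S P ℓ τ D _ X hg]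
  simp only [sum_twoPoint_bar_psi τ _ _ _ _ (isTest_smear S P ℓ _ _ hg),
    sum_twoPoint_psi_zero τ _ _ (.inr (.psi ρ p)) (by simp) (isTest_smear S P ℓ _ _ hg),
    mul_zero, Finset.sum_const_zero, zero_add, ← Finset.sum_neg_distrib]
  refine Finset.sum_congr rfl fun a _ => ?_
  rw [Finset.sum_eq_single ρ]
  · rw [Finset.sum_eq_single p]
    · simp
    · intro b _ h; simp [h]
    · simp
  · intro b _ h; simp [h.symm]
  · simp

theorem obs_Q1min_boson (D : ColorData ι κ) (i : Boson ι) (X : Wick ι κ) {g : Spt × Spt → ℂ}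
    (hg : IsTest g) :
    ∑ φ, ∑ μ, twoPoint τ μ φ (.inl i) (smear S P ℓ Sm (dRight φ (Q1min D G μ)) X g) = 0 := by
  rw [obs_Q1min_field S P ℓ τ D _ X hg]
  simp only [sum_twoPoint_bar_zero τ _ _ (.inl i) (by simp) (isTest_smear S P ℓ _ _ hg),
    sum_twoPoint_psi_zero τ _ _ (.inl i) (by simp) (isTest_smear S P ℓ _ _ hg),
    mul_zero, Finset.sum_const_zero, add_zero]

theorem obs_Q1min (D : ColorData ι κ) (X : Wick ι κ) {g : Spt × Spt → ℂ} (hg : IsTest g) :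
    obs τ S P ℓ (Q1min D G) X g =
      ∑ ρ, ∑ p, (-∑ a, ∑ n, D.rep a p n *
        delta (smear S P ℓ Sm (-(bos (.w a) * quark (.psi ρ n))) (dLeft (.inr (.psi ρ p)) X) g)) +
      ∑ ρ, ∑ p, -∑ a, ∑ m, D.rep a m p *
        delta (smear S P ℓ Sm (bos (.w a) * quark (.bar ρ m)) (dLeft (.inr (.bar ρ p)) X) g) := by
  rw [obs_eq_sum, Fintype.sum_sum_type,
    Finset.sum_eq_zero fun i _ => obs_Q1min_boson S P ℓ τ D i _ hg, zero_add, sum_quark]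
  simp only [obs_Q1min_psi S P ℓ τ D _ _ _ hg, obs_Q1min_bar S P ℓ τ D _ _ _ hg]

/-- Only contractions of a quark with a quark contribute for `Q_{1,min}`, and `L_{1,YM}` contains no
quarks. -/
theorem obs_Q1min_L1YM (D : ColorData ι κ) {g : Spt × Spt → ℂ} (hg : IsTest g) :
    obs τ S P ℓ (Q1min D G) (L1YM D) g = 0 := by
  rw [obs_Q1min S P ℓ τ D _ hg]
  simp only [dLeft_inr_of_mem_bosonic _ (L1YM_mem_bosonic D), smear_zero_right,
    delta_isLinear.map_zero, mul_zero, Finset.sum_const_zero, neg_zero, add_zero]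

end Obstructions

/-! ### Reordering of sums -/

section Reorder

variable {A B C M : Type*} [Fintype A] [Fintype B] [Fintype C] [AddCommMonoid M]

theorem sum_reorder_psi (f : A → B → C → B → A → C → A → B → M) :
    ∑ r, ∑ p, ∑ a, ∑ q, ∑ m, ∑ b, ∑ α, ∑ n, f r p a q m b α n =
      ∑ m, ∑ a, ∑ b, ∑ α, ∑ r, ∑ n, ∑ q, ∑ p, f r p a q m b α n := by
  calc
    _ = ∑ y : ((((((A × B) × C) × B) × A) × C) × A) × B,
        f y.1.1.1.1.1.1.1 y.1.1.1.1.1.1.2 y.1.1.1.1.1.2 y.1.1.1.1.2 y.1.1.1.2 y.1.1.2 y.1.2 y.2 := by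
      simp only [Fintype.sum_prod_type]
    _ = ∑ y : ((((((A × C) × C) × A) × A) × B) × B) × B,
        f y.1.1.1.2 y.2 y.1.1.1.1.1.1.2 y.1.2 y.1.1.1.1.1.1.1 y.1.1.1.1.1.2 y.1.1.1.1.2 y.1.1.2 :=
      Fintype.sum_equiv
        ⟨fun y => (((((((y.1.1.1.2, y.1.1.1.1.1.2), y.1.1.2), y.1.2), y.1.1.1.1.1.1.1), y.2),
            y.1.1.1.1.2), y.1.1.1.1.1.1.2),
          fun y => (((((((y.1.1.1.2, y.2), y.1.1.1.1.1.1.2), y.1.2), y.1.1.1.1.1.1.1),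
            y.1.1.1.1.1.2), y.1.1.1.1.2), y.1.1.2), fun _ => rfl, fun _ => rfl⟩ _ _ fun _ => rfl
    _ = _ := by simp only [Fintype.sum_prod_type]

theorem sum_reorder_bar (f : A → B → C → B → A → C → A → B → M) :
    ∑ r, ∑ p, ∑ a, ∑ n, ∑ m, ∑ b, ∑ β, ∑ q, f r p a n m b β q =
      ∑ m, ∑ a, ∑ b, ∑ r, ∑ β, ∑ n, ∑ q, ∑ p, f r p a n m b β q := by
  rw [sum_reorder_psi fun r p a n m b β q => f r p a n m b β q]
  refine Finset.sum_congr rfl fun m _ => Finset.sum_congr rfl fun a _ =>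
    Finset.sum_congr rfl fun b _ => ?_
  rw [Finset.sum_comm]
  exact Finset.sum_congr rfl fun r _ => Finset.sum_congr rfl fun β _ => Finset.sum_comm

theorem sum_reorder_cur {N : Type*} [Fintype N] (f : A → A → A → B → B → N → N → M) :
    ∑ μ, ∑ α, ∑ β, ∑ m, ∑ p, ∑ i, ∑ j, f μ α β m p i j =
      ∑ m, ∑ p, ∑ i, ∑ j, ∑ μ, ∑ α, ∑ β, f μ α β m p i j := by
  calc
    _ = ∑ x : (A × A) × A, ∑ y : ((B × B) × N) × N,
        f x.1.1 x.1.2 x.2 y.1.1.1 y.1.1.2 y.1.2 y.2 := by simp only [Fintype.sum_prod_type]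
    _ = _ := by rw [Finset.sum_comm]; simp only [Fintype.sum_prod_type]

theorem sum_reorder_color (f : C → C → C → A → A → B → B → M) :
    ∑ a, ∑ b, ∑ α, ∑ β, ∑ m, ∑ q, ∑ c, f c a b α β m q =
      ∑ c, ∑ a, ∑ b, ∑ α, ∑ β, ∑ m, ∑ q, f c a b α β m q := by
  calc
    _ = ∑ y : ((((C × C) × A) × A) × B) × B, ∑ c,
        f c y.1.1.1.1.1 y.1.1.1.1.2 y.1.1.1.2 y.1.1.2 y.1.2 y.2 := by
      simp only [Fintype.sum_prod_type]
    _ = _ := by rw [Finset.sum_comm]; simp only [Fintype.sum_prod_type]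

end Reorder

/-! ### Partial derivatives -/

theorem pd_mul {f h : Spt → ℂ} (hf : ContDiff ℝ ∞ f) (hh : ContDiff ℝ ∞ h) (μ : Fin 4) (x : Spt) :
    pd μ (fun x => f x * h x) x = pd μ f x * h x + f x * pd μ h x := by
  rw [pd, fderiv_fun_mul (hf.differentiable (by simp) x) (hh.differentiable (by simp) x)]
  simp [pd]; ring

theorem pd_const_mul {f : Spt → ℂ} (hf : ContDiff ℝ ∞ f) (t : ℂ) (μ : Fin 4) (x : Spt) :
    pd μ (fun x => t * f x) x = t * pd μ f x := by
  rw [pd, fderiv_const_mul (hf.differentiable (by simp) x)]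
  simp [pd]

theorem pd_mul_const {f : Spt → ℂ} (hf : ContDiff ℝ ∞ f) (t : ℂ) (μ : Fin 4) (x : Spt) :
    pd μ (fun x => f x * t) x = pd μ f x * t := by
  simp_rw [mul_comm _ t]; exact pd_const_mul hf t μ x

theorem pd_sum {α : Type*} {s : Finset α} {f : α → Spt → ℂ} (hf : ∀ i ∈ s, ContDiff ℝ ∞ (f i))
    (μ : Fin 4) (x : Spt) : pd μ (fun x => ∑ i ∈ s, f i x) x = ∑ i ∈ s, pd μ (f i) x := by
  rw [pd, fderiv_fun_sum fun i hi => (hf i hi).differentiable (by simp) x, _root_.sum_apply]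
  rfl

theorem pdx_eq_pd {f : Spt × Spt → ℂ} (hf : ContDiff ℝ ∞ f) (μ : Fin 4) (z : Spt × Spt) :
    pdx μ f z = pd μ (fun x => f (x, z.2)) z.1 := by
  have h1 : HasFDerivAt (fun x : Spt => (x, z.2)) (ContinuousLinearMap.inl ℝ Spt Spt) z.1 :=
    hasFDerivAt_prodMk_left z.1 z.2
  have h2 := ((hf.differentiable (by simp)) z).hasFDerivAt.comp z.1 h1
  rw [pd, show (fun x => f (x, z.2)) = f ∘ fun x => (x, z.2) from rfl, h2.fderiv]
  simp [pdx]

theorem pdx_mul {f g : Spt × Spt → ℂ} (hf : ContDiff ℝ ∞ f) (hg : ContDiff ℝ ∞ g) (μ : Fin 4)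
    (z : Spt × Spt) : pdx μ (fun z => f z * g z) z = pdx μ f z * g z + f z * pdx μ g z := by
  rw [pdx, fderiv_fun_mul (hf.differentiable (by simp) z) (hg.differentiable (by simp) z)]
  simp [pdx]; ring

/-! ### Conserved currents, the string-localized terms and the lock-key identity -/

section Obstructions

variable {ι κ : Type*} [Fintype ι] [DecidableEq ι] [Fintype κ] [DecidableEq κ]
  {G : DiracMatrices} {Sm : Smearing} {cF : ℂ} {n : ℕ}
  (S : GluonSolution ι) (P : QuarkSolution κ G n)
  (ℓ : Module.Dual ℂ (ExteriorAlgebra ℂ (Fin n → ℂ)))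

theorem pdx_smear (Y X : Wick ι κ) {g : Spt × Spt → ℂ} (hg : IsTest g) (k : Fin 4)
    (z : Spt × Spt) : pdx k (smear S P ℓ Sm Y X g) z =
      pd k (fun x => ℓ (value S P Sm.c Sm.b x Y * value S P Sm.c Sm.b z.2 X)) z.1 * g z +
      smear S P ℓ Sm Y X (pdx k g) z := by
  have h := contDiff_two_point (value_mem_grassmannSmooth S P Sm Y)
    (value_mem_grassmannSmooth S P Sm X) ℓ
  unfold smear
  rw [pdx_mul h hg.1, pdx_eq_pd h]

/-- Gluon fields have commuting values. -/
theorem value_of_mem_bosonic {Y : Wick ι κ} (hY : Y ∈ bosonic ι κ) (c : Spt → ℝ)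
    (b : Fin 4 → Spt → ℝ) (x : Spt) : ∃ r, value S P c b x Y = algebraMap ℂ _ r := by
  obtain ⟨p, rfl⟩ := hY
  exact ⟨MvPolynomial.aeval (gluonValue S c b x) p, by
    simpa using value_tmul S P c b x p (1 : ExteriorAlgebra ℂ (Quark κ → ℂ))⟩

theorem br_ww_AA_mem_bosonic (D : ColorData ι κ) (ν : Fin 4) (a : ι) :
    br D ww (AA ν) a ∈ bosonic ι κ :=
  br_mem_bosonic D (fun _ => bos_mem_bosonic _) (fun _ => bos_mem_bosonic _) a

theorem swap_smear {Y : Wick ι κ} (hY : Y ∈ bosonic ι κ) (X : Wick ι κ) (g : Spt × Spt → ℂ) :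
    (fun z : Spt × Spt => smear S P ℓ Sm Y X g (z.2, z.1)) =
      smear S P ℓ Sm X Y fun z => g (z.2, z.1) := by
  ext z
  obtain ⟨r, hr⟩ := value_of_mem_bosonic S P hY Sm.c Sm.b z.2
  simp only [smear, hr, Algebra.commutes]

/-- A Lie-algebra valued conserved current. -/
def IsConserved (Sm : Smearing) (X : Fin 4 → ι → Wick ι κ) : Prop :=
  ∀ (m : Module.Dual ℂ (ExteriorAlgebra ℂ (Fin n → ℂ))) a x,
    ∑ k, pd k (fun x => m (value S P Sm.c Sm.b x (X k a))) x = 0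

/-- The nonlocal part of the obstruction is a derivative of a string-localized field. -/
theorem sum_strDelta'_smear (D : ColorData ι κ) {X : Fin 4 → ι → Wick ι κ}
    (hX : IsConserved S P Sm X) {g : Spt × Spt → ℂ} (hg : IsTest g) :
    ∑ k, ∑ b, ∑ ν, strDelta' Sm.c ν (pdx k (smear S P ℓ Sm (br D ww (AA ν) b) (X k b) g)) =
      -∑ k, pairW2 D S P Sm ℓ (X k) (pdx k fun z => g (z.2, z.1)) := by
  have hlin := fun ν => strDelta_isLinear Sm.c_smooth Sm.c_supp ν
  -- The exchange of x and x' turns I' into I and ∂ into ∂'. A string delta depends only on the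
  -- difference of the points, so ∂' may be replaced by -∂.
  have h1 : ∀ k b ν, strDelta' Sm.c ν (pdx k (smear S P ℓ Sm (br D ww (AA ν) b) (X k b) g)) =
      -strDelta Sm.c ν (pdx k (smear S P ℓ Sm (X k b) (br D ww (AA ν) b)
        fun z => g (z.2, z.1))) := by
    intro k b ν
    rw [strDelta'_eq_swap, swap_pdx, swap_smear S P ℓ (br_ww_AA_mem_bosonic D ν b),
      strDelta_pdx' _ _ (isTest_smear S P ℓ _ _ hg.swap)]
  -- The current now sits at `x`, where the derivative acts. The terms with its divergence add up to
  -- zero by conservation, applied to the functional that multiplies by the fixed value at `x'`; the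
  -- derivative is left on the test function.
  have h2 : ∀ b ν, ∑ k, strDelta Sm.c ν (pdx k (smear S P ℓ Sm (X k b) (br D ww (AA ν) b)
        fun z => g (z.2, z.1))) = ∑ k, strDelta Sm.c ν (smear S P ℓ Sm (X k b)
        (br D ww (AA ν) b) (pdx k fun z => g (z.2, z.1))) := by
    intro b ν
    rw [← (hlin ν).sum _ fun k _ => (isTest_smear S P ℓ _ _ hg.swap).pdx k,
      ← (hlin ν).sum _ fun k _ => isTest_smear S P ℓ _ _ (hg.swap.pdx k)]
    congr 1; ext z
    simp only [pdx_smear S P ℓ _ _ hg.swap, Finset.sum_add_distrib, ← Finset.sum_mul]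
    have := hX (ℓ ∘ₗ LinearMap.mulRight ℂ (value S P Sm.c Sm.b z.2 (br D ww (AA ν) b))) b z.1
    simp only [LinearMap.comp_apply, LinearMap.mulRight_apply] at this
    rw [this, zero_mul, zero_add]
  simp only [h1, Finset.sum_neg_distrib, neg_inj, pairW2, bilocal_eq]
  rw [Finset.sum_comm, Finset.sum_congr rfl fun b _ => Finset.sum_comm,
    Finset.sum_congr rfl fun b _ => Finset.sum_congr rfl fun ν _ => h2 b ν,
    Finset.sum_congr rfl fun b _ => Finset.sum_comm, Finset.sum_comm]

/-- The quark current is conserved. -/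
theorem isConserved_cur (D : ColorData ι κ) : IsConserved S P Sm (cur D G) := by
  intro M a x
  set t : Fin n → Fin n → ℂ := fun i j => M (ExteriorAlgebra.ι ℂ (Pi.single i 1) *
    ExteriorAlgebra.ι ℂ (Pi.single j 1)) with ht
  -- Expansion in products of two Grassmann generators leaves scalar functions, to which the product
  -- rule and the Dirac equations apply.
  have h1 : ∀ μ y, M (value S P Sm.c Sm.b y (cur D G μ a)) = ∑ α, ∑ β, ∑ m, ∑ p, ∑ i, ∑ j,
      G.γ μ α β * D.rep a m p * t i j * (P.v α m i y * P.u β p j y) := by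
    intro μ y
    simp only [cur, map_sum, map_smul, map_mul, value_quark, quarkValue]
    refine Finset.sum_congr rfl fun α _ => Finset.sum_congr rfl fun β _ =>
      Finset.sum_congr rfl fun m _ => Finset.sum_congr rfl fun p _ => ?_
    rw [← map_sum_single_smul (ExteriorAlgebra.ι ℂ) fun k => P.v α m k y,
      ← map_sum_single_smul (ExteriorAlgebra.ι ℂ) fun k => P.u β p k y, Finset.sum_mul_sum,
      map_sum, smul_eq_mul, Finset.mul_sum]
    refine Finset.sum_congr rfl fun i _ => ?_
    rw [map_sum, Finset.mul_sum]
    refine Finset.sum_congr rfl fun j _ => ?_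
    rw [smul_mul_smul_comm, map_smul, smul_eq_mul, ht]
    ring
  have hs : ∀ α β m p i j, ContDiff ℝ ∞ fun y => P.v α m i y * P.u β p j y :=
    fun α β m p i j => (P.v_smooth α m i).mul (P.u_smooth β p j)
  have h2 : ∀ μ, pd μ (fun y => M (value S P Sm.c Sm.b y (cur D G μ a))) x =
      ∑ α, ∑ β, ∑ m, ∑ p, ∑ i, ∑ j, G.γ μ α β * D.rep a m p * t i j *
        (pd μ (P.v α m i) x * P.u β p j x + P.v α m i x * pd μ (P.u β p j) x) := by
    intro μ
    simp only [h1]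
    rw [pd_sum fun α _ => by fun_prop]
    refine Finset.sum_congr rfl fun α _ => ?_
    rw [pd_sum fun β _ => by fun_prop]
    refine Finset.sum_congr rfl fun β _ => ?_
    rw [pd_sum fun m _ => by fun_prop]
    refine Finset.sum_congr rfl fun m _ => ?_
    rw [pd_sum fun p _ => by fun_prop]
    refine Finset.sum_congr rfl fun p _ => ?_
    rw [pd_sum fun i _ => by fun_prop]
    refine Finset.sum_congr rfl fun i _ => ?_
    rw [pd_sum fun j _ => by fun_prop]
    refine Finset.sum_congr rfl fun j _ => ?_
    rw [pd_const_mul (hs α β m p i j), pd_mul (P.v_smooth α m i) (P.u_smooth β p j)]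
  have h3 : ∀ m p i j, ∑ μ, ∑ α, ∑ β, G.γ μ α β * D.rep a m p * t i j *
        (pd μ (P.v α m i) x * P.u β p j x + P.v α m i x * pd μ (P.u β p j) x) = 0 := by
    intro m p i j
    have e1 : ∑ β, (∑ μ, ∑ α, pd μ (P.v α m i) x * G.γ μ α β) * P.u β p j x = 0 :=
      Finset.sum_eq_zero fun β _ => by rw [P.dirac_bar, zero_mul]
    have e2 : ∑ α, P.v α m i x * (∑ μ, ∑ β, G.γ μ α β * pd μ (P.u β p j) x) = 0 :=
      Finset.sum_eq_zero fun α _ => by rw [P.dirac, mul_zero]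
    have e3 : ∑ μ, ∑ α, ∑ β, G.γ μ α β * D.rep a m p * t i j *
        (pd μ (P.v α m i) x * P.u β p j x + P.v α m i x * pd μ (P.u β p j) x) =
        D.rep a m p * t i j *
        (∑ β, (∑ μ, ∑ α, pd μ (P.v α m i) x * G.γ μ α β) * P.u β p j x +
        ∑ α, P.v α m i x * (∑ μ, ∑ β, G.γ μ α β * pd μ (P.u β p j) x)) := by
      have e4 : ∑ β, (∑ μ, ∑ α, pd μ (P.v α m i) x * G.γ μ α β) * P.u β p j x =
          ∑ μ, ∑ α, ∑ β, pd μ (P.v α m i) x * G.γ μ α β * P.u β p j x := by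
        simp only [Finset.sum_mul]
        rw [Finset.sum_comm]
        exact Finset.sum_congr rfl fun μ _ => Finset.sum_comm
      have e5 : ∑ α, P.v α m i x * (∑ μ, ∑ β, G.γ μ α β * pd μ (P.u β p j) x) =
          ∑ μ, ∑ α, ∑ β, P.v α m i x * (G.γ μ α β * pd μ (P.u β p j) x) := by
        simp only [Finset.mul_sum]
        exact Finset.sum_comm
      rw [e4, e5]
      simp only [Finset.mul_sum, ← Finset.sum_add_distrib]
      refine Finset.sum_congr rfl fun μ _ => Finset.sum_congr rfl fun α _ =>
        Finset.sum_congr rfl fun β _ => ?_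
      ring
    rw [e3, e1, e2]; ring
  simp only [h2]
  rw [sum_reorder_cur]
  simp only [h3, Finset.sum_const_zero]

/-! ### The lock-key identity -/

theorem bos_commute (i : Boson ι) (Y : Wick ι κ) : bos i * Y = Y * bos i := by
  induction Y using TensorProduct.induction_on with
  | zero => simp
  | add y₁ y₂ h₁ h₂ => rw [mul_add, h₁, h₂, add_mul]
  | tmul p q => simp [bos, Algebra.TensorProduct.tmul_mul_tmul, mul_comm]

theorem ι_mul_ι_swap {V : Type*} [AddCommGroup V] [Module ℂ V] (v u : V) :
    ExteriorAlgebra.ι ℂ v * ExteriorAlgebra.ι ℂ u =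
      -(ExteriorAlgebra.ι ℂ u * ExteriorAlgebra.ι ℂ v) :=
  eq_neg_of_add_eq_zero_left (ExteriorAlgebra.ι_add_mul_swap v u)

theorem quark_mul_quark (r s : Quark κ) :
    (quark r * quark s : Wick ι κ) = -(quark s * quark r) := by
  have h : ∀ r s : Quark κ, (quark r * quark s : Wick ι κ) = 1 ⊗ₜ[ℂ]
      (ExteriorAlgebra.ι ℂ (Pi.single r 1) * ExteriorAlgebra.ι ℂ (Pi.single s 1)) := fun r s => by
    rw [quark, quark, Algebra.TensorProduct.tmul_mul_tmul, one_mul]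
  rw [h, h, ι_mul_ι_swap, TensorProduct.tmul_neg]

theorem bos_mul_quark_mul (i j : Boson ι) (r s : Quark κ) :
    (bos i * quark r * (bos j * quark s) : Wick ι κ) = bos i * bos j * (quark r * quark s) := by
  rw [mul_assoc, ← mul_assoc (quark r), ← bos_commute j (quark r)]
  simp only [mul_assoc]

theorem wick_neg_mul_neg (Y X : Wick ι κ) : -Y * -X = Y * X := neg_mul_neg Y X

theorem wick_mul_neg (Y X : Wick ι κ) : Y * -X = -(Y * X) := mul_neg Y X

theorem wick_smul_neg (t : ℂ) (X : Wick ι κ) : t • -X = (-t) • X :=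
  (smul_neg t X).trans (neg_smul t X).symm

/-- The products of fields that occur in the lock-key identity. -/
noncomputable def quartic (μ : Fin 4) (a b : ι) (α β : Fin 4) (m q : κ) : Wick ι κ :=
  bos (.w a) * bos (.A μ b) * (quark (.bar α m) * quark (.psi β q))

/-- The derivative signs from `Q` and `L` cancel, and a minus sign comes from restoring the order
ψ̄ψ. The inner color sum gives the matrix product in the order π(ξ_b)π(ξ_a). -/
theorem sum_psi_L1min (D : ColorData ι κ) :
    ∑ ρ, ∑ p, ∑ a, ∑ q, D.rep a p q •
      (-(bos (.w a) * quark (.psi ρ q)) * dLeft (.inr (.psi ρ p)) (L1min D G) : Wick ι κ) =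
      ∑ μ, ∑ a, ∑ b, ∑ α, ∑ β, ∑ m, ∑ q,
        (-(G.γ μ α β * (D.rep b * D.rep a) m q)) • quartic μ a b α β m q := by
  have h1 : ∑ ρ, ∑ p, ∑ a, ∑ q, D.rep a p q •
      (-(bos (.w a) * quark (.psi ρ q)) * dLeft (.inr (.psi ρ p)) (L1min D G) : Wick ι κ) =
      ∑ ρ, ∑ p, ∑ a, ∑ q, ∑ μ, ∑ b, ∑ α, ∑ m,
        (-(G.γ μ α ρ * (D.rep b m p * D.rep a p q))) • quartic μ a b α ρ m q := by
    simp only [dLeft_psi_L1min, Finset.mul_sum, Finset.smul_sum]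
    refine Finset.sum_congr rfl fun ρ _ => Finset.sum_congr rfl fun p _ =>
      Finset.sum_congr rfl fun a _ => Finset.sum_congr rfl fun q _ =>
      Finset.sum_congr rfl fun μ _ => Finset.sum_congr rfl fun b _ =>
      Finset.sum_congr rfl fun α _ => Finset.sum_congr rfl fun m _ => ?_
    rw [mul_smul_comm, wick_neg_mul_neg, bos_mul_quark_mul, quark_mul_quark, wick_mul_neg,
      wick_smul_neg, smul_smul, quartic]
    congr 1; ring
  rw [h1, sum_reorder_psi]
  simp only [Matrix.mul_apply, Finset.mul_sum, Finset.sum_smul, ← Finset.sum_neg_distrib]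

theorem sum_bar_L1min (D : ColorData ι κ) :
    ∑ ρ, ∑ p, ∑ a, ∑ m, D.rep a m p •
      (bos (.w a) * quark (.bar ρ m) * dLeft (.inr (.bar ρ p)) (L1min D G) : Wick ι κ) =
      ∑ μ, ∑ a, ∑ b, ∑ α, ∑ β, ∑ m, ∑ q,
        (G.γ μ α β * (D.rep a * D.rep b) m q) • quartic μ a b α β m q := by
  have h2 : ∑ ρ, ∑ p, ∑ a, ∑ m, D.rep a m p •
      (bos (.w a) * quark (.bar ρ m) * dLeft (.inr (.bar ρ p)) (L1min D G) : Wick ι κ) =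
      ∑ ρ, ∑ p, ∑ a, ∑ m, ∑ μ, ∑ b, ∑ β, ∑ q,
        (G.γ μ ρ β * (D.rep a m p * D.rep b p q)) • quartic μ a b ρ β m q := by
    simp only [dLeft_bar_L1min, Finset.mul_sum, Finset.smul_sum]
    refine Finset.sum_congr rfl fun ρ _ => Finset.sum_congr rfl fun p _ =>
      Finset.sum_congr rfl fun a _ => Finset.sum_congr rfl fun q _ =>
      Finset.sum_congr rfl fun μ _ => Finset.sum_congr rfl fun b _ =>
      Finset.sum_congr rfl fun α _ => Finset.sum_congr rfl fun m _ => ?_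
    rw [mul_smul_comm, bos_mul_quark_mul, smul_smul, quartic]
    congr 1; ring
  rw [h2, sum_reorder_bar]
  simp only [Matrix.mul_apply, Finset.mul_sum, Finset.sum_smul]

theorem sum_ip_br_cur (D : ColorData ι κ) :
    (-Complex.I) • ∑ ν, ip (br D ww (AA ν)) (cur D G ν) =
      ∑ μ, ∑ a, ∑ b, ∑ α, ∑ β, ∑ m, ∑ q,
        (∑ c, G.γ μ α β * (Complex.I * (D.f a b c : ℂ) * D.rep c m q)) •
          quartic μ a b α β m q := by
  simp only [Finset.sum_smul]
  rw [Finset.smul_sum]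
  refine Finset.sum_congr rfl fun μ _ => ?_
  rw [sum_reorder_color fun c a b α β m q =>
    (G.γ μ α β * (Complex.I * (D.f a b c : ℂ) * D.rep c m q)) • quartic μ a b α β m q]
  simp only [ip, br, cur, ww, AA, Finset.smul_sum]
  refine Finset.sum_congr rfl fun c _ => ?_
  rw [Finset.sum_mul, Finset.smul_sum]
  refine Finset.sum_congr rfl fun a _ => ?_
  rw [Finset.sum_mul, Finset.smul_sum]
  refine Finset.sum_congr rfl fun b _ => ?_
  simp only [Finset.mul_sum, Finset.smul_sum]
  refine Finset.sum_congr rfl fun α _ => Finset.sum_congr rfl fun β _ =>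
    Finset.sum_congr rfl fun m _ => Finset.sum_congr rfl fun q _ => ?_
  rw [smul_mul_smul_comm, smul_smul, quartic]
  congr 1; ring

/-- The contraction of ψ with ψ̄' and that of ψ̄ with ψ' carry π(ξ_a)π(ξ_b) and π(ξ_b)π(ξ_a) with
opposite signs. Their sum is the commutator, and the representation property converts it into the
bracket i[w,A]. -/
theorem sum_psi_add_sum_bar (D : ColorData ι κ) :
    ∑ ρ, ∑ p, ∑ a, ∑ q, D.rep a p q •
      (-(bos (.w a) * quark (.psi ρ q)) * dLeft (.inr (.psi ρ p)) (L1min D G) : Wick ι κ) +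
    ∑ ρ, ∑ p, ∑ a, ∑ m, D.rep a m p •
      (bos (.w a) * quark (.bar ρ m) * dLeft (.inr (.bar ρ p)) (L1min D G)) =
    (-Complex.I) • ∑ ν, ip (br D ww (AA ν)) (cur D G ν) := by
  rw [sum_psi_L1min, sum_bar_L1min, sum_ip_br_cur]
  simp only [← Finset.sum_add_distrib, ← add_smul]
  refine Finset.sum_congr rfl fun μ _ => Finset.sum_congr rfl fun a _ =>
    Finset.sum_congr rfl fun b _ => Finset.sum_congr rfl fun α _ =>
    Finset.sum_congr rfl fun β _ => Finset.sum_congr rfl fun m _ =>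
    Finset.sum_congr rfl fun q _ => ?_
  congr 1
  have := congrFun (congrFun (D.rep_comm a b) m) q
  simp only [Matrix.sub_apply, Matrix.sum_apply, Matrix.smul_apply, smul_eq_mul] at this
  rw [← Finset.mul_sum, ← this]; ring

variable (τ : TimeOrdering (ι := ι) (κ := κ) G Sm cF)

/-- The quark-only obstruction. -/
theorem obs_Q1min_L1min (D : ColorData ι κ) {g : Spt × Spt → ℂ} (hg : IsTest g) :
    obs τ S P ℓ (Q1min D G) (L1min D G) g =
      Complex.I * bilocal S P Sm ℓ (∑ ν, ip (br D ww (AA ν)) (cur D G ν)) 1 delta g := by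
  rw [obs_Q1min S P ℓ τ D _ hg]
  have h : ∀ Y X, delta (smear S P ℓ Sm Y X g) =
      (bilin S P ℓ Sm delta_isLinear hg).flip 1 (Y * X) := fun Y X => delta_smear S P ℓ Y X g
  simp only [h]
  have key := congrArg ((bilin S P ℓ Sm delta_isLinear hg).flip 1)
    (sum_psi_add_sum_bar (G := G) D)
  simp only [map_add, map_sum, map_smul, smul_eq_mul] at key
  simp only [Finset.sum_neg_distrib]
  rw [← neg_add, key, ← map_sum, neg_mul, neg_neg]
  rfl

theorem sum_delta_smear_ip (Y X : Fin 4 → ι → Wick ι κ) {g : Spt × Spt → ℂ} (hg : IsTest g) :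
    ∑ k, ∑ b, delta (smear S P ℓ Sm (Y k b) (X k b) g) =
      bilocal S P Sm ℓ (∑ ν, ip (Y ν) (X ν)) 1 delta g := by
  have h : ∀ Y X, delta (smear S P ℓ Sm Y X g) =
      (bilin S P ℓ Sm delta_isLinear hg).flip 1 (Y * X) := fun Y X => delta_smear S P ℓ Y X g
  simp only [h, ← map_sum]
  rfl

/-- The quark-gluon cross-term. -/
theorem obs_Q1YM_L1min_eq (D : ColorData ι κ) {g : Spt × Spt → ℂ} (hg : IsTest g) :
    obs τ S P ℓ (Q1YM D) (L1min D G) g =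
      -(Complex.I * bilocal S P Sm ℓ (∑ ν, ip (br D ww (AA ν)) (cur D G ν)) 1 delta g) -
      Complex.I * ∑ k, ∑ b, ∑ ν,
        strDelta' Sm.c ν (pdx k (smear S P ℓ Sm (br D ww (AA ν) b) (cur D G k b) g)) := by
  rw [obs_Q1YM_L1min S P ℓ τ D hg, ← sum_delta_smear_ip S P ℓ _ _ hg]
  simp only [← Finset.mul_sum, Finset.sum_add_distrib]
  ring

end Obstructions

/-! ### The Lie bracket of classical fields -/

section Bracket

variable {ι κ : Type*} [Fintype ι] [Fintype κ] (D : ColorData ι κ)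

/-- The bracket `i[X,Z]` of Lie-algebra elements. -/
noncomputable def brC (X Z : ι → ℂ) (c : ι) : ℂ := ∑ a, ∑ b, -(D.f a b c : ℂ) * (X a * Z b)

theorem brC_swap (X Z : ι → ℂ) (c : ι) : brC D Z X c = -brC D X Z c := by
  simp only [brC, ← Finset.sum_neg_distrib]
  rw [Finset.sum_comm]
  refine Finset.sum_congr rfl fun a _ => Finset.sum_congr rfl fun b _ => ?_
  rw [D.f_antisymm a b c]; push_cast; ring

theorem brC_self (X : ι → ℂ) (c : ι) : brC D X X c = 0 := self_eq_neg.1 (brC_swap D X X c)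

theorem brC_add_right (X Z Z' : ι → ℂ) (c : ι) :
    brC D X (Z + Z') c = brC D X Z c + brC D X Z' c := by
  simp only [brC, Pi.add_apply, mul_add, Finset.sum_add_distrib]

theorem brC_smul_left (t : ℂ) (X Z : ι → ℂ) (c : ι) : brC D (t • X) Z c = t * brC D X Z c := by
  simp only [brC, Pi.smul_apply, smul_eq_mul, Finset.mul_sum]
  exact Finset.sum_congr rfl fun a _ => Finset.sum_congr rfl fun b _ => by ring

theorem brC_neg_left (X Z : ι → ℂ) (c : ι) : brC D (-X) Z c = -brC D X Z c := by
  simpa using brC_smul_left D (-1) X Z c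

theorem brC_sum_left {α : Type*} (s : Finset α) (X : α → ι → ℂ) (Z : ι → ℂ) (c : ι) :
    brC D (∑ i ∈ s, X i) Z c = ∑ i ∈ s, brC D (X i) Z c := by
  simp only [brC, Finset.sum_apply, Finset.sum_mul, Finset.mul_sum]
  rw [Finset.sum_congr rfl fun a _ => Finset.sum_comm, Finset.sum_comm]

/-- Cyclicity puts the contracted index of the second structure constant first, the form in which
the Jacobi identity is stated. -/
theorem sum_brC_mul_brC (X Y Z W : ι → ℂ) : ∑ d, brC D X Y d * brC D Z W d =
    ∑ a, ∑ b, ∑ c, ∑ e, (∑ d, (D.f a b d * D.f d c e : ℂ)) * (X a * Y b * Z c * W e) := by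
  have h : ∀ d, brC D X Y d * brC D Z W d = ∑ a, ∑ b, ∑ c, ∑ e,
      (D.f a b d * D.f d c e : ℂ) * (X a * Y b * Z c * W e) := by
    intro d
    simp only [brC, Finset.sum_mul]
    refine Finset.sum_congr rfl fun a _ => Finset.sum_congr rfl fun b _ => ?_
    simp only [Finset.mul_sum]
    refine Finset.sum_congr rfl fun c _ => Finset.sum_congr rfl fun e _ => ?_
    rw [D.f_cyclic d c e]; ring
  simp only [h, Finset.sum_mul]
  rw [Finset.sum_comm]
  refine Finset.sum_congr rfl fun a _ => ?_
  rw [Finset.sum_comm]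
  refine Finset.sum_congr rfl fun b _ => ?_
  rw [Finset.sum_comm]
  exact Finset.sum_congr rfl fun c _ => Finset.sum_comm

/-- The Jacobi identity. -/
theorem sum_brC_jacobi (F w A B : ι → ℂ) : ∑ c, brC D F w c * brC D A B c =
    ∑ c, brC D w A c * brC D B F c + ∑ c, brC D w B c * brC D F A c := by
  have h1 : ∑ c, brC D w A c * brC D B F c = -∑ c, brC D w A c * brC D F B c := by
    simp only [brC_swap D F B, mul_neg, Finset.sum_neg_distrib]
  have h2 : ∑ c, brC D w B c * brC D F A c = -∑ c, brC D A F c * brC D w B c := by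
    simp only [brC_swap D A F, mul_neg, Finset.sum_neg_distrib, mul_comm]
  rw [h1, h2, sum_brC_mul_brC, sum_brC_mul_brC, sum_brC_mul_brC]
  have r1 : ∀ f : ι → ι → ι → ℂ, ∑ b, ∑ c, ∑ a, f b c a = ∑ a, ∑ b, ∑ c, f b c a := fun f => by
    rw [Finset.sum_congr rfl fun b _ => Finset.sum_comm, Finset.sum_comm]
  have r2 : ∀ f : ι → ι → ι → ℂ, ∑ c, ∑ a, ∑ b, f c a b = ∑ a, ∑ b, ∑ c, f c a b := fun f => by
    rw [Finset.sum_comm, Finset.sum_congr rfl fun a _ => Finset.sum_comm]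
  rw [r1 fun b c a => ∑ e, (∑ d, (D.f b c d * D.f d a e : ℂ)) * (w b * A c * F a * B e),
    r2 fun c a b => ∑ e, (∑ d, (D.f c a d * D.f d b e : ℂ)) * (A c * F a * w b * B e),
    ← sub_eq_zero]
  simp only [← Finset.sum_neg_distrib, ← Finset.sum_add_distrib, ← Finset.sum_sub_distrib]
  refine Finset.sum_eq_zero fun a _ => Finset.sum_eq_zero fun b _ =>
    Finset.sum_eq_zero fun c _ => Finset.sum_eq_zero fun e _ => ?_
  have h := congrArg (fun r : ℝ => (r : ℂ)) (D.jacobi a b c e)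
  simp only [Finset.sum_add_distrib] at h
  push_cast at h
  linear_combination (F a * w b * A c * B e) * h

variable {F : Fin 4 → Fin 4 → ι → ℂ} (A : Fin 4 → ι → ℂ)
  (w : ι → ℂ)

/-- Exchange of the two Lorentz indices in a contraction with the metric. -/
theorem sum_sgn_swap (Z : Fin 4 → Fin 4 → ℂ) :
    ∑ k, ∑ l, sgn k * sgn l * Z k l = ∑ k, ∑ l, sgn k * sgn l * Z l k := by
  rw [Finset.sum_comm]
  exact Finset.sum_congr rfl fun k _ => Finset.sum_congr rfl fun l _ => by ring

/-- The Jacobi identity produces two terms, which become equal after exchanging the Lorentz indices.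
-/
theorem sum_brC_F_w (hF : ∀ k l, F l k = -F k l) :
    ∑ k, ∑ l, sgn k * sgn l * ∑ b, brC D (F k l) w b * brC D (A k) (A l) b =
      -2 * ∑ k, ∑ l, sgn k * sgn l * ∑ b, brC D w (A k) b * brC D (F k l) (A l) b := by
  have h1 : ∀ k l, ∑ b, brC D (F k l) w b * brC D (A k) (A l) b =
      -(∑ b, brC D w (A k) b * brC D (F k l) (A l) b) +
        -(∑ b, brC D w (A l) b * brC D (F l k) (A k) b) := by
    intro k l
    rw [sum_brC_jacobi]
    simp only [brC_swap D (F k l) (A l), hF k l, brC_neg_left, mul_neg, Finset.sum_neg_distrib,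
      neg_neg]
  simp only [h1, mul_add, mul_neg, Finset.sum_add_distrib, Finset.sum_neg_distrib]
  rw [← sum_sgn_swap fun k l => ∑ b, brC D w (A k) b * brC D (F k l) (A l) b]
  ring

/-- The factor i[A_k,A_l] is antisymmetric and picks the curl out of `dA`, that is half of `F`; the
preceding identity then disposes of i[F,w]. -/
theorem sum_brC_gradient (hF : ∀ k l, F l k = -F k l) (E : Fin 4 → ι → ℂ)
    (dA : Fin 4 → Fin 4 → ι → ℂ) (hA : ∀ k l, dA k l = F k l + dA l k) :
    ∑ k, ∑ l, sgn k * sgn l *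
        ∑ b, (brC D (E l) (A k) b + brC D w (dA l k) b) * brC D (A k) (A l) b =
      -(∑ k, ∑ l, sgn k * sgn l * ∑ b, brC D (E k) (A l) b * brC D (A k) (A l) b) -
        ∑ k, ∑ l, sgn k * sgn l * ∑ b, brC D w (A k) b * brC D (F k l) (A l) b := by
  simp only [add_mul, Finset.sum_add_distrib, mul_add]
  have h1 : ∑ k, ∑ l, sgn k * sgn l * ∑ b, brC D (E l) (A k) b * brC D (A k) (A l) b =
      -(∑ k, ∑ l, sgn k * sgn l * ∑ b, brC D (E k) (A l) b * brC D (A k) (A l) b) := by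
    rw [sum_sgn_swap]
    simp only [← Finset.sum_neg_distrib]
    refine Finset.sum_congr rfl fun k _ => Finset.sum_congr rfl fun l _ => ?_
    rw [← mul_neg, ← Finset.sum_neg_distrib]
    congr 1
    refine Finset.sum_congr rfl fun b _ => ?_
    rw [brC_swap D (A k) (A l)]; ring
  have h2 : ∑ k, ∑ l, sgn k * sgn l * ∑ b, brC D w (dA l k) b * brC D (A k) (A l) b =
      -(∑ k, ∑ l, sgn k * sgn l * ∑ b, brC D w (dA k l) b * brC D (A k) (A l) b) := by
    rw [sum_sgn_swap fun k l => ∑ b, brC D w (dA l k) b * brC D (A k) (A l) b]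
    simp only [← Finset.sum_neg_distrib]
    refine Finset.sum_congr rfl fun k _ => Finset.sum_congr rfl fun l _ => ?_
    rw [← mul_neg, ← Finset.sum_neg_distrib]
    congr 1
    refine Finset.sum_congr rfl fun b _ => ?_
    rw [brC_swap D (A k) (A l)]; ring
  have h3 : ∑ k, ∑ l, sgn k * sgn l * ∑ b, brC D w (dA k l) b * brC D (A k) (A l) b =
      -(∑ k, ∑ l, sgn k * sgn l * ∑ b, brC D (F k l) w b * brC D (A k) (A l) b) +
      ∑ k, ∑ l, sgn k * sgn l * ∑ b, brC D w (dA l k) b * brC D (A k) (A l) b := by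
    simp only [← Finset.sum_neg_distrib, ← Finset.sum_add_distrib]
    refine Finset.sum_congr rfl fun k _ => Finset.sum_congr rfl fun l _ => ?_
    rw [← mul_neg, ← mul_add, ← Finset.sum_neg_distrib, ← Finset.sum_add_distrib]
    congr 1
    refine Finset.sum_congr rfl fun b _ => ?_
    rw [hA k l, brC_add_right, brC_swap D (F k l) w]; ring
  have h4 := sum_brC_F_w D A w hF
  rw [h4] at h3
  linear_combination h1 + (1 / 2) * h2 - (1 / 2) * h3

/-- The divergence of `i[F^{μν}, A_ν]` vanishes algebraically. -/
theorem sum_brC_divergence (hF : ∀ k l, F l k = -F k l)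
    (dA : Fin 4 → Fin 4 → ι → ℂ) (hA : ∀ k l, dA k l = F k l + dA l k)
    (dF : Fin 4 → Fin 4 → Fin 4 → ι → ℂ) (hdF : ∀ ν, ∑ k, sgn k • dF k k ν = 0) (b : ι) :
    ∑ k, ∑ ν, sgn k * sgn ν * (brC D (dF k k ν) (A ν) b + brC D (F k ν) (dA k ν) b) = 0 := by
  simp only [mul_add, Finset.sum_add_distrib]
  have h1 : ∑ k, ∑ ν, sgn k * sgn ν * brC D (dF k k ν) (A ν) b = 0 := by
    rw [Finset.sum_comm]
    refine Finset.sum_eq_zero fun ν _ => ?_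
    have : ∑ k, sgn k * sgn ν * brC D (dF k k ν) (A ν) b =
        sgn ν * brC D (∑ k, sgn k • dF k k ν) (A ν) b := by
      rw [brC_sum_left, Finset.mul_sum]
      exact Finset.sum_congr rfl fun k _ => by rw [brC_smul_left]; ring
    rw [this, hdF]
    simp [brC]
  -- Exchanging the indices reverses `F` and transposes `dA`, which changes it by `F` itself. As
  -- i[F,F] = 0, the sum equals its own negative.
  have h2 : ∑ k, ∑ ν, sgn k * sgn ν * brC D (F k ν) (dA k ν) b =
      -∑ k, ∑ ν, sgn k * sgn ν * brC D (F k ν) (dA k ν) b := by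
    conv_lhs => rw [sum_sgn_swap fun k ν => brC D (F k ν) (dA k ν) b]
    simp only [← Finset.sum_neg_distrib]
    refine Finset.sum_congr rfl fun k _ => Finset.sum_congr rfl fun l _ => ?_
    rw [hF k l, hA k l, brC_add_right, brC_self, brC_neg_left]; ring
  rw [h1, zero_add]
  exact self_eq_neg.1 h2

theorem contDiff_brC {X Z : ι → Spt → ℂ} (hX : ∀ a, ContDiff ℝ ∞ (X a))
    (hZ : ∀ a, ContDiff ℝ ∞ (Z a)) (c : ι) :
    ContDiff ℝ ∞ fun x => brC D (fun a => X a x) (fun a => Z a x) c :=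
  ContDiff.sum fun a _ => ContDiff.sum fun b _ => contDiff_const.mul ((hX a).mul (hZ b))

theorem pd_brC {X Z : ι → Spt → ℂ} (hX : ∀ a, ContDiff ℝ ∞ (X a))
    (hZ : ∀ a, ContDiff ℝ ∞ (Z a)) (c : ι) (k : Fin 4) (x : Spt) :
    pd k (fun x => brC D (fun a => X a x) (fun a => Z a x) c) x =
      brC D (fun a => pd k (X a) x) (fun a => Z a x) c +
        brC D (fun a => X a x) (fun a => pd k (Z a) x) c := by
  have hXZ : ∀ a b, ContDiff ℝ ∞ fun x => X a x * Z b x := fun a b => (hX a).mul (hZ b)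
  simp only [brC, ← Finset.sum_add_distrib]
  rw [pd_sum fun a _ => ContDiff.sum fun b _ => contDiff_const.mul (hXZ a b)]
  refine Finset.sum_congr rfl fun a _ => ?_
  rw [pd_sum fun b _ => contDiff_const.mul (hXZ a b)]
  refine Finset.sum_congr rfl fun b _ => ?_
  rw [pd_const_mul (hXZ a b), pd_mul (hX a) (hZ b)]
  ring

end Bracket

/-! ### Local functionals -/

/-- The field `φ(x)` times `δ(x-x')`. -/
noncomputable def contact (φ : Spt → ℂ) (h : Spt × Spt → ℂ) : ℂ := delta fun z => φ z.1 * h z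

theorem isTest_contact {φ : Spt → ℂ} (hφ : ContDiff ℝ ∞ φ) {h : Spt × Spt → ℂ} (hh : IsTest h) :
    IsTest fun z => φ z.1 * h z :=
  ⟨(hφ.comp contDiff_fst).mul hh.1, hh.2.mul_left⟩

theorem contact_sum {α : Type*} {s : Finset α} {φ : α → Spt → ℂ}
    (hφ : ∀ i ∈ s, ContDiff ℝ ∞ (φ i)) {h : Spt × Spt → ℂ} (hh : IsTest h) :
    contact (fun x => ∑ i ∈ s, φ i x) h = ∑ i ∈ s, contact (φ i) h := by
  simp only [contact, Finset.sum_mul]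
  exact delta_isLinear.sum s fun i hi => isTest_contact (hφ i hi) hh

theorem contact_const_mul {φ : Spt → ℂ} (hφ : ContDiff ℝ ∞ φ) (t : ℂ) {h : Spt × Spt → ℂ}
    (hh : IsTest h) : contact (fun x => t * φ x) h = t * contact φ h := by
  simp only [contact, mul_assoc]
  exact delta_isLinear.fun_smul t (isTest_contact hφ hh)

theorem contact_sub {φ χ : Spt → ℂ} (hφ : ContDiff ℝ ∞ φ) (hχ : ContDiff ℝ ∞ χ)
    {h : Spt × Spt → ℂ} (hh : IsTest h) :
    contact (fun x => φ x - χ x) h = contact φ h - contact χ h := by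
  have e : (fun x => φ x - χ x) = fun x => ∑ i : Bool, (cond i (φ x) (-1 * χ x)) := by
    ext x; simp; ring
  rw [e, contact_sum (φ := fun i x => cond i (φ x) (-1 * χ x)) (fun i _ => by
    cases i
    · exact contDiff_const.mul hχ
    · exact hφ) hh]
  simp only [Fintype.sum_bool, cond_true, cond_false]
  rw [contact_const_mul hχ _ hh]
  ring

theorem contact_swap (φ : Spt → ℂ) (h : Spt × Spt → ℂ) :
    contact φ (fun z => h (z.2, z.1)) = contact φ h := rfl

theorem delta_congr {g h : Spt × Spt → ℂ} (H : ∀ x, g (x, x) = h (x, x)) : delta g = delta h := by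
  simp only [delta, H]

section YangMills

variable {ι κ : Type*} [Fintype ι] [DecidableEq ι] [Fintype κ] [DecidableEq κ]
  {G : DiracMatrices} {Sm : Smearing} {cF : ℂ} {n : ℕ} (D : ColorData ι κ)

/-! ### The derivative of `L_{1,YM}` with respect to `A` -/

theorem ip_add_right (X Y Z : ι → Wick ι κ) : ip X (fun a => Y a + Z a) = ip X Y + ip X Z := by
  simp only [ip, mul_add, Finset.sum_add_distrib]

theorem ip_br_single_right (X Z : ι → Wick ι κ) (a : ι) :
    ip X (br D Z fun c => if c = a then 1 else 0) = br D X Z a := by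
  simp only [ip, br, mul_ite, mul_one, mul_zero, smul_ite, smul_zero, Finset.sum_ite_eq',
    Finset.mem_univ, if_true, Finset.mul_sum, mul_smul_comm]
  refine Finset.sum_congr rfl fun c _ => Finset.sum_congr rfl fun b _ => ?_
  rw [D.f_cyclic c b a]

theorem br_swap_bosonic (X Z : ι → Wick ι κ) (h : ∀ a b, X a * Z b = Z b * X a) (c : ι) :
    br D X Z c = (-1 : ℂ) • br D Z X c := by
  simp only [br, Finset.smul_sum, smul_smul]
  rw [Finset.sum_comm]
  refine Finset.sum_congr rfl fun a _ => Finset.sum_congr rfl fun b _ => ?_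
  rw [h, D.f_antisymm a b c]
  congr 1; push_cast; ring

theorem ip_smul_right (t : ℂ) (X Z : ι → Wick ι κ) : ip X (fun a => t • Z a) = t • ip X Z := by
  simp only [ip, mul_smul_comm, Finset.smul_sum]

theorem ip_br_single_left (X Z : ι → Wick ι κ) (a : ι) :
    ip X (br D (fun c => if c = a then 1 else 0) Z) = (-1 : ℂ) • br D X Z a := by
  have : br D (fun c => if c = a then 1 else 0) Z =
      fun c => (-1 : ℂ) • br D Z (fun c => if c = a then 1 else 0) c :=
    funext fun c => br_swap_bosonic D _ _ (fun a b => by split_ifs <;> simp) c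
  rw [this, ip_smul_right, ip_br_single_right]

theorem dLeft_A_L1YM (k : Fin 4) (a : ι) :
    dLeft (.inl (.A k a)) (L1YM D : Wick ι κ) = (1 / 2 : ℂ) •
      (∑ ν, (sgn k * sgn ν) • (-1 : ℂ) • br D (FF k ν) (AA ν) a +
        ∑ μ, (sgn μ * sgn k) • br D (FF μ k) (AA μ) a) := by
  simp only [L1YM, map_sum, map_smul, dLeft_inl_ip, dLeft_inl_br, AA, FF, dLeft_inl_bos,
    reduceCtorEq, if_false, Boson.A.injEq]
  change (1 / 2 : ℂ) • ∑ μ, ∑ σ, (sgn μ * sgn σ) •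
    (ip (0 : ι → Wick ι κ) _ + ip (FF μ σ) (fun c => br D (fun b => if μ = k ∧ b = a then 1 else 0)
      (AA σ) c + br D (AA μ) (fun b => if σ = k ∧ b = a then 1 else 0) c)) = _
  simp only [ip_zero_left, zero_add, ip_add_right, smul_add, Finset.sum_add_distrib]
  congr 2
  · rw [Finset.sum_eq_single k]
    · simp only [true_and]
      exact Finset.sum_congr rfl fun ν _ => congrArg _ (ip_br_single_left D _ _ a)
    · intro b _ hb
      refine Finset.sum_eq_zero fun ν _ => ?_
      simp [hb, ip, br]
    · simp
  · refine Finset.sum_congr rfl fun μ _ => ?_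
    rw [Finset.sum_eq_single k]
    · simp only [true_and]
      exact congrArg _ (ip_br_single_right D _ _ a)
    · intro b _ hb
      simp [hb, ip, br]
    · simp

variable (S : GluonSolution ι) (P : QuarkSolution κ G n)
  (ℓ : Module.Dual ℂ (ExteriorAlgebra ℂ (Fin n → ℂ)))

/-! ### Values of the gluon fields -/

theorem value_br {c : Spt → ℝ} {b : Fin 4 → Spt → ℝ} {x : Spt} {X Z : ι → Wick ι κ}
    {X' Z' : ι → ℂ} (hX : ∀ a, value S P c b x (X a) = algebraMap ℂ _ (X' a))
    (hZ : ∀ a, value S P c b x (Z a) = algebraMap ℂ _ (Z' a)) (e : ι) :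
    value S P c b x (br D X Z e) = algebraMap ℂ _ (brC D X' Z' e) := by
  simp only [br, brC, map_sum, map_smul, map_mul, hX, hZ, Algebra.smul_def]

theorem value_ip {c : Spt → ℝ} {b : Fin 4 → Spt → ℝ} {x : Spt} {X Z : ι → Wick ι κ}
    {X' Z' : ι → ℂ} (hX : ∀ a, value S P c b x (X a) = algebraMap ℂ _ (X' a))
    (hZ : ∀ a, value S P c b x (Z a) = algebraMap ℂ _ (Z' a)) :
    value S P c b x (ip X Z) = algebraMap ℂ _ (∑ a, X' a * Z' a) := by
  simp only [ip, map_sum, map_mul, hX, hZ]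

theorem value_AA (c : Spt → ℝ) (b : Fin 4 → Spt → ℝ) (x : Spt) (μ : Fin 4) (a : ι) :
    value S P c b x (AA μ a) = algebraMap ℂ _ (potential S c a μ x) := value_bos S P c b x _

theorem value_FF (c : Spt → ℝ) (b : Fin 4 → Spt → ℝ) (x : Spt) (μ ν : Fin 4) (a : ι) :
    value S P c b x (FF μ ν a) = algebraMap ℂ _ (S.F a μ ν x) := value_bos S P c b x _

theorem value_ww (c : Spt → ℝ) (b : Fin 4 → Spt → ℝ) (x : Spt) (a : ι) :
    value S P c b x (ww a) = algebraMap ℂ _ (wField S b a x) := value_bos S P c b x _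

/-- The value of `i[w, A_k]`. -/
noncomputable def brwA (Sm : Smearing) (k : Fin 4) (b : ι) (x : Spt) : ℂ :=
  brC D (fun a => wField S Sm.b a x) (fun a => potential S Sm.c a k x) b

/-- The value of `i[A_k, A_l]`. -/
noncomputable def brAA (Sm : Smearing) (k l : Fin 4) (b : ι) (x : Spt) : ℂ :=
  brC D (fun a => potential S Sm.c a k x) (fun a => potential S Sm.c a l x) b

/-- The value of `i[F_{kl}, w]`. -/
noncomputable def brFw (Sm : Smearing) (k l : Fin 4) (b : ι) (x : Spt) : ℂ :=
  brC D (fun a => S.F a k l x) (fun a => wField S Sm.b a x) b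

/-- The value of `i[F_{kl}, A_l]`. -/
noncomputable def brFA (Sm : Smearing) (k l : Fin 4) (b : ι) (x : Spt) : ℂ :=
  brC D (fun a => S.F a k l x) (fun a => potential S Sm.c a l x) b

theorem value_br_ww_AA (k : Fin 4) (b : ι) (x : Spt) :
    value S P Sm.c Sm.b x (br D ww (AA k) b) = algebraMap ℂ _ (brwA D S Sm k b x) :=
  value_br D S P (value_ww S P _ _ x) (value_AA S P _ _ x k) b

theorem value_br_AA_AA (k l : Fin 4) (b : ι) (x : Spt) :
    value S P Sm.c Sm.b x (br D (AA k) (AA l) b) = algebraMap ℂ _ (brAA D S Sm k l b x) :=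
  value_br D S P (value_AA S P _ _ x k) (value_AA S P _ _ x l) b

theorem value_br_FF_ww (k l : Fin 4) (b : ι) (x : Spt) :
    value S P Sm.c Sm.b x (br D (FF k l) ww b) = algebraMap ℂ _ (brFw D S Sm k l b x) :=
  value_br D S P (value_FF S P _ _ x k l) (value_ww S P _ _ x) b

theorem value_br_FF_AA (k l : Fin 4) (b : ι) (x : Spt) :
    value S P Sm.c Sm.b x (br D (FF k l) (AA l) b) = algebraMap ℂ _ (brFA D S Sm k l b x) :=
  value_br D S P (value_FF S P _ _ x k l) (value_AA S P _ _ x l) b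

theorem value_FAcur (k : Fin 4) (b : ι) (x : Spt) :
    value S P Sm.c Sm.b x (FAcur D k b) =
      algebraMap ℂ _ (∑ l, sgn k * sgn l * brFA D S Sm k l b x) := by
  simp only [FAcur, map_sum, map_smul, value_br_FF_AA, Algebra.smul_def, map_mul]

/-- The two occurrences of `A` in `L_{1,YM}` give equal contributions once F_{μν} = -F_{νμ} is used,
which holds for values; this compensates the factor 1/2. -/
theorem value_dLeft_A_L1YM (k : Fin 4) (a : ι) (x : Spt) :
    value S P Sm.c Sm.b x (dLeft (.inl (.A k a)) (L1YM D)) =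
      value S P Sm.c Sm.b x ((-1 : ℂ) • FAcur D k a) := by
  have h : ∀ μ, value S P Sm.c Sm.b x (br D (FF μ k) (AA μ) a) =
      algebraMap ℂ _ (-brFA D S Sm k μ a x) := by
    intro μ
    rw [value_br D S P (value_FF S P _ _ x μ k) (value_AA S P _ _ x μ) a, brFA,
      ← brC_neg_left]
    congr 2
    exact funext fun b => S.antisymm b k μ x
  rw [dLeft_A_L1YM]
  simp only [map_smul, map_add, map_sum, value_br_FF_AA, value_FAcur, h,
    Algebra.algebraMap_eq_smul_one, smul_smul, ← Finset.sum_smul, ← add_smul]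
  congr 1
  rw [← Finset.sum_add_distrib, Finset.mul_sum, Finset.mul_sum]
  exact Finset.sum_congr rfl fun ν _ => by ring

theorem contDiff_potential' (k : Fin 4) (a : ι) : ContDiff ℝ ∞ (potential S Sm.c a k) :=
  contDiff_potential S Sm.c_smooth Sm.c_supp a k

theorem contDiff_wField' (a : ι) : ContDiff ℝ ∞ (wField S Sm.b a) :=
  contDiff_wField S Sm.b_smooth Sm.b_supp a

theorem contDiff_brwA (k : Fin 4) (b : ι) : ContDiff ℝ ∞ (brwA D S Sm k b) :=
  contDiff_brC D (contDiff_wField' S) (contDiff_potential' S k) b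

theorem contDiff_brAA (k l : Fin 4) (b : ι) : ContDiff ℝ ∞ (brAA D S Sm k l b) :=
  contDiff_brC D (contDiff_potential' S k) (contDiff_potential' S l) b

theorem contDiff_brFw (k l : Fin 4) (b : ι) : ContDiff ℝ ∞ (brFw D S Sm k l b) :=
  contDiff_brC D (fun a => S.smooth a k l) (contDiff_wField' S) b

theorem contDiff_brFA (k l : Fin 4) (b : ι) : ContDiff ℝ ∞ (brFA D S Sm k l b) :=
  contDiff_brC D (fun a => S.smooth a k l) (contDiff_potential' S l) b

theorem contDiff_pd {f : Spt → ℂ} (hf : ContDiff ℝ ∞ f) (k : Fin 4) : ContDiff ℝ ∞ (pd k f) :=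
  contDiff_fderiv_const hf _

/-! ### Conservation of the gluon current -/

theorem pd_potential_eq (k l : Fin 4) (x : Spt) : (fun a => pd k (potential S Sm.c a l) x) =
    (fun a => S.F a k l x) + fun a => pd l (potential S Sm.c a k) x := by
  ext a
  rw [Pi.add_apply, ← potential_curl S Sm.c_smooth Sm.c_supp Sm.c_weight a k l x]; ring

theorem field_antisymm (k l : Fin 4) (x : Spt) :
    (fun a => S.F a l k x) = -fun a => S.F a k l x := funext fun a => S.antisymm a k l x

theorem isConserved_FAcur : IsConserved S P Sm (FAcur D : Fin 4 → ι → Wick ι κ) := by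
  intro m b x
  have h1 : ∀ k y, m (value S P Sm.c Sm.b y (FAcur D k b)) =
      (∑ l, sgn k * sgn l * brFA D S Sm k l b y) * m 1 := by
    intro k y
    rw [value_FAcur, Algebra.algebraMap_eq_smul_one, map_smul, smul_eq_mul]
  simp only [h1]
  have h2 : ∀ k l, ContDiff ℝ ∞ fun y => sgn k * sgn l * brFA D S Sm k l b y := fun k l =>
    contDiff_const.mul (contDiff_brFA D S k l b)
  have h3 : ∀ k, pd k (fun y => (∑ l, sgn k * sgn l * brFA D S Sm k l b y) * m 1) x =
      (∑ l, sgn k * sgn l * (brC D (fun a => pd k (S.F a k l) x)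
        (fun a => potential S Sm.c a l x) b + brC D (fun a => S.F a k l x)
        (fun a => pd k (potential S Sm.c a l) x) b)) * m 1 := by
    intro k
    rw [pd_mul_const (ContDiff.sum fun l _ => h2 k l), pd_sum fun l _ => h2 k l]
    congr 1
    refine Finset.sum_congr rfl fun l _ => ?_
    rw [pd_const_mul (contDiff_brFA D S k l b)]
    congr 1
    exact pd_brC D (fun a => S.smooth a k l) (contDiff_potential' S l) b k x
  simp only [h3, ← Finset.sum_mul]
  rw [sum_brC_divergence D (F := fun k l a => S.F a k l x) (fun l a => potential S Sm.c a l x)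
    (fun k l => field_antisymm S k l x) (fun k l a => pd k (potential S Sm.c a l) x)
    (fun k l => pd_potential_eq S k l x) (fun k l ν a => pd k (S.F a l ν) x)
    (fun ν => funext fun a => by
      simpa [Finset.sum_apply] using S.maxwell a ν x) b, zero_mul]

/-! ### Contact terms -/

theorem delta_smear_of_value {Y X : Wick ι κ} {y w : Spt → ℂ}
    (hY : ∀ x, value S P Sm.c Sm.b x Y = algebraMap ℂ _ (y x))
    (hX : ∀ x, value S P Sm.c Sm.b x X = algebraMap ℂ _ (w x))
    (hy : ContDiff ℝ ∞ y) (hw : ContDiff ℝ ∞ w) {g : Spt × Spt → ℂ} (hg : IsTest g) :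
    delta (smear S P ℓ Sm Y X g) = ℓ 1 * contact (fun x => y x * w x) g := by
  rw [← contact_const_mul (hy.mul hw) _ hg, contact]
  refine delta_congr fun x => ?_
  rw [smear, hY, hX, ← map_mul, Algebra.algebraMap_eq_smul_one, map_smul, smul_eq_mul]
  ring

/-- The derivative is taken in `x` before the points are identified, so it hits `Y` and the test
function but not `X`. -/
theorem delta_pdx_smear_of_value {Y X : Wick ι κ} {y w : Spt → ℂ}
    (hY : ∀ x, value S P Sm.c Sm.b x Y = algebraMap ℂ _ (y x))
    (hX : ∀ x, value S P Sm.c Sm.b x X = algebraMap ℂ _ (w x))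
    (hy : ContDiff ℝ ∞ y) (hw : ContDiff ℝ ∞ w) (l : Fin 4) {g : Spt × Spt → ℂ} (hg : IsTest g) :
    delta (pdx l (smear S P ℓ Sm Y X g)) =
      ℓ 1 * (contact (fun x => pd l y x * w x) g + contact (fun x => y x * w x) (pdx l g)) := by
  have h1 := (contDiff_pd hy l).mul hw
  have h2 := hy.mul hw
  rw [mul_add, ← delta_smear_of_value S P ℓ hY hX hy hw (hg.pdx l),
    ← contact_const_mul h1 _ hg, contact,
    ← delta_isLinear.fun_add (isTest_contact (contDiff_const.mul h1) hg)
      (isTest_smear S P ℓ Y X (hg.pdx l))]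
  refine delta_congr fun x => ?_
  rw [pdx_smear S P ℓ _ _ hg]
  have h3 : (fun x' => ℓ (value S P Sm.c Sm.b x' Y * value S P Sm.c Sm.b x X)) =
      fun x' => y x' * (w x * ℓ 1) := by
    ext x'
    rw [hY, hX, ← map_mul, Algebra.algebraMap_eq_smul_one, map_smul, smul_eq_mul]
    ring
  rw [h3, pd_mul_const hy]
  ring

theorem contact_sum_sgn {φ : Fin 4 → Fin 4 → ι → Spt → ℂ} (hφ : ∀ k l b, ContDiff ℝ ∞ (φ k l b))
    {h : Spt × Spt → ℂ} (hh : IsTest h) :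
    contact (fun x => ∑ k, ∑ l, sgn k * sgn l * ∑ b, φ k l b x) h =
      ∑ k, ∑ l, sgn k * sgn l * ∑ b, contact (φ k l b) h := by
  have h1 : ∀ k l, ContDiff ℝ ∞ fun x => ∑ b, φ k l b x := fun k l => ContDiff.sum fun b _ => hφ k l b
  have h2 : ∀ k l, ContDiff ℝ ∞ fun x => sgn k * sgn l * ∑ b, φ k l b x := fun k l =>
    contDiff_const.mul (h1 k l)
  rw [contact_sum (fun k _ => ContDiff.sum fun l _ => h2 k l) hh]
  refine Finset.sum_congr rfl fun k _ => ?_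
  rw [contact_sum (fun l _ => h2 k l) hh]
  refine Finset.sum_congr rfl fun l _ => ?_
  rw [contact_const_mul (h1 k l) _ hh, contact_sum (fun b _ => hφ k l b) hh]

/-- The vector field `⟨i[w, A_k] | i[A^k, A_l]⟩`. -/
noncomputable def wAAA (Sm : Smearing) (l : Fin 4) (x : Spt) : ℂ :=
  ∑ k, sgn k * sgn l * ∑ b, brwA D S Sm k b x * brAA D S Sm k l b x

/-- The scalar field `⟨i[∂_k w, A_l] | i[A^k, A^l]⟩`. -/
noncomputable def dwAAA (Sm : Smearing) (x : Spt) : ℂ :=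
  ∑ k, ∑ l, sgn k * sgn l * ∑ b, brC D (fun a => pd k (wField S Sm.b a) x)
    (fun a => potential S Sm.c a l x) b * brAA D S Sm k l b x

/-- The scalar field `⟨i[w, A_k] | i[F^{kl}, A_l]⟩`. -/
noncomputable def wAFA (Sm : Smearing) (x : Spt) : ℂ :=
  ∑ k, ∑ l, sgn k * sgn l * ∑ b, brwA D S Sm k b x * brFA D S Sm k l b x

theorem contDiff_wAAA (l : Fin 4) : ContDiff ℝ ∞ (wAAA D S Sm l) :=
  ContDiff.sum fun k _ => contDiff_const.mul (ContDiff.sum fun b _ =>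
    (contDiff_brwA D S k b).mul (contDiff_brAA D S k l b))

theorem contDiff_dwAAA : ContDiff ℝ ∞ (dwAAA D S Sm) :=
  ContDiff.sum fun k _ => ContDiff.sum fun l _ => contDiff_const.mul (ContDiff.sum fun b _ =>
    (contDiff_brC D (fun a => contDiff_pd (contDiff_wField' S a) k)
      (contDiff_potential' S l) b).mul (contDiff_brAA D S k l b))

theorem contDiff_wAFA : ContDiff ℝ ∞ (wAFA D S Sm) :=
  ContDiff.sum fun k _ => ContDiff.sum fun l _ => contDiff_const.mul (ContDiff.sum fun b _ =>
    (contDiff_brwA D S k b).mul (contDiff_brFA D S k l b))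

theorem sum_brFw_mul_brAA (x : Spt) :
    ∑ k, ∑ l, sgn k * sgn l * ∑ b, brFw D S Sm k l b x * brAA D S Sm k l b x =
      -2 * wAFA D S Sm x :=
  sum_brC_F_w D (F := fun k l a => S.F a k l x) (fun l a => potential S Sm.c a l x)
    (fun a => wField S Sm.b a x) fun k l => field_antisymm S k l x

/-- Separates the gradient of `w`, needed for δ_c L₂, from the field strength terms that have to
cancel. -/
theorem sum_pd_brwA_mul_brAA (x : Spt) :
    ∑ k, ∑ l, sgn k * sgn l * ∑ b, pd l (brwA D S Sm k b) x * brAA D S Sm k l b x =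
      -1 * dwAAA D S Sm x - wAFA D S Sm x := by
  have h := sum_brC_gradient D (F := fun k l a => S.F a k l x) (fun l a => potential S Sm.c a l x)
    (fun a => wField S Sm.b a x) (fun k l => field_antisymm S k l x)
    (fun k a => pd k (wField S Sm.b a) x) (fun k l a => pd k (potential S Sm.c a l) x)
    fun k l => pd_potential_eq S k l x
  rw [neg_one_mul]
  refine Eq.trans ?_ h
  refine Finset.sum_congr rfl fun k _ => Finset.sum_congr rfl fun l _ => ?_
  congr 1
  refine Finset.sum_congr rfl fun b _ => ?_
  congr 1
  exact pd_brC D (contDiff_wField' S) (contDiff_potential' S k) b l x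

theorem brAA_swap (k l : Fin 4) (b : ι) (x : Spt) :
    brAA D S Sm l k b x = -brAA D S Sm k l b x := brC_swap D _ _ b

variable (τ : TimeOrdering (ι := ι) (κ := κ) G Sm cF)

theorem smear_smul_right (t : ℂ) (Y X : Wick ι κ) (g : Spt × Spt → ℂ) :
    smear S P ℓ Sm Y (t • X) g = t • smear S P ℓ Sm Y X g := by
  ext z; simp [smear, mul_assoc]

/-- The obstruction of pure Yang-Mills theory. -/
theorem obs_Q1YM_L1YM {g : Spt × Spt → ℂ} (hg : IsTest g) :
    obs τ S P ℓ (Q1YM D) (L1YM D) g =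
      Complex.I * (1 + cF) * ℓ 1 *
        (∑ l, contact (wAAA D S Sm l) (pdx l g) - contact (dwAAA D S Sm) g) +
      Complex.I * ∑ k, ∑ b, ∑ ν,
        strDelta' Sm.c ν (pdx k (smear S P ℓ Sm (br D ww (AA ν) b) (FAcur D k b) g)) := by
  have hw : ∀ k l b, ContDiff ℝ ∞ fun x => brwA D S Sm k b x * brAA D S Sm k l b x :=
    fun k l b => (contDiff_brwA D S k b).mul (contDiff_brAA D S k l b)
  have hT : ∀ k l b, delta (pdx l (smear S P ℓ Sm (br D ww (AA k) b)
      (dLeft (.inl (.F k l b)) (L1YM D)) g)) = 1 / 2 * (sgn k * sgn l) *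
      (ℓ 1 * (contact (fun x => pd l (brwA D S Sm k b) x * brAA D S Sm k l b x) g +
        contact (fun x => brwA D S Sm k b x * brAA D S Sm k l b x) (pdx l g))) := by
    intro k l b
    rw [dLeft_F_L1YM, smear_smul_right, pdx_smul,
      delta_isLinear.2 _ _ ((isTest_smear S P ℓ _ _ hg).pdx l),
      delta_pdx_smear_of_value S P ℓ (value_br_ww_AA D S P k b) (value_br_AA_AA D S P k l b)
        (contDiff_brwA D S k b) (contDiff_brAA D S k l b) l hg]
  -- Antisymmetry of i[A_k,A_l] reduces the second divergence term of the F-contraction to the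
  -- first, with `k` and `l` exchanged.
  have hT' : ∀ k l b, delta (pdx k (smear S P ℓ Sm (br D ww (AA l) b)
      (dLeft (.inl (.F k l b)) (L1YM D)) g)) = -delta (pdx k (smear S P ℓ Sm (br D ww (AA l) b)
      (dLeft (.inl (.F l k b)) (L1YM D)) g)) := by
    intro k l b
    have h1 : smear S P ℓ Sm (br D ww (AA l) b) (dLeft (.inl (.F k l b)) (L1YM D)) g =
        (-1 : ℂ) • smear S P ℓ Sm (br D ww (AA l) b) (dLeft (.inl (.F l k b)) (L1YM D)) g := by
      ext z
      simp only [dLeft_F_L1YM, smear, Pi.smul_apply, map_smul, value_br_AA_AA, smul_eq_mul,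
        brAA_swap D S k l, map_neg, smul_neg, mul_neg]
      rw [mul_comm (sgn l) (sgn k)]; ring
    rw [h1, pdx_smul, delta_isLinear.2 _ _ ((isTest_smear S P ℓ _ _ hg).pdx k), neg_one_mul]
  have hS : ∀ k l b, delta (smear S P ℓ Sm (br D (FF k l) ww b)
      (dLeft (.inl (.F k l b)) (L1YM D)) g) = 1 / 2 * (sgn k * sgn l) *
      (ℓ 1 * contact (fun x => brFw D S Sm k l b x * brAA D S Sm k l b x) g) := by
    intro k l b
    rw [dLeft_F_L1YM, smear_smul_right, delta_isLinear.2 _ _ (isTest_smear S P ℓ _ _ hg),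
      delta_smear_of_value S P ℓ (value_br_FF_ww D S P k l b) (value_br_AA_AA D S P k l b)
        (contDiff_brFw D S k l b) (contDiff_brAA D S k l b) hg]
  have hA : ∀ ν k b, smear S P ℓ Sm (br D ww (AA ν) b) (dLeft (.inl (.A k b)) (L1YM D)) g =
      (-1 : ℂ) • smear S P ℓ Sm (br D ww (AA ν) b) (FAcur D k b) g := by
    intro ν k b
    rw [smear_congr_right S P ℓ (value_dLeft_A_L1YM D S P k b), smear_smul_right]
  have hFA : ∀ k b, ContDiff ℝ ∞ fun x => ∑ l, sgn k * sgn l * brFA D S Sm k l b x := fun k b =>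
    ContDiff.sum fun l _ => contDiff_const.mul (contDiff_brFA D S k l b)
  have hloc : ∀ k b, delta (smear S P ℓ Sm (br D ww (AA k) b)
      (dLeft (.inl (.A k b)) (L1YM D)) g) = -(ℓ 1 * ∑ l, sgn k * sgn l *
        contact (fun x => brwA D S Sm k b x * brFA D S Sm k l b x) g) := by
    intro k b
    have h1 : ∀ l, ContDiff ℝ ∞ fun x => brwA D S Sm k b x * brFA D S Sm k l b x := fun l =>
      (contDiff_brwA D S k b).mul (contDiff_brFA D S k l b)
    have e1 : (fun x => brwA D S Sm k b x * ∑ l, sgn k * sgn l * brFA D S Sm k l b x) =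
        fun x => ∑ l, sgn k * sgn l * (brwA D S Sm k b x * brFA D S Sm k l b x) := by
      ext x
      rw [Finset.mul_sum]
      exact Finset.sum_congr rfl fun l _ => by ring
    rw [hA, delta_isLinear.2 _ _ (isTest_smear S P ℓ _ _ hg), neg_one_mul,
      delta_smear_of_value S P ℓ (value_br_ww_AA D S P k b) (value_FAcur D S P k b)
        (contDiff_brwA D S k b) (hFA k b) hg, e1,
      contact_sum (fun l _ => contDiff_const.mul (h1 l)) hg]
    simp only [contact_const_mul (h1 _) _ hg]
  have hnl : ∀ k b ν, strDelta' Sm.c ν (pdx k (smear S P ℓ Sm (br D ww (AA ν) b)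
      (dLeft (.inl (.A k b)) (L1YM D)) g)) = -strDelta' Sm.c ν (pdx k (smear S P ℓ Sm
      (br D ww (AA ν) b) (FAcur D k b) g)) := by
    intro k b ν
    have hlin := strDelta_isLinear Sm.c_smooth Sm.c_supp ν
    rw [hA, pdx_smul, strDelta'_eq_swap, strDelta'_eq_swap]
    exact (hlin.2 (-1) _ ((isTest_smear S P ℓ _ _ hg).pdx k).swap).trans (neg_one_mul _)
  rw [obs_Q1YM S P ℓ τ D (dLeft_w_L1YM D) hg]
  have c1 : contact (dwAAA D S Sm) g + contact (wAFA D S Sm) g = -∑ k, ∑ l, sgn k * sgn l *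
      ∑ b, contact (fun x => pd l (brwA D S Sm k b) x * brAA D S Sm k l b x) g := by
    rw [← contact_sum_sgn (fun k l b => (contDiff_pd (contDiff_brwA D S k b) l).mul
      (contDiff_brAA D S k l b)) hg]
    simp only [sum_pd_brwA_mul_brAA]
    rw [contact_sub (contDiff_const.mul (contDiff_dwAAA D S)) (contDiff_wAFA D S) hg,
      contact_const_mul (contDiff_dwAAA D S) _ hg]
    ring
  have c2 : ∑ k, ∑ l, sgn k * sgn l *
      ∑ b, contact (fun x => brFw D S Sm k l b x * brAA D S Sm k l b x) g =
      -2 * contact (wAFA D S Sm) g := by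
    rw [← contact_sum_sgn (fun k l b => (contDiff_brFw D S k l b).mul
      (contDiff_brAA D S k l b)) hg]
    simp only [sum_brFw_mul_brAA]
    rw [contact_const_mul (contDiff_wAFA D S) _ hg]
  have c3 : contact (wAFA D S Sm) g = ∑ k, ∑ l, sgn k * sgn l *
      ∑ b, contact (fun x => brwA D S Sm k b x * brFA D S Sm k l b x) g :=
    contact_sum_sgn (fun k l b => (contDiff_brwA D S k b).mul (contDiff_brFA D S k l b)) hg
  have c4 : ∑ l, contact (wAAA D S Sm l) (pdx l g) = ∑ k, ∑ l, sgn k * sgn l *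
      ∑ b, contact (fun x => brwA D S Sm k b x * brAA D S Sm k l b x) (pdx l g) := by
    rw [Finset.sum_comm]
    refine Finset.sum_congr rfl fun l _ => ?_
    have h1 : ∀ k, ContDiff ℝ ∞ fun x => ∑ b, brwA D S Sm k b x * brAA D S Sm k l b x := fun k =>
      ContDiff.sum fun b _ => hw k l b
    unfold wAAA
    rw [contact_sum (fun k _ => contDiff_const.mul (h1 k)) (hg.pdx l)]
    refine Finset.sum_congr rfl fun k _ => ?_
    rw [contact_const_mul (h1 k) _ (hg.pdx l), contact_sum (fun b _ => hw k l b) (hg.pdx l)]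
  have s1 : ∑ k, ∑ l, ∑ b, delta (pdx k (smear S P ℓ Sm (br D ww (AA l) b)
      (dLeft (.inl (.F k l b)) (L1YM D)) g)) = -∑ k, ∑ l, ∑ b, delta (pdx l (smear S P ℓ Sm
      (br D ww (AA k) b) (dLeft (.inl (.F k l b)) (L1YM D)) g)) := by
    simp only [hT', Finset.sum_neg_distrib]
    rw [Finset.sum_comm]
  have s2 : ∑ k, ∑ l, ∑ b, delta (pdx l (smear S P ℓ Sm (br D ww (AA k) b)
      (dLeft (.inl (.F k l b)) (L1YM D)) g)) = 1 / 2 * ℓ 1 *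
      (∑ l, contact (wAAA D S Sm l) (pdx l g) -
        (contact (dwAAA D S Sm) g + contact (wAFA D S Sm) g)) := by
    rw [c1, c4, sub_neg_eq_add, ← Finset.sum_add_distrib, Finset.mul_sum]
    refine Finset.sum_congr rfl fun k _ => ?_
    rw [← Finset.sum_add_distrib, Finset.mul_sum]
    refine Finset.sum_congr rfl fun l _ => ?_
    rw [← mul_add, ← Finset.sum_add_distrib, ← mul_assoc, Finset.mul_sum]
    refine Finset.sum_congr rfl fun b _ => ?_
    rw [hT]; ring
  have s3 : ∑ k, ∑ l, ∑ b, delta (smear S P ℓ Sm (br D (FF k l) ww b)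
      (dLeft (.inl (.F k l b)) (L1YM D)) g) = -ℓ 1 * contact (wAFA D S Sm) g := by
    have : ∑ k, ∑ l, ∑ b, delta (smear S P ℓ Sm (br D (FF k l) ww b)
      (dLeft (.inl (.F k l b)) (L1YM D)) g) = 1 / 2 * ℓ 1 * ∑ k, ∑ l, sgn k * sgn l *
      ∑ b, contact (fun x => brFw D S Sm k l b x * brAA D S Sm k l b x) g := by
      simp only [hS, Finset.mul_sum]
      refine Finset.sum_congr rfl fun k _ => Finset.sum_congr rfl fun l _ =>
        Finset.sum_congr rfl fun b _ => by ring
    rw [this, c2]; ring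
  have s4 : ∑ k, ∑ b, delta (smear S P ℓ Sm (br D ww (AA k) b)
      (dLeft (.inl (.A k b)) (L1YM D)) g) = -ℓ 1 * contact (wAFA D S Sm) g := by
    simp only [hloc, c3, Finset.mul_sum, ← Finset.sum_neg_distrib]
    refine Finset.sum_congr rfl fun k _ => ?_
    rw [Finset.sum_comm]
    exact Finset.sum_congr rfl fun l _ => Finset.sum_congr rfl fun b _ => by ring
  -- The term ⟨i[w,A_k]|i[F^{kl},A_l]⟩ drops out: it occurs with -(1+c_F) from the divergence of
  -- `F`, with c_F from the curl of `A`, and with 1 from the contraction of `F` with `A'`.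
  simp only [hnl, Finset.sum_neg_distrib, Finset.sum_add_distrib, Finset.sum_sub_distrib,
    ← Finset.mul_sum, s1, s2, s3, s4]
  ring

/-! ### The induced interaction -/

/-- The variation of `A` is ∂w. Each of the four factors of `A` in ⟨i[A,A]|i[A,A]⟩ contributes
equally, so -1/2 becomes -2. -/
theorem varC_L2YM (cF : ℂ) (x : Spt) : varC S P Sm ℓ (L2YM D cF) x =
    -2 * (1 + cF) * ℓ 1 * dwAAA D S Sm x := by
  set A : Fin 4 → ι → ℂ := fun k a => potential S Sm.c a k x with hA
  set E : Fin 4 → ι → ℂ := fun k a => pd k (wField S Sm.b a) x with hE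
  -- The potential is affine in the smearing function, so this is a polynomial in `t`.
  have hval : ∀ t : ℝ, ℓ (value S P (fun e => Sm.c e + t * Sm.dc e) Sm.b x (L2YM D cF)) =
      -(1 / 2 : ℂ) * (1 + cF) * ℓ 1 * ∑ k, ∑ l, sgn k * sgn l * ∑ b,
        brC D (fun a => A k a + t * E k a) (fun a => A l a + t * E l a) b *
        brC D (fun a => A k a + t * E k a) (fun a => A l a + t * E l a) b := by
    intro t
    have hAA : ∀ k a, value S P (fun e => Sm.c e + t * Sm.dc e) Sm.b x (AA k a) =
        algebraMap ℂ _ (A k a + t * E k a) := by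
      intro k a
      rw [value_AA, potential_add_smul S Sm.c_smooth Sm.c_supp Sm.dc_smooth Sm.dc_supp,
        potential_variation]
    have hbr := fun k l => value_br D S P (hAA k) (hAA l)
    have hip := fun k l => value_ip S P (hbr k l) (hbr k l)
    simp only [L2YM, map_smul, map_sum, hip, Algebra.algebraMap_eq_smul_one, smul_eq_mul]
    simp only [Finset.mul_sum]
    exact Finset.sum_congr rfl fun k _ => Finset.sum_congr rfl fun l _ =>
      Finset.sum_congr rfl fun b _ => by ring
  have hbr : ∀ k l b, HasDerivAt (fun t : ℝ =>
      brC D (fun a => A k a + t * E k a) (fun a => A l a + t * E l a) b)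
      (brC D (E k) (A l) b + brC D (A k) (E l) b) 0 := by
    intro k l b
    have h1 : ∀ k a, HasDerivAt (fun t : ℝ => A k a + (t : ℂ) * E k a) (E k a) 0 := by
      intro k a
      have := ((hasDerivAt_id (0 : ℝ)).ofReal_comp.mul_const (E k a)).const_add (A k a)
      simpa using this
    simp only [brC, ← Finset.sum_add_distrib]
    refine HasDerivAt.fun_sum fun a _ => HasDerivAt.fun_sum fun c _ => ?_
    refine (((h1 k a).mul (h1 l c)).const_mul _).congr_deriv ?_
    simp; ring
  have hd : HasDerivAt (fun t : ℝ =>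
      ℓ (value S P (fun e => Sm.c e + t * Sm.dc e) Sm.b x (L2YM D cF)))
      (-(1 / 2 : ℂ) * (1 + cF) * ℓ 1 * ∑ k, ∑ l, sgn k * sgn l * ∑ b,
        (2 * ((brC D (E k) (A l) b + brC D (A k) (E l) b) * brC D (A k) (A l) b))) 0 := by
    simp only [hval]
    refine HasDerivAt.const_mul _ (HasDerivAt.fun_sum fun k _ => HasDerivAt.fun_sum fun l _ =>
      HasDerivAt.const_mul _ (HasDerivAt.fun_sum fun b _ => ?_))
    refine ((hbr k l b).mul (hbr k l b)).congr_deriv ?_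
    simp; ring
  rw [varC, hd.deriv]
  have h1 : dwAAA D S Sm x =
      ∑ k, ∑ l, sgn k * sgn l * ∑ b, brC D (E k) (A l) b * brC D (A k) (A l) b := rfl
  have h2 : dwAAA D S Sm x =
      ∑ k, ∑ l, sgn k * sgn l * ∑ b, brC D (A k) (E l) b * brC D (A k) (A l) b := by
    rw [h1, sum_sgn_swap]
    refine Finset.sum_congr rfl fun k _ => Finset.sum_congr rfl fun l _ => ?_
    congr 1
    refine Finset.sum_congr rfl fun b _ => ?_
    rw [brC_swap D (A k) (E l), brC_swap D (A k) (A l), neg_mul_neg]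
  have h3 : ∑ k, ∑ l, sgn k * sgn l * ∑ b,
        (2 * ((brC D (E k) (A l) b + brC D (A k) (E l) b) * brC D (A k) (A l) b)) =
      2 * (dwAAA D S Sm x + dwAAA D S Sm x) := by
    nth_rewrite 2 [h2]
    rw [h1]
    simp only [add_mul, ← Finset.mul_sum, Finset.sum_add_distrib, mul_add, mul_left_comm _ (2 : ℂ)]
  rw [h3]; ring

theorem delta_smear_Q2YMdelta (cF : ℂ) (μ : Fin 4) {h : Spt × Spt → ℂ} (hh : IsTest h) :
    bilocal S P Sm ℓ (Q2YMdelta D cF μ) 1 delta h =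
      2 * (1 + cF) * ℓ 1 * contact (wAAA D S Sm μ) h := by
  have h1 : ∀ x, value S P Sm.c Sm.b x (Q2YMdelta D cF μ) =
      algebraMap ℂ _ (2 * (1 + cF) * wAAA D S Sm μ x) := by
    intro x
    have hip := fun ν => value_ip S P (fun b => value_br_AA_AA D S P (Sm := Sm) μ ν b x)
      (fun b => value_br_ww_AA D S P ν b x)
    simp only [Q2YMdelta, map_smul, map_sum, hip, Algebra.algebraMap_eq_smul_one, smul_smul,
      ← Finset.sum_smul]
    congr 1
    simp only [wAAA, Finset.mul_sum]
    refine Finset.sum_congr rfl fun ν _ => Finset.sum_congr rfl fun b _ => ?_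
    rw [brAA_swap D S ν μ]; ring
  rw [bilocal_eq, delta_smear_of_value S P ℓ h1 (w := fun _ => 1) (fun x => by simp)
    (contDiff_const.mul (contDiff_wAAA D S μ)) contDiff_const hh]
  simp only [mul_one]
  rw [contact_const_mul (contDiff_wAAA D S μ) _ hh]
  ring

/-! ### The second-order obstruction of QCD -/

/-- The local part of the quark-gluon cross-term cancels the quark-only obstruction. The remaining
string terms are divergences because both currents are conserved, but with the two points exchanged.
-/
theorem obs_QCD {g : Spt × Spt → ℂ} (hg : IsTest g) :
    obs τ S P ℓ (fun μ => Q1YM D μ + Q1min D G μ) (L1YM D + L1min D G) g =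
      Complex.I * (1 + cF) * ℓ 1 *
        (∑ l, contact (wAAA D S Sm l) (pdx l g) - contact (dwAAA D S Sm) g) +
      Complex.I * ∑ k, (pairW2 D S P Sm ℓ (cur D G k) (pdx k fun z => g (z.2, z.1)) -
        pairW2 D S P Sm ℓ (FAcur D k) (pdx k fun z => g (z.2, z.1))) := by
  rw [obs_add_left S P ℓ τ _ _ _ hg, obs_add_right S P ℓ τ _ _ _ hg,
    obs_add_right S P ℓ τ _ _ _ hg, obs_Q1min_L1YM S P ℓ τ D hg,
    obs_Q1min_L1min S P ℓ τ D hg, obs_Q1YM_L1min_eq S P ℓ τ D hg,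
    obs_Q1YM_L1YM D S P ℓ τ hg, sum_strDelta'_smear S P ℓ D (isConserved_cur S P D) hg,
    sum_strDelta'_smear S P ℓ D (isConserved_FAcur D S P) hg, Finset.sum_sub_distrib]
  ring

/-- Symmetrization makes the exchange of points in the string terms immaterial, and contact terms do
not see it. The factor 2 in `Q₂` offsets the average on the right, which carries 1/2. -/
theorem obs2_QCD {g : Spt × Spt → ℂ} (hg : IsTest g) :
    obs2 τ S P ℓ (fun μ => Q1YM D μ + Q1min D G μ) (L1YM D + L1min D G) g =
      resolution S P Sm ℓ (L2YM D cF + L2min)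
        (fun μ => Q2YM D cF S P Sm ℓ μ + Q2min D S P Sm ℓ μ) g := by
  have hL : (L2YM D cF + L2min : Wick ι κ) = L2YM D cF := add_zero _
  have hd : delta (fun z => varC S P Sm ℓ (L2YM D cF) z.1 * g z) =
      -2 * (1 + cF) * ℓ 1 * contact (dwAAA D S Sm) g := by
    simp only [varC_L2YM]
    exact contact_const_mul (contDiff_dwAAA D S) _ hg
  have hs : (fun z : Spt × Spt => (fun w : Spt × Spt => g (w.2, w.1)) (z.2, z.1)) = g := rfl
  simp only [obs2, resolution, Kern.symm, Kern.swap, obs_QCD D S P ℓ τ hg,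
    obs_QCD D S P ℓ τ hg.swap, hL, hd, contact_swap, Kern.dx, Pi.add_apply, Q2YM, Q2min,
    delta_smear_Q2YMdelta D S P ℓ cF _ (hg.pdx _),
    delta_smear_Q2YMdelta D S P ℓ cF _ (hg.swap.pdx _)]
  simp only [Finset.sum_add_distrib, Finset.sum_sub_distrib, Finset.sum_neg_distrib,
    ← Finset.mul_sum]
  ring

end YangMills

end StringQCD

/-! ### The proposition -/

theorem propositionp {ι κ : Type*} [Fintype ι] [DecidableEq ι] [Fintype κ] [DecidableEq κ]
    (D : StringQCD.ColorData ι κ) (G : StringQCD.DiracMatrices) (Sm : StringQCD.Smearing) (cF : ℂ)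
    (τ : StringQCD.TimeOrdering (ι := ι) (κ := κ) G Sm cF)
    (S : StringQCD.GluonSolution ι) (n : ℕ) (P : StringQCD.QuarkSolution κ G n)
    (ℓ : Module.Dual ℂ (ExteriorAlgebra ℂ (Fin n → ℂ)))
    (g : StringQCD.Spt × StringQCD.Spt → ℂ) (hg : StringQCD.IsTest g) :
    -- the second-order obstruction of QCD is resolved
    StringQCD.obs2 τ S P ℓ
        (fun μ => StringQCD.Q1YM D μ + StringQCD.Q1min D G μ)
        (StringQCD.L1YM D + StringQCD.L1min D G) g =
      StringQCD.resolution S P Sm ℓ (StringQCD.L2YM D cF + StringQCD.L2min)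
        (fun μ => StringQCD.Q2YM D cF S P Sm ℓ μ + StringQCD.Q2min D S P Sm ℓ μ) g ∧
    -- the quark-only obstruction is `⟨i[w,A_ν] | j^ν⟩ · iδ`
    StringQCD.obs τ S P ℓ (StringQCD.Q1min D G) (StringQCD.L1min D G) g =
      Complex.I * StringQCD.bilocal S P Sm ℓ
        (∑ ν, StringQCD.ip (StringQCD.br D StringQCD.ww (StringQCD.AA ν)) (StringQCD.cur D G ν))
        1 StringQCD.delta g ∧
    -- the quark-gluon cross-term is `-⟨i[w,A_ν] | j'^k⟩ · (δ^ν_k - I'^ν ∂_k) iδ`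
    StringQCD.obs τ S P ℓ (StringQCD.Q1YM D) (StringQCD.L1min D G) g =
      -(Complex.I * StringQCD.bilocal S P Sm ℓ
        (∑ ν, StringQCD.ip (StringQCD.br D StringQCD.ww (StringQCD.AA ν)) (StringQCD.cur D G ν))
        1 StringQCD.delta g) +
      Complex.I * ∑ ν, ∑ k, ∑ a, StringQCD.bilocal S P Sm ℓ
        (StringQCD.br D StringQCD.ww (StringQCD.AA ν) a) (StringQCD.cur D G k a)
        ((StringQCD.strDelta' Sm.c ν).dx k) g ∧
    -- the other cross-term vanishes
    StringQCD.obs τ S P ℓ (StringQCD.Q1min D G) (StringQCD.L1YM D) g = 0 := by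
  refine ⟨StringQCD.obs2_QCD D S P ℓ τ hg, StringQCD.obs_Q1min_L1min S P ℓ τ D hg, ?_,
    StringQCD.obs_Q1min_L1YM S P ℓ τ D hg⟩
  -- The minus sign of the string term is the one in the distributional derivative `Kern.dx`.
  rw [StringQCD.obs_Q1YM_L1min_eq S P ℓ τ D hg, sub_eq_add_neg, ← mul_neg]
  congr 2
  simp only [StringQCD.bilocal_eq, StringQCD.Kern.dx, Finset.sum_neg_distrib]
  rw [Finset.sum_congr rfl fun k _ => Finset.sum_comm, Finset.sum_comm, mul_neg]
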